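/- **Setting.** Let $m\ge 1$. For $i=1,\dots,m$ let $f_i(x,y_i)=\mathbb E_{\xi\sim\mathcal P_i}[f_i(x,y_i;\xi)]$, $g_i(x,y_i)=\mathbb E_{\zeta\sim\mathcal Q_i}[g_i(x,y_i;\zeta)]$ with $x\in\mathbb R^{d_x}$, $y_i\in\mathbb R^{d_{y,i}}$, where $f_i,g_i$ are continuously differentiable and $\nabla_yg_i$ is differentiable (so that $\nabla^2_{xy}g_i$, $\nabla^2_{yy}g_i$ exist), and for each sample $f_i(\cdot;\xi)$, $g_i(\cdot;\zeta)$ and $\nabla_yg_i(\cdot;\zeta)$ are differentiable. Put $$F(x)=\frac1m\sum_{i=1}^m f_i(x,y_i(x)),\qquad y_i(x)=\arg\min_{y} g_i(x,y).$$ Norms are Euclidean norms of vectors and spectral norms of matrices. Assume, for all $i$, with constants $\lambda,L_g>0$ and $L_{fx},L_{fy},L_{gy},L_{gxy},L_{gyy},C_{fx},C_{fy},\tilde C_{gyy},\sigma\ge 0$: 1. For every $x$, $g_i(x,\cdot)$ is $L_g$-smooth and $\lambda$-strongly convex. 2. (i) For every sample, $\nabla_xf_i(\cdot;\xi)$, $\nabla_yf_i(\cdot;\xi)$,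 $\nabla_yg_i(\cdot;\zeta)$, $\nabla^2_{xy}g_i(\cdot;\zeta)$, $\nabla^2_{yy}g_i(\cdot;\zeta)$ are Lipschitz in $(x,y_i)$ with constants $L_{fx},L_{fy},L_{gy},L_{gxy},L_{gyy}$; (ii) $\|\nabla_xf_i\|\le C_{fx}$ and $\|\nabla_yf_i\|\le C_{fy}$; (iii) these five stochastic derivatives are unbiased estimators of the corresponding derivatives of $f_i$, $g_i$, with variance at most $\sigma^2$. 3. $\|\nabla^2_{yy}g_i(x,y_i;\zeta)\|\le\tilde C_{gyy}$ for all $x,y_i,\zeta$. **Algorithm (BSVRB$^{\rm v2}$).** Let $V=C_{fy}/\lambda$, let $\Pi_V$ be the Euclidean projection onto the ball $\{\|v\|\le V\}$, and $\nabla_v\phi_i(v,x,y_i;\mathcal B,\widetilde{\mathcal B})=\nabla_{yy}^2g_i(x,y_i;\widetilde{\mathcal B})v-\nabla_yf_i(x,y_i;\mathcal B)$, where a batch as argument means the average over the batch. Start from $x_0=x_1$, $y_0=y_1$, $v_0=v_1$ with $\|v_{i,1}\|\le V$. One initial mini-batch pair $\mathcal B_i^0\sim\mathcal P_i$, $\widetilde{\mathcal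 B}_i^0\sim\mathcal Q_i$ of size $S$ for every block $i$ gives $s_{i,1}=\nabla_yg_i(x_1,y_{i,1};\widetilde{\mathcal B}_i^0)$, $u_{i,1}=\nabla_v\phi_i(v_{i,1},x_1,y_{i,1};\mathcal B_i^0,\widetilde{\mathcal B}_i^0)$ and $z_1=\frac1m\sum_{i=1}^m[\nabla_xf_i(x_1,y_{i,1};\mathcal B_i^0)-\nabla^2_{xy}g_i(x_1,y_{i,1};\widetilde{\mathcal B}_i^0)v_{i,1}]$. At iteration $t=1,2,\dots$ draw a uniformly random set $\mathcal I_t$ of $I$ of the $m$ blocks and independent batches $\mathcal B_i^t\sim\mathcal P_i$, $\widetilde{\mathcal B}_i^t\sim\mathcal Q_i$ of size $B$ (all independent of each other and of the past). For $i\in\mathcal I_t$ set $$s_{i,t+1}=(1-\alpha_t)s_{i,t}+\alpha_t\nabla_yg_i(x_t,y_{i,t};\widetilde{\mathcal B}_i^t)+\gamma_t\big(\nabla_yg_i(x_t,y_{i,t};\widetilde{\mathcal B}_i^t)-\nabla_yg_i(x_{t-1},y_{i,t-1};\widetilde{\mathcal B}_i^t)\big),$$ $$u_{i,t+1}=(1-\bar\alpha_t)u_{i,t}+\bar\alpha_t\nabla_v\phi_i(v_{i,t},x_t,y_{i,t};\mathcal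 B_i^t,\widetilde{\mathcal B}_i^t)+\bar\gamma_t\big(\nabla_v\phi_i(v_{i,t},x_t,y_{i,t};\mathcal B_i^t,\widetilde{\mathcal B}_i^t)-\nabla_v\phi_i(v_{i,t-1},x_{t-1},y_{i,t-1};\mathcal B_i^t,\widetilde{\mathcal B}_i^t)\big),$$ with $\gamma_t=\frac{m-I}{I(1-\alpha_t)}+(1-\alpha_t)$ and $\bar\gamma_t=\frac{m-I}{I(1-\bar\alpha_t)}+(1-\bar\alpha_t)$; for $i\notin\mathcal I_t$ keep $s_{i,t+1}=s_{i,t}$, $u_{i,t+1}=u_{i,t}$. Let $G_t=\frac1I\sum_{i\in\mathcal I_t}[\nabla_xf_i(x_t,y_{i,t};\mathcal B_i^t)-\nabla^2_{xy}g_i(x_t,y_{i,t};\widetilde{\mathcal B}_i^t)v_{i,t}]$, let $\widetilde G_t$ be the same expression, with the same $\mathcal I_t$ and batches, at $(x_{t-1},y_{t-1},v_{t-1})$, and set $$z_{t+1}=(1-\beta_t)(z_t-\widetilde G_t)+G_t,\quad y_{t+1}=y_t-\tau\tau_ts_t,\quad v_{i,t+1}=\Pi_V[v_{i,t}-\bar\tau_tu_{i,t}],\quad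 x_{t+1}=x_t-\eta_tz_{t+1}.$$ No Hessian inverse is computed. **Theorem.** Write $\rho=\frac{\mathbb I(I<m)}{I}+\frac1B$. Let $0<\tau\le\frac{2}{3L_g}$ and $\kappa\in(0,1]$. There are constants $L_F,L_{\phi v},C_6',C_8',C_9',C_{11}',C_{\bar\tau},c_0>0$, depending only on the constants in Assumptions 1–3, $\tau$ and $\kappa$, and for all $\Delta,D_y,c_S>0$ a constant $C_T>0$, depending in addition only on $\Delta,D_y,c_S$, such that for every problem satisfying Assumptions 1–3 the function $F$ is differentiable with $L_F$-Lipschitz gradient, and the following holds. Let $1\le I\le m$, $B\ge1$, $\epsilon>0$ with $\epsilon^2\le c_0\rho$. Let the step sizes satisfy, for every $t$, $$\alpha_t\le\min\Big\{\tfrac12,\tfrac{B\epsilon^2}{18C_9'}\Big\},\quad \bar\alpha_t\le\min\Big\{\tfrac12,\tfrac{\epsilon^2}{18C_9'\rho}\Big\},\quad \beta_t\le\tfrac{\epsilon^2}{18C_9'\rho},\quad \tau_t\le\sqrt{\tfrac{C_8'\min\{1,C_{\bar\tau}\}}{18C_9'}}\,\tfrac{I}{m}\,\rho^{-1/2}\epsilon,$$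 $$\bar\tau_t\le\min\Big\{\tfrac{\lambda}{8L_{\phi v}^2},\tfrac\lambda2,\tfrac1\lambda,\tfrac1{2\sqrt{C_6'}},\tfrac{\sqrt{C_{\bar\tau}}I}{m}\sqrt{\bar\alpha_t}\Big\},\qquad \eta_t\le\min\Big\{\tfrac1{2L_F},\tfrac{\sqrt{C_{11}'}I}{m}\rho^{-1/2}\epsilon\Big\},$$ and let each of them be at least $\kappa$ times its bound. Let $F(x_1)-\inf F\le\Delta$, $\sum_{i=1}^m\|y_{i,1}-y_i(x_1)\|^2\le D_y m$, $\|v_{i,1}\|\le V$ for all $i$, and let the initial mini-batch size satisfy $S\ge c_S/\epsilon$. Then for every integer $$T\ge C_T\Big(\frac{m\epsilon^{-3}\,\mathbb I(I<m)}{I\sqrt I}+\frac{m\epsilon^{-3}}{I\sqrt B}\Big)$$ the iterates satisfy $\mathbb E\big[\frac1T\sum_{t=1}^T\|\nabla F(x_t)\|^2\big]\le\epsilon^2$. -/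

import Mathlib

open MeasureTheory ProbabilityTheory Finset

noncomputable section

namespace BSVRB

/-- Euclidean space `ℝⁿ`. -/
abbrev E (n : ℕ) : Type := EuclideanSpace ℝ (Fin n)

/-! ### Partial derivatives of a function of two vector variables -/

section Partial

variable {a b : ℕ}

/-- Partial gradient `∇ₓ h(x, y)`. -/
def gradX (h : E a → E b → ℝ) (x : E a) (y : E b) : E a :=
  gradient (fun x' => h x' y) x

/-- Partial gradient `∇_y h(x, y)`. -/
def gradY (h : E a → E b → ℝ) (x : E a) (y : E b) : E b :=
  gradient (fun y' => h x y') y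

/-- The Hessian `∇²_yy h(x, y)`, the derivative of `∇_y h(x, ·)` at `y`. -/
def hessYY (h : E a → E b → ℝ) (x : E a) (y : E b) : E b →L[ℝ] E b :=
  fderiv ℝ (fun y' => gradY h x y') y

/-- The Jacobian `∇²_xy h(x, y)`, the `a × b` matrix with entries `∂²h / ∂x_k ∂y_l`: the transpose
of the derivative of `∇_y h(·, y)` at `x`. -/
def hessXY (h : E a → E b → ℝ) (x : E a) (y : E b) : E b →L[ℝ] E a :=
  ContinuousLinearMap.adjoint (fderiv ℝ (fun x' => gradY h x' y) x)

end Partial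

/-! ### The multi-block bilevel problem -/

/-- Data of a multi-block bilevel problem: stochastic upper objectives `f_i(x, y_i; ξ)` with
`ξ ∼ P_i` and stochastic lower objectives `g_i(x, y_i; ζ)` with `ζ ∼ Q_i`, for `m` blocks. -/
structure Problem (m dx : ℕ) (dy : Fin m → ℕ) (Ξ Z : Type*)
    [MeasurableSpace Ξ] [MeasurableSpace Z] where
  f : (i : Fin m) → Ξ → E dx → E (dy i) → ℝ
  g : (i : Fin m) → Z → E dx → E (dy i) → ℝ
  P : Fin m → Measure Ξ
  Q : Fin m → Measure Z
  isProbP : ∀ i, IsProbabilityMeasure (P i)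
  isProbQ : ∀ i, IsProbabilityMeasure (Q i)

attribute [instance] Problem.isProbP Problem.isProbQ

namespace Problem

variable {m dx : ℕ} {dy : Fin m → ℕ} {Ξ Z : Type*} [MeasurableSpace Ξ] [MeasurableSpace Z]

/-- `f_i(x, y) = E_ξ f_i(x, y; ξ)`. -/
def fbar (p : Problem m dx dy Ξ Z) (i : Fin m) (x : E dx) (y : E (dy i)) : ℝ :=
  ∫ ξ, p.f i ξ x y ∂(p.P i)

/-- `g_i(x, y) = E_ζ g_i(x, y; ζ)`. -/
def gbar (p : Problem m dx dy Ξ Z) (i : Fin m) (x : E dx) (y : E (dy i)) : ℝ :=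
  ∫ ζ, p.g i ζ x y ∂(p.Q i)

/-- `y_i(x)`, the minimizer of `g_i(x, ·)` (some point if there is none). -/
def ySol (p : Problem m dx dy Ξ Z) (i : Fin m) (x : E dx) : E (dy i) :=
  Classical.epsilon fun y => ∀ y', p.gbar i x y ≤ p.gbar i x y'

/-- The objective `F(x) = (1/m) ∑ᵢ f_i(x, y_i(x))`. -/
def F (p : Problem m dx dy Ξ Z) (x : E dx) : ℝ :=
  (m : ℝ)⁻¹ * ∑ i, p.fbar i x (p.ySol i x)

end Problem

/-! ### Assumptions -/

/-- Constants in the assumptions. -/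
structure Consts where
  lam : ℝ
  Lg : ℝ
  Lfx : ℝ
  Lfy : ℝ
  Lgy : ℝ
  Lgxy : ℝ
  Lgyy : ℝ
  Cfx : ℝ
  Cfy : ℝ
  Cgyy : ℝ
  σ : ℝ

/-- Sign conditions on the constants. -/
structure Consts.Valid (c : Consts) : Prop where
  lam_pos : 0 < c.lam
  Lg_pos : 0 < c.Lg
  Lfx_nonneg : 0 ≤ c.Lfx
  Lfy_nonneg : 0 ≤ c.Lfy
  Lgy_nonneg : 0 ≤ c.Lgy
  Lgxy_nonneg : 0 ≤ c.Lgxy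
  Lgyy_nonneg : 0 ≤ c.Lgyy
  Cfx_nonneg : 0 ≤ c.Cfx
  Cfy_nonneg : 0 ≤ c.Cfy
  Cgyy_nonneg : 0 ≤ c.Cgyy
  σ_nonneg : 0 ≤ c.σ

/-- The radius `V = C_fy / λ` of the ball containing the Hessian-inverse-vector products. -/
def Consts.V (c : Consts) : ℝ := c.Cfy / c.lam

/-- `h` is `L`-Lipschitz with respect to the Euclidean norm of the pair `(x, y)`. -/
def JointLipschitz {a b : ℕ} {H : Type*} [NormedAddCommGroup H] (L : ℝ) (h : E a → E b → H) :
    Prop :=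
  ∀ x x' y y', ‖h x y - h x' y'‖ ≤ L * √(‖x - x'‖ ^ 2 + ‖y - y'‖ ^ 2)

/-- `X` is an unbiased estimator of `m₀` with variance at most `σ²`. -/
structure UnbiasedBddVar {S H : Type*} [MeasurableSpace S] [NormedAddCommGroup H] [NormedSpace ℝ H]
    (ν : Measure S) (X : S → H) (m₀ : H) (σ : ℝ) : Prop where
  stronglyMeasurable : StronglyMeasurable X
  integrable : Integrable X ν
  mean : ∫ s, X s ∂ν = m₀
  integrable_sq : Integrable (fun s => ‖X s - m₀‖ ^ 2) ν
  variance_le : ∫ s, ‖X s - m₀‖ ^ 2 ∂ν ≤ σ ^ 2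

/-- Standing regularity: the objectives are well-defined expectations, `f_i` and `g_i` are
continuously differentiable, and `∇_y g_i` is differentiable, so that the Jacobian and the Hessian
exist; likewise for the objectives at a fixed sample. -/
structure Problem.Regular {m dx : ℕ} {dy : Fin m → ℕ} {Ξ Z : Type*} [MeasurableSpace Ξ]
    [MeasurableSpace Z] (p : Problem m dx dy Ξ Z) : Prop where
  f_integrable : ∀ i x y, Integrable (fun ξ => p.f i ξ x y) (p.P i)
  g_integrable : ∀ i x y, Integrable (fun ζ => p.g i ζ x y) (p.Q i)
  f_diff : ∀ i ξ, Differentiable ℝ fun q : E dx × E (dy i) => p.f i ξ q.1 q.2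
  g_diff : ∀ i ζ, Differentiable ℝ fun q : E dx × E (dy i) => p.g i ζ q.1 q.2
  g_diff2 : ∀ i ζ, Differentiable ℝ fun q : E dx × E (dy i) => gradY (p.g i ζ) q.1 q.2
  fbar_C1 : ∀ i, ContDiff ℝ 1 fun q : E dx × E (dy i) => p.fbar i q.1 q.2
  gbar_C1 : ∀ i, ContDiff ℝ 1 fun q : E dx × E (dy i) => p.gbar i q.1 q.2
  gbar_diff2 : ∀ i, Differentiable ℝ fun q : E dx × E (dy i) => gradY (p.gbar i) q.1 q.2

/-- The assumptions on the problem. -/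
structure Problem.Assumptions {m dx : ℕ} {dy : Fin m → ℕ} {Ξ Z : Type*} [MeasurableSpace Ξ]
    [MeasurableSpace Z] (p : Problem m dx dy Ξ Z) (c : Consts) : Prop extends p.Regular where
  /- `g_i(x, ·)` is `L_g`-smooth and `λ`-strongly convex. -/
  g_smooth : ∀ i x y y',
    ‖gradY (p.gbar i) x y - gradY (p.gbar i) x y'‖ ≤ c.Lg * ‖y - y'‖
  g_strongConvex : ∀ i x y y',
    p.gbar i x y' + inner ℝ (gradY (p.gbar i) x y') (y - y') + c.lam / 2 * ‖y - y'‖ ^ 2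
      ≤ p.gbar i x y
  /- Lipschitz continuity of the stochastic derivatives. -/
  lip_fx : ∀ i ξ, JointLipschitz c.Lfx (gradX (p.f i ξ))
  lip_fy : ∀ i ξ, JointLipschitz c.Lfy (gradY (p.f i ξ))
  lip_gy : ∀ i ζ, JointLipschitz c.Lgy (gradY (p.g i ζ))
  lip_gxy : ∀ i ζ, JointLipschitz c.Lgxy (hessXY (p.g i ζ))
  lip_gyy : ∀ i ζ, JointLipschitz c.Lgyy (hessYY (p.g i ζ))
  /- Bounded partial gradients of `f_i`. -/
  bdd_fx : ∀ i x y, ‖gradX (p.fbar i) x y‖ ^ 2 ≤ c.Cfx ^ 2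
  bdd_fy : ∀ i x y, ‖gradY (p.fbar i) x y‖ ^ 2 ≤ c.Cfy ^ 2
  /- Unbiased stochastic derivatives with bounded variance. -/
  var_fx : ∀ i x y, UnbiasedBddVar (p.P i) (fun ξ => gradX (p.f i ξ) x y)
    (gradX (p.fbar i) x y) c.σ
  var_fy : ∀ i x y, UnbiasedBddVar (p.P i) (fun ξ => gradY (p.f i ξ) x y)
    (gradY (p.fbar i) x y) c.σ
  var_gy : ∀ i x y, UnbiasedBddVar (p.Q i) (fun ζ => gradY (p.g i ζ) x y)
    (gradY (p.gbar i) x y) c.σ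
  var_gxy : ∀ i x y, UnbiasedBddVar (p.Q i) (fun ζ => hessXY (p.g i ζ) x y)
    (hessXY (p.gbar i) x y) c.σ
  var_gyy : ∀ i x y, UnbiasedBddVar (p.Q i) (fun ζ => hessYY (p.g i ζ) x y)
    (hessYY (p.gbar i) x y) c.σ
  /- Uniformly bounded stochastic Hessians. -/
  bdd_gyy : ∀ i ζ x y, ‖hessYY (p.g i ζ) x y‖ ^ 2 ≤ c.Cgyy ^ 2

/-! ### Sampling -/

/-- Two batches of `n` samples `ξ` and `n` samples `ζ` for each of the `m` blocks. -/
abbrev Batches (m n : ℕ) (Ξ Z : Type*) : Type _ :=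
  (Fin m → Fin n → Ξ) × (Fin m → Fin n → Z)

/-- The randomness of one iteration: a set of blocks, and the two batches of each block (only
those of the blocks in the set are used). -/
abbrev IterSample (m B : ℕ) (Ξ Z : Type*) : Type _ :=
  Finset (Fin m) × Batches m B Ξ Z

/-- Law of the batches: all samples independent, `ξ ∼ P_i` and `ζ ∼ Q_i` for block `i`. -/
def batchesLaw {m dx : ℕ} {dy : Fin m → ℕ} {Ξ Z : Type*} [MeasurableSpace Ξ] [MeasurableSpace Z]
    (p : Problem m dx dy Ξ Z) (n : ℕ) : Measure (Batches m n Ξ Z) :=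
  (Measure.pi fun i => Measure.pi fun _ : Fin n => p.P i).prod
    (Measure.pi fun i => Measure.pi fun _ : Fin n => p.Q i)

/-- Law of one iteration: `I` of the `m` blocks uniformly at random, independent of the batches. -/
def iterLaw {m dx : ℕ} {dy : Fin m → ℕ} {Ξ Z : Type*} [MeasurableSpace Ξ] [MeasurableSpace Z]
    (p : Problem m dx dy Ξ Z) (I B : ℕ) : Measure (IterSample m B Ξ Z) :=
  (uniformOn {A : Finset (Fin m) | A.card = I}).prod (batchesLaw p B)

/-- `init` is the initial mini-batch (of size `S` for every block) and `smp t` the randomness of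
iteration `t`; all of them are independent. -/
structure IsSampling {m dx : ℕ} {dy : Fin m → ℕ} {Ξ Z : Type*} [MeasurableSpace Ξ]
    [MeasurableSpace Z] {Ω : Type*} [MeasurableSpace Ω] (p : Problem m dx dy Ξ Z) (I B S : ℕ)
    (μ : Measure Ω) (init : Ω → Batches m S Ξ Z) (smp : ℕ → Ω → IterSample m B Ξ Z) : Prop where
  init_measurable : Measurable init
  smp_measurable : ∀ t, Measurable (smp t)
  init_law : μ.map init = batchesLaw p S
  smp_law : ∀ t, μ.map (smp t) = iterLaw p I B
  smp_indep : iIndepFun smp μ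
  init_indep : IndepFun init (fun ω t => smp t ω) μ

/-! ### The algorithm -/

/-- Average of `φ` over a batch. -/
def batchMean {S H : Type*} [AddCommGroup H] [Module ℝ H] {n : ℕ} (φ : S → H) (b : Fin n → S) :
    H :=
  (n : ℝ)⁻¹ • ∑ k, φ (b k)

/-- Euclidean projection onto the closed ball of radius `V ≥ 0` around `0`. -/
def projBall {n : ℕ} (V : ℝ) (v : E n) : E n :=
  if ‖v‖ ≤ V then v else (V / ‖v‖) • v

/-- Step size and momentum sequences: `α`, `α'` (for `ᾱ`), `β`, `τy` (for `τ_t`),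
`τv` (for `τ̄_t`) and `η`. -/
structure Steps where
  α : ℕ → ℝ
  α' : ℕ → ℝ
  β : ℕ → ℝ
  τy : ℕ → ℝ
  τv : ℕ → ℝ
  η : ℕ → ℝ

/-- State of the algorithm: current and previous `x`, `y`, `v`, and the estimators `s`, `u`, `z`. -/
structure State (m dx : ℕ) (dy : Fin m → ℕ) where
  x : E dx
  xPrev : E dx
  y : (i : Fin m) → E (dy i)
  yPrev : (i : Fin m) → E (dy i)
  v : (i : Fin m) → E (dy i)
  vPrev : (i : Fin m) → E (dy i)
  s : (i : Fin m) → E (dy i)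
  u : (i : Fin m) → E (dy i)
  z : E dx

section Algorithm

variable {m dx : ℕ} {dy : Fin m → ℕ} {Ξ Z : Type*} [MeasurableSpace Ξ] [MeasurableSpace Z]

/-- `∇_y g_i(x, y_i; B̃_i)`. -/
def gradGHat (p : Problem m dx dy Ξ Z) {n : ℕ} (b : Batches m n Ξ Z) (i : Fin m) (x : E dx)
    (y : E (dy i)) : E (dy i) :=
  batchMean (fun ζ => gradY (p.g i ζ) x y) (b.2 i)

/-- `∇_v φ_i(v, x, y_i; B_i, B̃_i) = ∇²_yy g_i(x, y_i; B̃_i) v - ∇_y f_i(x, y_i; B_i)`. -/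
def gradPhiHat (p : Problem m dx dy Ξ Z) {n : ℕ} (b : Batches m n Ξ Z) (i : Fin m)
    (v : E (dy i)) (x : E dx) (y : E (dy i)) : E (dy i) :=
  (batchMean (fun ζ => hessYY (p.g i ζ) x y) (b.2 i)) v
    - batchMean (fun ξ => gradY (p.f i ξ) x y) (b.1 i)

/-- The average over the blocks `i ∈ A` of `∇ₓ f_i(x, y_i; B_i) - ∇²_xy g_i(x, y_i; B̃_i) v_i`. -/
def hyperGradHat (p : Problem m dx dy Ξ Z) {n : ℕ} (b : Batches m n Ξ Z) (A : Finset (Fin m))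
    (x : E dx) (y v : (i : Fin m) → E (dy i)) : E dx :=
  (A.card : ℝ)⁻¹ • ∑ i ∈ A,
    (batchMean (fun ξ => gradX (p.f i ξ) x (y i)) (b.1 i)
      - (batchMean (fun ζ => hessXY (p.g i ζ) x (y i)) (b.2 i)) (v i))

/-- `γ = (m - I) / (I (1 - α)) + (1 - α)`. -/
def gam (m I : ℕ) (α : ℝ) : ℝ := ((m : ℝ) - I) / (I * (1 - α)) + (1 - α)

/-- Initial state: `x₀ = x₁`, `y₀ = y₁`, `v₀ = v₁`, and `s₁`, `u₁`, `z₁` computed from the initial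
mini-batch of all blocks. -/
def initState (p : Problem m dx dy Ξ Z) {S : ℕ} (b : Batches m S Ξ Z) (x₁ : E dx)
    (y₁ v₁ : (i : Fin m) → E (dy i)) : State m dx dy where
  x := x₁
  xPrev := x₁
  y := y₁
  yPrev := y₁
  v := v₁
  vPrev := v₁
  s := fun i => gradGHat p b i x₁ (y₁ i)
  u := fun i => gradPhiHat p b i (v₁ i) x₁ (y₁ i)
  z := hyperGradHat p b univ x₁ y₁ v₁

/-- One iteration of the algorithm, with block set `w.1` and batches `w.2`. -/
def step (p : Problem m dx dy Ξ Z) (I : ℕ) {B : ℕ} (V τ : ℝ) (h : Steps) (t : ℕ)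
    (w : IterSample m B Ξ Z) (q : State m dx dy) : State m dx dy :=
  let z' : E dx := (1 - h.β t) • (q.z - hyperGradHat p w.2 w.1 q.xPrev q.yPrev q.vPrev)
    + hyperGradHat p w.2 w.1 q.x q.y q.v
  { x := q.x - h.η t • z'
    xPrev := q.x
    y := fun i => q.y i - (τ * h.τy t) • q.s i
    yPrev := q.y
    v := fun i => projBall V (q.v i - h.τv t • q.u i)
    vPrev := q.v
    s := fun i => if i ∈ w.1 then
        (1 - h.α t) • q.s i + h.α t • gradGHat p w.2 i q.x (q.y i)
          + gam m I (h.α t) •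
            (gradGHat p w.2 i q.x (q.y i) - gradGHat p w.2 i q.xPrev (q.yPrev i))
      else q.s i
    u := fun i => if i ∈ w.1 then
        (1 - h.α' t) • q.u i + h.α' t • gradPhiHat p w.2 i (q.v i) q.x (q.y i)
          + gam m I (h.α' t) •
            (gradPhiHat p w.2 i (q.v i) q.x (q.y i)
              - gradPhiHat p w.2 i (q.vPrev i) q.xPrev (q.yPrev i))
      else q.u i
    z := z' }

/-- The states of the algorithm. Iterations are counted from `0`, so that
`(run … t ω).x` is the iterate `x_{t+1}` when they are counted from `1`. -/
def run (p : Problem m dx dy Ξ Z) (I : ℕ) {B S : ℕ} {Ω : Type*} (V τ : ℝ) (h : Steps)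
    (x₁ : E dx) (y₁ v₁ : (i : Fin m) → E (dy i))
    (init : Ω → Batches m S Ξ Z) (smp : ℕ → Ω → IterSample m B Ξ Z) :
    ℕ → Ω → State m dx dy
  | 0, ω => initState p (init ω) x₁ y₁ v₁
  | t + 1, ω => step p I V τ h t (smp t ω) (run p I V τ h x₁ y₁ v₁ init smp t ω)

end Algorithm

/-! ### Step sizes and iteration complexity -/

/-- `𝕀(I < m) / I + 1 / B`. -/
def rho (m I B : ℕ) : ℝ := (if I < m then 1 / (I : ℝ) else 0) + 1 / B

/-- `m ε⁻³ 𝕀(I < m) / (I √I) + m ε⁻³ / (I √B)`. -/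
def rate (m I B : ℕ) (ε : ℝ) : ℝ :=
  (if I < m then m / (ε ^ 3 * (I * √I)) else 0) + m / (ε ^ 3 * (I * √B))

/-- Constants in the step sizes; `c₀` bounds the range of `ε`. -/
structure StepConsts where
  LF : ℝ
  Lφ : ℝ
  C6 : ℝ
  C8 : ℝ
  C9 : ℝ
  C11 : ℝ
  Cτ : ℝ
  c₀ : ℝ

/-- All constants are positive. -/
structure StepConsts.Pos (k : StepConsts) : Prop where
  LF : 0 < k.LF
  Lφ : 0 < k.Lφ
  C6 : 0 < k.C6
  C8 : 0 < k.C8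
  C9 : 0 < k.C9
  C11 : 0 < k.C11
  Cτ : 0 < k.Cτ
  c₀ : 0 < k.c₀

/-- `a` is at most `b`, and at least `κ b`. -/
def Comparable (κ a b : ℝ) : Prop := κ * b ≤ a ∧ a ≤ b

/-- The step sizes are at most their prescribed bounds, and at least `κ` times them. -/
structure Steps.Admissible (h : Steps) (lam : ℝ) (k : StepConsts) (κ : ℝ) (m I B : ℕ) (ε : ℝ) :
    Prop where
  α : ∀ t, Comparable κ (h.α t) (min (1 / 2) (B / (18 * k.C9) * ε ^ 2))
  α' : ∀ t, Comparable κ (h.α' t) (min (1 / 2) (1 / (18 * k.C9) * (rho m I B)⁻¹ * ε ^ 2))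
  β : ∀ t, Comparable κ (h.β t) (1 / (18 * k.C9) * (rho m I B)⁻¹ * ε ^ 2)
  τy : ∀ t, Comparable κ (h.τy t)
    (√(k.C8 * min 1 k.Cτ / (18 * k.C9)) * (I / m) * (√(rho m I B))⁻¹ * ε)
  τv : ∀ t, Comparable κ (h.τv t)
    (min (min (min (lam / (8 * k.Lφ ^ 2)) (lam / 2)) (min (1 / lam) (1 / (2 * √k.C6))))
      (√k.Cτ * I / m * √(h.α' t)))
  η : ∀ t, Comparable κ (h.η t)
    (min (1 / (2 * k.LF)) (√k.C11 * I / m * (√(rho m I B))⁻¹ * ε))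

end BSVRB

end

/-! Smoothness of $F$ is implicit differentiation: $\nabla
F(x)=\frac1m\sum_i[\nabla_xf_i-\nabla^2_{xy}g_i\,v_i(x)]$ at $y=y_i(x)$, where $v_i(x)$ solves
$\nabla^2_{yy}g_i\,v=\nabla_yf_i$. Strong convexity puts $v_i(x)$ in the ball of radius $V$ and
makes $y_i$ and $v_i$ Lipschitz, hence also $\nabla F$ (`hasGradientAt_fbar_ySol`,
`norm_gradient_F_sub_le`).

Convergence is a Lyapunov argument in $F(x_t)$ and six error terms: the mean squared errors `errS`,
`errU`, `errZ` of the estimators $s,u,z$, each measured at the previous iterate, where it was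
formed; the distances `errY`, `errV` of $y_i,v_i$ from the exact solutions at the current $x$; and
`lag`, the squared length of the last move. Put $a=I/m$. In expectation `errS`, `errU`, `errZ`
contract by $1-a\alpha$, $1-a\bar\alpha$, $1-\beta$, up to noise quadratic in the momentum parameter
and a multiple of `lag` (`msvr_step`, `storm_step`). The lag appears because one batch is evaluated
at two consecutive points, so the fresh variance is proportional to the squared move; the weight
$\gamma$ makes the cross terms of selected and unselected blocks cancel. `errY` and `errV` contract
at the rates of their own step sizes, driven by `errS`, `errU`, `lag` and the drift of $x$. The
descent inequality for $F$ releases $-\frac\eta4\|z\|^2$, which pays for every drift of $x$.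

A weighted sum of these quantities therefore loses $\frac\eta2\|\nabla F\|^2$ per iteration up to a
noise $N$ (`lyap_step`). With $r=\epsilon/\sqrt\rho$ the step sizes $\eta,\tau_t,\bar\tau_t$ have
order $ar$, $\bar\alpha$ and $\beta$ have order $r^2$, and $\alpha$ has order $\alpha_0$, a minimum
of $1/2$ and a multiple of $B\epsilon^2$. The weights $r/\alpha_0$, $1/r$, $a/r$, $1$, $1$, $1/(ar)$
then balance all terms up to constants, and $N$ is a small multiple of $ar\epsilon^2$
(`Tuning.Valid.balanced`).

Telescoping bounds the average of $\mathbb E\|\nabla F\|^2$ by $2\Phi/(\eta_0T)+\epsilon^2/4$, where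
$\eta_0$ of order $ar$ bounds the $\eta_t$ from below and $\Phi$ bounds the initial value. $\Phi$ is
a constant: the estimator weights are $O(1/\epsilon)$, the initial variances are
$O(1/S)=O(\epsilon)$, and the initial lag is zero. It remains to take $T$ of order
$1/(ar\epsilon^2)=m\sqrt\rho/(I\epsilon^3)$, which `rate` dominates (`inv_le_rate`). -/

namespace BSVRB

/-! ### Lipschitz bounds for sample derivatives and their expectations -/

section JointLipschitz

variable {a b : ℕ} {H : Type*} [NormedAddCommGroup H] {L : ℝ} {h : E a → E b → H}

theorem JointLipschitz.norm_sub_sq_le (hh : JointLipschitz L h) (x x' : E a) (y y' : E b) :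
    ‖h x y - h x' y'‖ ^ 2 ≤ L ^ 2 * (‖x - x'‖ ^ 2 + ‖y - y'‖ ^ 2) := by
  have h1 := hh x x' y y'
  have h2 := pow_le_pow_left₀ (norm_nonneg _) h1 2
  rwa [mul_pow, Real.sq_sqrt (by positivity)] at h2

theorem JointLipschitz.norm_sub_le_add (hL : 0 ≤ L) (hh : JointLipschitz L h) (x x' : E a)
    (y y' : E b) : ‖h x y - h x' y'‖ ≤ L * (‖x - x'‖ + ‖y - y'‖) := by
  refine (hh x x' y y').trans (mul_le_mul_of_nonneg_left ?_ hL)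
  rw [Real.sqrt_le_left (by positivity)]
  nlinarith [norm_nonneg (x - x'), norm_nonneg (y - y')]

theorem JointLipschitz.norm_sub_left (hh : JointLipschitz L h) (x x' : E a) (y : E b) :
    ‖h x y - h x' y‖ ≤ L * ‖x - x'‖ := by
  simpa using hh x x' y y

theorem JointLipschitz.continuous (hL : 0 ≤ L) (hh : JointLipschitz L h) :
    Continuous fun q : E a × E b => h q.1 q.2 := by
  have : LipschitzWith (L * 2).toNNReal fun q : E a × E b => h q.1 q.2 := by
    refine LipschitzWith.of_dist_le_mul fun q q' => ?_
    rw [Real.coe_toNNReal _ (by positivity), dist_eq_norm, dist_eq_norm]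
    refine (hh.norm_sub_le_add hL _ _ _ _).trans ?_
    rw [mul_assoc]
    refine mul_le_mul_of_nonneg_left ?_ hL
    have h1 := norm_fst_le (q - q')
    have h2 := norm_snd_le (q - q')
    simp only [Prod.fst_sub, Prod.snd_sub] at h1 h2
    linarith
  exact this.continuous

theorem UnbiasedBddVar.norm_sub_le {S : Type*} [MeasurableSpace S] [NormedSpace ℝ H]
    {ν : Measure S} [IsProbabilityMeasure ν] {X Y : S → H} {m₁ m₂ : H} {σ D : ℝ}
    (hX : UnbiasedBddVar ν X m₁ σ) (hY : UnbiasedBddVar ν Y m₂ σ)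
    (hD : ∀ s, ‖X s - Y s‖ ≤ D) : ‖m₁ - m₂‖ ≤ D := by
  rw [← hX.mean, ← hY.mean, ← integral_sub hX.integrable hY.integrable]
  simpa using norm_integral_le_of_norm_le_const (μ := ν) (Filter.Eventually.of_forall hD)

/-- Unbiasedness alone carries the Lipschitz constants of the sample derivatives over to the
derivatives of the expectation; nothing is differentiated under the integral. -/
theorem UnbiasedBddVar.jointLipschitz {S : Type*} [MeasurableSpace S] [NormedSpace ℝ H]
    {ν : Measure S} [IsProbabilityMeasure ν] {X : S → E a → E b → H} {σ : ℝ}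
    (hX : ∀ x y, UnbiasedBddVar ν (fun s => X s x y) (h x y) σ)
    (hL : ∀ s, JointLipschitz L (X s)) : JointLipschitz L h := fun x x' y y' =>
  (hX x y).norm_sub_le (hX x' y') fun s => hL s x x' y y'

end JointLipschitz

/-! ### Partial derivatives in two vector variables -/

section Gradients

variable {a b : ℕ} {h : E a → E b → ℝ}

theorem hasGradientAt_gradY (hd : Differentiable ℝ fun q : E a × E b => h q.1 q.2) (x : E a)
    (y : E b) : HasGradientAt (fun y' => h x y') (gradY h x y) y := by
  apply DifferentiableAt.hasGradientAt
  exact (hd (x, y)).comp (f := fun y' => (x, y')) y (by fun_prop)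

theorem hasGradientAt_gradX (hd : Differentiable ℝ fun q : E a × E b => h q.1 q.2) (x : E a)
    (y : E b) : HasGradientAt (fun x' => h x' y) (gradX h x y) x := by
  apply DifferentiableAt.hasGradientAt
  exact (hd (x, y)).comp (f := fun x' => (x', y)) x (by fun_prop)

theorem fderiv_eq_inner_add_inner (hd : Differentiable ℝ fun q : E a × E b => h q.1 q.2) (x : E a)
    (y : E b) (q : E a × E b) :
    fderiv ℝ (fun q : E a × E b => h q.1 q.2) (x, y) q
      = inner ℝ (gradX h x y) q.1 + inner ℝ (gradY h x y) q.2 := by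
  have h0 := (hd (x, y)).hasFDerivAt
  have h1 := h0.comp (f := fun x' => (x', y)) x (hasFDerivAt_prodMk_left x y)
  have h2 := h0.comp (f := fun y' => (x, y')) y (hasFDerivAt_prodMk_right x y)
  have e1 := h1.unique (hasGradientAt_gradX hd x y).hasFDerivAt
  have e2 := h2.unique (hasGradientAt_gradY hd x y).hasFDerivAt
  have e1' := congrArg (fun l => l q.1) e1
  have e2' := congrArg (fun l => l q.2) e2
  simp only [ContinuousLinearMap.comp_apply, InnerProductSpace.toDual_apply_apply,
    ContinuousLinearMap.inl_apply, ContinuousLinearMap.inr_apply] at e1' e2'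
  rw [← e1', ← e2', ← map_add]
  simp

theorem fderiv_gradY_eq (hd : Differentiable ℝ fun q : E a × E b => gradY h q.1 q.2) (x : E a)
    (y : E b) (q : E a × E b) :
    fderiv ℝ (fun q : E a × E b => gradY h q.1 q.2) (x, y) q
      = ContinuousLinearMap.adjoint (hessXY h x y) q.1 + hessYY h x y q.2 := by
  have h0 := (hd (x, y)).hasFDerivAt
  have h1 := h0.comp (f := fun x' => (x', y)) x (hasFDerivAt_prodMk_left x y)
  have h2 := h0.comp (f := fun y' => (x, y')) y (hasFDerivAt_prodMk_right x y)
  have e1 := congrArg (fun l => l q.1) h1.fderiv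
  have e2 := congrArg (fun l => l q.2) h2.fderiv
  simp only [ContinuousLinearMap.comp_apply,
    ContinuousLinearMap.inl_apply, ContinuousLinearMap.inr_apply, Function.comp_def] at e1 e2
  rw [hessXY, ContinuousLinearMap.adjoint_adjoint, hessYY]
  rw [e1, e2, ← map_add]
  simp

theorem hasFDerivAt_gradY_right (hd : Differentiable ℝ fun q : E a × E b => gradY h q.1 q.2)
    (x : E a) (y : E b) : HasFDerivAt (fun y' => gradY h x y') (hessYY h x y) y := by
  apply DifferentiableAt.hasFDerivAt
  exact (hd (x, y)).comp (f := fun y' => (x, y')) y (by fun_prop)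

/-- A Lipschitz map has derivative of norm at most its constant, and the adjoint preserves the norm.
This supplies the bound on the Jacobian, which is not assumed separately. -/
theorem norm_hessXY_le {L : ℝ} (hL : 0 ≤ L) (hh : JointLipschitz L (gradY h)) (x : E a) (y : E b) :
    ‖hessXY h x y‖ ≤ L := by
  rw [hessXY, LinearIsometryEquiv.norm_map]
  exact norm_fderiv_le_of_lip' ℝ hL
    (Filter.Eventually.of_forall fun x' => hh.norm_sub_left x' x y)

/-- Symmetry of the second derivative holds wherever the gradient is differentiable, without
continuity of the Hessian. It moves the Hessian from $v_i(x)$ to the displacement of $y_i$ in the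
computation of $\nabla F$. -/
theorem inner_hessYY_comm (hd : Differentiable ℝ fun q : E a × E b => h q.1 q.2)
    (hd2 : Differentiable ℝ fun q : E a × E b => gradY h q.1 q.2) (x : E a) (y v w : E b) :
    inner ℝ (hessYY h x y v) w = inner ℝ v (hessYY h x y w) := by
  have h1 : ∀ y', HasFDerivAt (fun y' => h x y') (innerSL ℝ (gradY h x y')) y' := fun y' =>
    (hasGradientAt_gradY hd x y').hasFDerivAt
  have h2 : HasFDerivAt (fun y' => innerSL ℝ (gradY h x y'))
      ((innerSL ℝ).comp (hessYY h x y)) y :=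
    (innerSL ℝ : E b →L[ℝ] E b →L[ℝ] ℝ).hasFDerivAt.comp y (hasFDerivAt_gradY_right hd2 x y)
  have h3 := second_derivative_symmetric h1 h2 v w
  simp only [ContinuousLinearMap.comp_apply, innerSL_apply_apply] at h3
  rw [h3, real_inner_comm]

end Gradients

/-! ### The lower-level problems -/

variable {m dx : ℕ} {dy : Fin m → ℕ} {Ξ Z : Type*} [MeasurableSpace Ξ] [MeasurableSpace Z]
  {p : Problem m dx dy Ξ Z} {c : Consts}

namespace Problem.Assumptions

variable (hp : p.Assumptions c)
include hp

theorem lip_gradX_fbar (i : Fin m) : JointLipschitz c.Lfx (gradX (p.fbar i)) :=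
  UnbiasedBddVar.jointLipschitz (hp.var_fx i) (hp.lip_fx i)

theorem lip_gradY_fbar (i : Fin m) : JointLipschitz c.Lfy (gradY (p.fbar i)) :=
  UnbiasedBddVar.jointLipschitz (hp.var_fy i) (hp.lip_fy i)

theorem lip_gradY_gbar (i : Fin m) : JointLipschitz c.Lgy (gradY (p.gbar i)) :=
  UnbiasedBddVar.jointLipschitz (hp.var_gy i) (hp.lip_gy i)

theorem lip_hessXY_gbar (i : Fin m) : JointLipschitz c.Lgxy (hessXY (p.gbar i)) :=
  UnbiasedBddVar.jointLipschitz (hp.var_gxy i) (hp.lip_gxy i)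

theorem lip_hessYY_gbar (i : Fin m) : JointLipschitz c.Lgyy (hessYY (p.gbar i)) :=
  UnbiasedBddVar.jointLipschitz (hp.var_gyy i) (hp.lip_gyy i)

theorem gbar_diff (i : Fin m) : Differentiable ℝ fun q : E dx × E (dy i) => p.gbar i q.1 q.2 :=
  (hp.gbar_C1 i).differentiable one_ne_zero

theorem fbar_diff (i : Fin m) : Differentiable ℝ fun q : E dx × E (dy i) => p.fbar i q.1 q.2 :=
  (hp.fbar_C1 i).differentiable one_ne_zero

theorem norm_gradX_fbar_le (hc : c.Valid) (i : Fin m) (x : E dx) (y : E (dy i)) :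
    ‖gradX (p.fbar i) x y‖ ≤ c.Cfx :=
  le_of_sq_le_sq (hp.bdd_fx i x y) hc.Cfx_nonneg

theorem norm_gradY_fbar_le (hc : c.Valid) (i : Fin m) (x : E dx) (y : E (dy i)) :
    ‖gradY (p.fbar i) x y‖ ≤ c.Cfy :=
  le_of_sq_le_sq (hp.bdd_fy i x y) hc.Cfy_nonneg

theorem norm_hessXY_gbar_le (hc : c.Valid) (i : Fin m) (x : E dx) (y : E (dy i)) :
    ‖hessXY (p.gbar i) x y‖ ≤ c.Lgy :=
  norm_hessXY_le hc.Lgy_nonneg (hp.lip_gradY_gbar i) x y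

theorem norm_hessYY_gbar_le (hc : c.Valid) (i : Fin m) (x : E dx) (y : E (dy i)) :
    ‖hessYY (p.gbar i) x y‖ ≤ c.Lg :=
  norm_fderiv_le_of_lip' ℝ hc.Lg_pos.le
    (Filter.Eventually.of_forall fun y' => hp.g_smooth i x y' y)

/-- Adding the strong convexity inequality to itself with the two points exchanged cancels the
function values. -/
theorem strong_monotone (i : Fin m) (x : E dx) (y y' : E (dy i)) :
    c.lam * ‖y - y'‖ ^ 2
      ≤ inner ℝ (gradY (p.gbar i) x y - gradY (p.gbar i) x y') (y - y') := by
  have h1 := hp.g_strongConvex i x y y'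
  have h2 := hp.g_strongConvex i x y' y
  rw [← neg_sub y y', inner_neg_right, norm_neg] at h2
  rw [inner_sub_left]
  linarith

/-- Strong convexity at $0$ gives quadratic growth, so a continuous function on a finite-dimensional
space attains its minimum. -/
theorem exists_minimizer (hc : c.Valid) (i : Fin m) (x : E dx) :
    ∃ y, ∀ y', p.gbar i x y ≤ p.gbar i x y' := by
  have hcont : Continuous fun y => p.gbar i x y :=
    (hp.gbar_diff i).continuous.comp (f := fun y => (x, y)) (by fun_prop)
  refine hcont.exists_forall_le ?_
  have hlam := hc.lam_pos
  set G := ‖gradY (p.gbar i) x 0‖ with hG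
  have key : ∀ y : E (dy i), p.gbar i x 0 - G ^ 2 / (c.lam) + c.lam / 4 * ‖y‖ ^ 2
      ≤ p.gbar i x y := fun y => by
    have h1 := hp.g_strongConvex i x y 0
    rw [sub_zero] at h1
    have h2 := neg_le_of_abs_le (abs_real_inner_le_norm (gradY (p.gbar i) x 0) y)
    rw [← hG] at h2
    -- Young's inequality, weighted so that half of the quadratic growth absorbs the linear term.
    have h3 : G * ‖y‖ ≤ G ^ 2 / c.lam + c.lam / 4 * ‖y‖ ^ 2 := by
      have h4 : 0 ≤ (G - c.lam / 2 * ‖y‖) ^ 2 / c.lam := by positivity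
      have h5 : (G - c.lam / 2 * ‖y‖) ^ 2 / c.lam
        = G ^ 2 / c.lam + c.lam / 4 * ‖y‖ ^ 2 - G * ‖y‖ := by
        field_simp
        ring
      linarith
    linarith
  refine Filter.tendsto_atTop_mono key ?_
  refine Filter.tendsto_atTop_add_const_left _ _ ?_
  refine Filter.Tendsto.const_mul_atTop (by positivity) ?_
  exact (Filter.tendsto_pow_atTop two_ne_zero).comp (tendsto_norm_cocompact_atTop (E := E (dy i)))

theorem gradY_ySol (hc : c.Valid) (i : Fin m) (x : E dx) :
    gradY (p.gbar i) x (p.ySol i x) = 0 := by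
  have h1 : ∀ y', p.gbar i x (p.ySol i x) ≤ p.gbar i x y' :=
    Classical.epsilon_spec (hp.exists_minimizer hc i x)
  have h2 : IsLocalMin (fun y => p.gbar i x y) (p.ySol i x) := Filter.Eventually.of_forall h1
  rw [gradY, gradient, h2.fderiv_eq_zero, map_zero]

/-- Apply strong monotonicity of $\nabla_yg_i(x,\cdot)$ to the two minimizers. The gradient at
$y_i(x)$ vanishes, and the one at $y_i(x')$ differs from $\nabla_yg_i(x',y_i(x'))=0$ by at most
$L_{gy}\|x-x'\|$. -/
theorem norm_ySol_sub_le (hc : c.Valid) (i : Fin m) (x x' : E dx) :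
    ‖p.ySol i x - p.ySol i x'‖ ≤ c.Lgy / c.lam * ‖x - x'‖ := by
  have hlam := hc.lam_pos
  rcases (norm_nonneg (p.ySol i x - p.ySol i x')).eq_or_lt with h0 | h0
  · rw [← h0]
    have := hc.Lgy_nonneg
    positivity
  have h1 := hp.strong_monotone i x (p.ySol i x) (p.ySol i x')
  rw [hp.gradY_ySol hc, ← hp.gradY_ySol hc i x'] at h1
  have h2 := h1.trans (real_inner_le_norm _ _)
  rw [pow_two, ← mul_assoc] at h2
  have h3 := le_of_mul_le_mul_right h2 h0
  have h4 := (hp.lip_gradY_gbar i).norm_sub_left x' x (p.ySol i x')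
  rw [norm_sub_rev x' x] at h4
  rw [div_mul_eq_mul_div, le_div_iff₀ hlam]
  linarith

/-- Strong monotonicity between $y$ and $y+tw$, divided by $t^2$, in the limit $t\to0^+$. -/
theorem coercive (i : Fin m) (x : E dx) (y w : E (dy i)) :
    c.lam * ‖w‖ ^ 2 ≤ inner ℝ (hessYY (p.gbar i) x y w) w := by
  have h1 : HasDerivAt (fun t : ℝ => gradY (p.gbar i) x (y + t • w))
      (hessYY (p.gbar i) x y w) 0 := by
    have h2 : HasDerivAt (fun t : ℝ => y + t • w) w 0 := by
      simpa using ((hasDerivAt_id (0 : ℝ)).smul_const w).const_add y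
    have h3 : HasFDerivAt (fun y' => gradY (p.gbar i) x y') (hessYY (p.gbar i) x y)
        (y + (0 : ℝ) • w) := by
      simpa using hasFDerivAt_gradY_right (hp.gbar_diff2 i) x y
    exact h3.comp_hasDerivAt (0 : ℝ) h2
  have h4 := (hasDerivAt_iff_tendsto_slope_zero.1 h1).mono_left
    (nhdsWithin_mono 0 (s := Set.Ioi 0) (fun t ht => ne_of_gt ht))
  have h5 : Filter.Tendsto (fun t : ℝ => inner ℝ (t⁻¹ • (gradY (p.gbar i) x (y + (0 + t) • w)
      - gradY (p.gbar i) x (y + (0 : ℝ) • w))) w) (nhdsWithin 0 (Set.Ioi 0))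
      (nhds (inner ℝ (hessYY (p.gbar i) x y w) w)) := by
    simp only [zero_add] at h4 ⊢
    exact h4.inner tendsto_const_nhds
  refine ge_of_tendsto h5 ?_
  filter_upwards [self_mem_nhdsWithin] with t ht
  have ht : 0 < t := ht
  have h6 := hp.strong_monotone i x (y + t • w) y
  rw [add_sub_cancel_left, norm_smul, inner_smul_right, mul_pow, Real.norm_of_nonneg ht.le] at h6
  rw [zero_add, zero_smul, add_zero, inner_smul_left]
  simp only [conj_trivial]
  rw [inv_mul_eq_div, le_div_iff₀ ht]
  have h7 : t * (c.lam * ‖w‖ ^ 2 * t) ≤ t * inner ℝ (gradY (p.gbar i) x (y + t • w)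
    - gradY (p.gbar i) x y) w := by linarith
  exact le_of_mul_le_mul_left h7 ht

theorem mul_norm_le_norm_hessYY (i : Fin m) (x : E dx) (y w : E (dy i)) :
    c.lam * ‖w‖ ≤ ‖hessYY (p.gbar i) x y w‖ := by
  rcases (norm_nonneg w).eq_or_lt with h0 | h0
  · rw [← h0]
    simp
  have h1 := (hp.coercive i x y w).trans (real_inner_le_norm _ _)
  rw [pow_two, ← mul_assoc] at h1
  exact le_of_mul_le_mul_right h1 h0

/-- The Hessian is bounded below by $\lambda$, hence injective, hence surjective by finite
dimension. This makes the choice in `vSol` meaningful. -/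
theorem exists_hessYY_eq (hc : c.Valid) (i : Fin m) (x : E dx) (y w : E (dy i)) :
    ∃ v, hessYY (p.gbar i) x y v = w := by
  have hinj : Function.Injective (hessYY (p.gbar i) x y : E (dy i) →ₗ[ℝ] E (dy i)) := by
    rw [injective_iff_map_eq_zero]
    intro v hv
    have h1 := hp.mul_norm_le_norm_hessYY i x y v
    have h2 : hessYY (p.gbar i) x y v = 0 := hv
    rw [h2, norm_zero] at h1
    have h3 := hc.lam_pos
    rw [← norm_le_zero_iff]
    by_contra h4
    nlinarith
  exact LinearMap.injective_iff_surjective.1 hinj w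

end Problem.Assumptions

/-- The Hessian-inverse-vector product `v_i(x) = [∇²_yy g_i(x, y_i(x))]⁻¹ ∇_y f_i(x, y_i(x))`. -/
noncomputable def Problem.vSol (p : Problem m dx dy Ξ Z) (i : Fin m) (x : E dx) : E (dy i) :=
  Classical.epsilon fun v =>
    hessYY (p.gbar i) x (p.ySol i x) v = gradY (p.fbar i) x (p.ySol i x)

/-- The hypergradient estimate `(1/m) ∑ᵢ [∇ₓ f_i(x, y_i) - ∇²_xy g_i(x, y_i) v_i]`. -/
noncomputable def Problem.hyperGrad (p : Problem m dx dy Ξ Z) (x : E dx)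
    (y v : (i : Fin m) → E (dy i)) : E dx :=
  (m : ℝ)⁻¹ • ∑ i, (gradX (p.fbar i) x (y i) - hessXY (p.gbar i) x (y i) (v i))

namespace Problem.Assumptions

variable (hp : p.Assumptions c)
include hp

theorem hessYY_vSol (hc : c.Valid) (i : Fin m) (x : E dx) :
    hessYY (p.gbar i) x (p.ySol i x) (p.vSol i x) = gradY (p.fbar i) x (p.ySol i x) :=
  Classical.epsilon_spec (hp.exists_hessYY_eq hc i x (p.ySol i x) _)

/-- This is why $V$ is the right radius: the exact solution lies in the ball, so projecting onto the
ball cannot move $v_i$ away from it. -/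
theorem norm_vSol_le (hc : c.Valid) (i : Fin m) (x : E dx) : ‖p.vSol i x‖ ≤ c.V := by
  have h1 := hp.mul_norm_le_norm_hessYY i x (p.ySol i x) (p.vSol i x)
  rw [hp.hessYY_vSol hc] at h1
  rw [Consts.V, le_div_iff₀ hc.lam_pos]
  linarith [hp.norm_gradY_fbar_le hc i x (p.ySol i x)]

end Problem.Assumptions

theorem Consts.Valid.V_nonneg (hc : c.Valid) : 0 ≤ c.V :=
  div_nonneg hc.Cfy_nonneg hc.lam_pos.le

/-- A Lipschitz constant of the lower-level solutions `y_i`. -/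
noncomputable def Consts.Ky (c : Consts) : ℝ := c.Lgy / c.lam

/-- A Lipschitz constant of the Hessian-inverse-vector products `v_i`. -/
noncomputable def Consts.Kv (c : Consts) : ℝ := (c.Lfy + c.Lgyy * c.V) * (1 + c.Ky) / c.lam

/-- A Lipschitz constant of `∇F`. -/
noncomputable def Consts.KF (c : Consts) : ℝ :=
  (c.Lfx + c.Lgxy * c.V) * (1 + c.Ky) + c.Lgy * c.Kv

theorem Consts.Valid.Ky_nonneg (hc : c.Valid) : 0 ≤ c.Ky :=
  div_nonneg hc.Lgy_nonneg hc.lam_pos.le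

theorem Consts.Valid.Kv_nonneg (hc : c.Valid) : 0 ≤ c.Kv := by
  have := hc.Ky_nonneg
  have := hc.V_nonneg
  have := hc.lam_pos
  have := hc.Lfy_nonneg
  have := hc.Lgyy_nonneg
  rw [Consts.Kv]
  positivity

theorem Consts.Valid.KF_nonneg (hc : c.Valid) : 0 ≤ c.KF := by
  have := hc.Ky_nonneg
  have := hc.Kv_nonneg
  have := hc.V_nonneg
  have := hc.Lfx_nonneg
  have := hc.Lgxy_nonneg
  have := hc.Lgy_nonneg
  rw [Consts.KF]
  positivity

/-! ### Lipschitz dependence on x and the hypergradient -/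

namespace Problem.Assumptions

variable (hp : p.Assumptions c)
include hp

/-- Subtracting the two linear systems gives $H(v-v')=(\nabla_yf-\nabla_yf')-(H-H')v'$. The Hessian
difference acts on $v'$, which is bounded by $V$, and the left side is at least $\lambda\|v-v'\|$ in
norm. -/
theorem norm_vSol_sub_le (hc : c.Valid) (i : Fin m) (x x' : E dx) :
    ‖p.vSol i x - p.vSol i x'‖ ≤ c.Kv * ‖x - x'‖ := by
  set y := p.ySol i x
  set y' := p.ySol i x'
  set v := p.vSol i x
  set v' := p.vSol i x'
  have h1 := hp.mul_norm_le_norm_hessYY i x y (v - v')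
  have e : hessYY (p.gbar i) x y (v - v')
      = (gradY (p.fbar i) x y - gradY (p.fbar i) x' y')
        - (hessYY (p.gbar i) x y - hessYY (p.gbar i) x' y') v' := by
    rw [map_sub, _root_.sub_apply, hp.hessYY_vSol hc i x, hp.hessYY_vSol hc i x']
    abel
  have h2 := (hp.lip_gradY_fbar i).norm_sub_le_add hc.Lfy_nonneg x x' y y'
  have h3 := (hp.lip_hessYY_gbar i).norm_sub_le_add hc.Lgyy_nonneg x x' y y'
  have h4 := (hessYY (p.gbar i) x y - hessYY (p.gbar i) x' y').le_opNorm v'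
  have h5 := hp.norm_vSol_le hc i x'
  have h6 : ‖y - y'‖ ≤ c.Ky * ‖x - x'‖ := hp.norm_ySol_sub_le hc i x x'
  have h7 := norm_sub_le (gradY (p.fbar i) x y - gradY (p.fbar i) x' y')
    ((hessYY (p.gbar i) x y - hessYY (p.gbar i) x' y') v')
  rw [← e] at h7
  have h8 : ‖x - x'‖ + ‖y - y'‖ ≤ (1 + c.Ky) * ‖x - x'‖ := by linarith
  have h9 : ‖(hessYY (p.gbar i) x y - hessYY (p.gbar i) x' y') v'‖
      ≤ c.Lgyy * ((1 + c.Ky) * ‖x - x'‖) * c.V :=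
    h4.trans (mul_le_mul (h3.trans (mul_le_mul_of_nonneg_left h8 hc.Lgyy_nonneg)) h5
      (norm_nonneg _) (by have := hc.Lgyy_nonneg; have := hc.Ky_nonneg; positivity))
  have h10 := h2.trans (mul_le_mul_of_nonneg_left h8 hc.Lfy_nonneg)
  rw [Consts.Kv, div_mul_eq_mul_div, le_div_iff₀ hc.lam_pos]
  linarith

/-- Sensitivity of one block of the hypergradient estimate to its arguments. -/
theorem norm_block_sub_le (hc : c.Valid) (i : Fin m) (x x' : E dx) (y y' v v' : E (dy i))
    (hv : ‖v‖ ≤ c.V) :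
    ‖(gradX (p.fbar i) x y - hessXY (p.gbar i) x y v)
      - (gradX (p.fbar i) x' y' - hessXY (p.gbar i) x' y' v')‖
      ≤ (c.Lfx + c.Lgxy * c.V) * (‖x - x'‖ + ‖y - y'‖) + c.Lgy * ‖v - v'‖ := by
  have e : (gradX (p.fbar i) x y - hessXY (p.gbar i) x y v)
      - (gradX (p.fbar i) x' y' - hessXY (p.gbar i) x' y' v')
      = (gradX (p.fbar i) x y - gradX (p.fbar i) x' y')
        - (hessXY (p.gbar i) x y - hessXY (p.gbar i) x' y') v
        - hessXY (p.gbar i) x' y' (v - v') := by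
    rw [map_sub, _root_.sub_apply]
    abel
  rw [e]
  have h1 := (hp.lip_gradX_fbar i).norm_sub_le_add hc.Lfx_nonneg x x' y y'
  have h2 := (hp.lip_hessXY_gbar i).norm_sub_le_add hc.Lgxy_nonneg x x' y y'
  have h3 := (hessXY (p.gbar i) x y - hessXY (p.gbar i) x' y').le_opNorm v
  have h4 := (hessXY (p.gbar i) x' y').le_opNorm (v - v')
  have h5 := mul_le_mul_of_nonneg_right (hp.norm_hessXY_gbar_le hc i x' y') (norm_nonneg (v - v'))
  have h6 := mul_le_mul h2 hv (norm_nonneg _)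
    (mul_nonneg hc.Lgxy_nonneg (add_nonneg (norm_nonneg (x - x')) (norm_nonneg (y - y'))))
  refine (norm_sub_le _ _).trans ?_
  refine (add_le_add_left (norm_sub_le _ _) _).trans ?_
  linarith

theorem norm_block_le (hc : c.Valid) (i : Fin m) (x : E dx) (y v : E (dy i)) (hv : ‖v‖ ≤ c.V) :
    ‖gradX (p.fbar i) x y - hessXY (p.gbar i) x y v‖ ≤ c.Cfx + c.Lgy * c.V := by
  refine (norm_sub_le _ _).trans (add_le_add (hp.norm_gradX_fbar_le hc i x y) ?_)
  exact ((hessXY (p.gbar i) x y).le_opNorm v).trans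
    (mul_le_mul (hp.norm_hessXY_gbar_le hc i x y) hv (norm_nonneg _) hc.Lgy_nonneg)

/-- Implicit differentiation without differentiability of $y_i$. Expand $f_i$ and $\nabla_yg_i$ to
first order at $(x,y_i(x))$; since $y_i$ is Lipschitz, both remainders along $x'\mapsto(x',y_i(x'))$
are $o(\|x'-x\|)$. Pair the second expansion with $v_i(x)$ and subtract it from the first. The
gradients $\nabla_yg_i$ vanish at both ends, and because $Hv_i(x)=\nabla_yf_i$ with $H$ symmetric,
the terms in $y_i(x')-y_i(x)$ cancel. -/
theorem hasGradientAt_fbar_ySol (hc : c.Valid) (i : Fin m) (x : E dx) :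
    HasGradientAt (fun x' => p.fbar i x' (p.ySol i x'))
      (gradX (p.fbar i) x (p.ySol i x) - hessXY (p.gbar i) x (p.ySol i x) (p.vSol i x)) x := by
  set y := p.ySol i x with hy
  set v := p.vSol i x with hv
  have hO : (fun x' => p.ySol i x' - y) =O[nhds x] fun x' => x' - x :=
    Asymptotics.IsBigO.of_bound c.Ky
      (Filter.Eventually.of_forall fun x' => hp.norm_ySol_sub_le hc i x' x)
  have hOq : (fun x' => (x', p.ySol i x') - (x, y)) =O[nhds x] fun x' => x' - x := by
    simp only [Prod.mk_sub_mk]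
    exact (Asymptotics.isBigO_refl _ _).prod_left hO
  have hcont : Filter.Tendsto (fun x' => (x', p.ySol i x')) (nhds x) (nhds (x, y)) := by
    refine Filter.tendsto_id.prodMk_nhds ?_
    have h0 : Filter.Tendsto (fun x' => p.ySol i x' - y) (nhds x) (nhds 0) :=
      hO.trans_tendsto (by
        have : Filter.Tendsto (fun x' : E dx => x' - x) (nhds x) (nhds (x - x)) :=
          (Filter.tendsto_id.sub tendsto_const_nhds)
        simpa using this)
    simpa using h0.add_const y
  have hf := ((hp.fbar_diff i (x, y)).hasFDerivAt.isLittleO.comp_tendsto hcont).trans_isBigO hOq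
  have hg := ((hp.gbar_diff2 i (x, y)).hasFDerivAt.isLittleO.comp_tendsto hcont).trans_isBigO hOq
  have hg' : (fun x' => inner ℝ v (gradY (p.gbar i) x' (p.ySol i x') - gradY (p.gbar i) x y
      - fderiv ℝ (fun q : E dx × E (dy i) => gradY (p.gbar i) q.1 q.2) (x, y)
        ((x', p.ySol i x') - (x, y)))) =o[nhds x] fun x' => x' - x :=
    (Asymptotics.IsBigO.of_bound ‖v‖ (Filter.Eventually.of_forall fun x' =>
      norm_inner_le_norm _ _)).trans_isLittleO hg
  rw [hasGradientAt_iff_hasFDerivAt, hasFDerivAt_iff_isLittleO]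
  refine (hf.sub hg').congr_left fun x' => ?_
  simp only [Function.comp_apply]
  rw [fderiv_eq_inner_add_inner (hp.fbar_diff i), fderiv_gradY_eq (hp.gbar_diff2 i),
    hp.gradY_ySol hc, hp.gradY_ySol hc, InnerProductSpace.toDual_apply_apply]
  simp only [Prod.mk_sub_mk]
  rw [← hp.hessYY_vSol hc i x, inner_hessYY_comm (hp.gbar_diff i) (hp.gbar_diff2 i), ← hy, ← hv,
    sub_self, zero_sub, inner_neg_right, inner_add_right, ContinuousLinearMap.adjoint_inner_right,
    inner_sub_left]
  ring

theorem hasGradientAt_F (hc : c.Valid) (x : E dx) :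
    HasGradientAt p.F (p.hyperGrad x (fun i => p.ySol i x) (fun i => p.vSol i x)) x := by
  rw [hasGradientAt_iff_hasFDerivAt, Problem.hyperGrad, map_smul, map_sum]
  exact (HasFDerivAt.fun_sum fun i _ => (hp.hasGradientAt_fbar_ySol hc i x).hasFDerivAt).const_mul _

theorem gradient_F (hc : c.Valid) (x : E dx) :
    gradient p.F x = p.hyperGrad x (fun i => p.ySol i x) (fun i => p.vSol i x) :=
  (hp.hasGradientAt_F hc x).gradient

theorem differentiable_F (hc : c.Valid) : Differentiable ℝ p.F := fun x =>
  (hp.hasGradientAt_F hc x).differentiableAt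

end Problem.Assumptions

theorem norm_average_le {H : Type*} [NormedAddCommGroup H] [NormedSpace ℝ H] {n : ℕ}
    {h : Fin n → H} {C : ℝ} (hC : 0 ≤ C) (hh : ∀ i, ‖h i‖ ≤ C) : ‖(n : ℝ)⁻¹ • ∑ i, h i‖ ≤ C := by
  rcases Nat.eq_zero_or_pos n with rfl | hn
  · simpa using hC
  have hn' : (0 : ℝ) < n := by exact_mod_cast hn
  rw [norm_smul, norm_inv, Real.norm_natCast, inv_mul_le_iff₀ hn']
  refine (norm_sum_le _ _).trans ((sum_le_sum fun i _ => hh i).trans ?_)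
  simp

theorem norm_sum_sq_le_card_mul {ι H : Type*} [NormedAddCommGroup H] (s : Finset ι) (h : ι → H) :
    ‖∑ i ∈ s, h i‖ ^ 2 ≤ #s * ∑ i ∈ s, ‖h i‖ ^ 2 :=
  (pow_le_pow_left₀ (norm_nonneg _) (norm_sum_le _ _) 2).trans sq_sum_le_card_mul_sum_sq

theorem norm_average_sq_le {H : Type*} [NormedAddCommGroup H] [NormedSpace ℝ H] {ι : Type*}
    (s : Finset ι) (h : ι → H) :
    ‖(#s : ℝ)⁻¹ • ∑ i ∈ s, h i‖ ^ 2 ≤ (#s : ℝ)⁻¹ * ∑ i ∈ s, ‖h i‖ ^ 2 := by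
  rcases s.eq_empty_or_nonempty with rfl | hs
  · simp
  have hn' : (0 : ℝ) < #s := by exact_mod_cast hs.card_pos
  rw [norm_smul, norm_inv, Real.norm_natCast, mul_pow]
  have h1 := mul_le_mul_of_nonneg_left (norm_sum_sq_le_card_mul s h)
    (show 0 ≤ ((#s : ℝ)⁻¹) ^ 2 by positivity)
  refine h1.trans (le_of_eq ?_)
  field_simp

namespace Problem.Assumptions

variable (hp : p.Assumptions c)
include hp

theorem norm_gradient_F_sub_le (hc : c.Valid) (x x' : E dx) :
    ‖gradient p.F x - gradient p.F x'‖ ≤ c.KF * ‖x - x'‖ := by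
  rw [hp.gradient_F hc, hp.gradient_F hc, Problem.hyperGrad, Problem.hyperGrad, ← smul_sub,
    ← sum_sub_distrib]
  refine norm_average_le (mul_nonneg hc.KF_nonneg (norm_nonneg _)) fun i => ?_
  refine (hp.norm_block_sub_le hc i _ _ _ _ _ _ (hp.norm_vSol_le hc i x)).trans ?_
  have h1 : ‖p.ySol i x - p.ySol i x'‖ ≤ c.Ky * ‖x - x'‖ := hp.norm_ySol_sub_le hc i x x'
  have h2 := hp.norm_vSol_sub_le hc i x x'
  have h3 : 0 ≤ c.Lfx + c.Lgxy * c.V :=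
    add_nonneg hc.Lfx_nonneg (mul_nonneg hc.Lgxy_nonneg hc.V_nonneg)
  have h4 := mul_le_mul_of_nonneg_left h1 h3
  have h5 := mul_le_mul_of_nonneg_left h2 hc.Lgy_nonneg
  rw [Consts.KF]
  linarith

/-- The gradient is bounded along every run, so its integrability needs no moment estimate. -/
theorem norm_gradient_F_le (hc : c.Valid) (x : E dx) :
    ‖gradient p.F x‖ ≤ c.Cfx + c.Lgy * c.V := by
  rw [hp.gradient_F hc, Problem.hyperGrad]
  exact norm_average_le (add_nonneg hc.Cfx_nonneg (mul_nonneg hc.Lgy_nonneg hc.V_nonneg))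
    fun i => hp.norm_block_le hc i _ _ _ (hp.norm_vSol_le hc i x)

/-- The mean value inequality on the segment leaves the error $K_F\eta^2\|z\|^2$. Polarizing
$-\eta\langle\nabla F,z\rangle$ produces $-\frac\eta2\|z\|^2$; since $K_F\eta\le\frac14$, half of it
survives and later pays for all effects of the movement of $x$. -/
theorem descent (hc : c.Valid) (x z : E dx) {η : ℝ} (hη : 0 ≤ η) (hη' : c.KF * η ≤ 1 / 4) :
    p.F (x - η • z) ≤ p.F x - η / 2 * ‖gradient p.F x‖ ^ 2 - η / 4 * ‖z‖ ^ 2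
      + η / 2 * ‖gradient p.F x - z‖ ^ 2 := by
  have h1 := Convex.norm_image_sub_le_of_norm_fderiv_le' (𝕜 := ℝ) (f := p.F)
    (C := c.KF * ‖(x - η • z) - x‖) (s := segment ℝ x (x - η • z)) (x := x) (y := x - η • z)
    (φ := fderiv ℝ p.F x) (fun w _ => hp.differentiable_F hc w) (fun w hw => by
      rw [← toDual_gradient, ← toDual_gradient, ← map_sub, LinearIsometryEquiv.norm_map]
      refine (hp.norm_gradient_F_sub_le hc w x).trans
        (mul_le_mul_of_nonneg_left ?_ hc.KF_nonneg)
      obtain ⟨t, ⟨ht0, ht1⟩, rfl⟩ := (segment_eq_image' ℝ x (x - η • z)) ▸ hw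
      simp only [add_sub_cancel_left]
      rw [norm_smul, Real.norm_of_nonneg ht0]
      exact mul_le_of_le_one_left (norm_nonneg _) ht1)
    (convex_segment _ _) (left_mem_segment _ _ _) (right_mem_segment _ _ _)
  rw [← toDual_gradient, InnerProductSpace.toDual_apply_apply] at h1
  have h2 := (le_abs_self _).trans h1
  rw [sub_sub_cancel_left, inner_neg_right, inner_smul_right, norm_neg, norm_smul,
    Real.norm_of_nonneg hη] at h2
  have h3 := norm_sub_sq_real (gradient p.F x) z
  have h4 : 0 ≤ η * ‖z‖ ^ 2 := by positivity
  rw [h3]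
  nlinarith

end Problem.Assumptions

end BSVRB

/-! ### Mean and variance of vector-valued estimators -/

namespace BSVRB

/-- `X` is square integrable with mean `m₀` and total variance at most `w`. -/
structure MeanVar {S H : Type*} [MeasurableSpace S] [NormedAddCommGroup H] [NormedSpace ℝ H]
    (ν : Measure S) (X : S → H) (m₀ : H) (w : ℝ) : Prop where
  memLp : MemLp X 2 ν
  mean : ∫ s, X s ∂ν = m₀
  variance_le : ∫ s, ‖X s - m₀‖ ^ 2 ∂ν ≤ w

section MeanVar

variable {S S' H G : Type*} [MeasurableSpace S] [MeasurableSpace S'] [NormedAddCommGroup H]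
  [NormedSpace ℝ H] [NormedAddCommGroup G] [NormedSpace ℝ G] {ν : Measure S} {ν' : Measure S'}

theorem UnbiasedBddVar.meanVar [IsProbabilityMeasure ν] {X : S → H} {m₀ : H} {σ : ℝ}
    (h : UnbiasedBddVar ν X m₀ σ) : MeanVar ν X m₀ (σ ^ 2) where
  memLp := by
    have h1 : MemLp (fun s => X s - m₀) 2 ν := by
      refine (memLp_two_iff_integrable_sq_norm ?_).2 h.integrable_sq
      exact h.integrable.aestronglyMeasurable.sub aestronglyMeasurable_const
    refine (h1.add (memLp_const m₀)).ae_eq (Filter.Eventually.of_forall fun s => ?_)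
    simp
  mean := h.mean
  variance_le := h.variance_le

namespace MeanVar

variable {X Y : S → H} {m₁ m₂ : H} {w w₁ w₂ : ℝ}

theorem mono (h : MeanVar ν X m₁ w₁) (hw : w₁ ≤ w₂) : MeanVar ν X m₁ w₂ :=
  ⟨h.memLp, h.mean, h.variance_le.trans hw⟩

theorem integrable [IsProbabilityMeasure ν] (h : MeanVar ν X m₁ w) : Integrable X ν :=
  h.memLp.integrable one_le_two

theorem memLp_sub [IsProbabilityMeasure ν] (h : MeanVar ν X m₁ w) (x : H) :
    MemLp (fun s => X s - x) 2 ν := h.memLp.sub (memLp_const x)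

theorem integrable_norm_sq [IsProbabilityMeasure ν] (h : MeanVar ν X m₁ w) (x : H) :
    Integrable (fun s => ‖X s - x‖ ^ 2) ν :=
  (memLp_two_iff_integrable_sq_norm (h.memLp_sub x).aestronglyMeasurable).1 (h.memLp_sub x)

theorem nonneg (h : MeanVar ν X m₁ w) : 0 ≤ w :=
  (integral_nonneg fun _ => by positivity).trans h.variance_le

theorem clm_apply [CompleteSpace H] [CompleteSpace G] [IsProbabilityMeasure ν] {A : S → H →L[ℝ] G}
    {M : H →L[ℝ] G} (h : MeanVar ν A M w) (v : H) :
    MeanVar ν (fun s => A s v) (M v) (w * ‖v‖ ^ 2) where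
  memLp := (ContinuousLinearMap.apply ℝ G v).comp_memLp' h.memLp
  mean := by rw [← h.mean, ContinuousLinearMap.integral_apply h.integrable]
  variance_le := by
    have h1 : ∫ s, ‖A s v - M v‖ ^ 2 ∂ν ≤ ∫ s, ‖A s - M‖ ^ 2 * ‖v‖ ^ 2 ∂ν := by
      refine integral_mono_of_nonneg (Filter.Eventually.of_forall fun s => by positivity)
        ((h.integrable_norm_sq M).mul_const _) (Filter.Eventually.of_forall fun s => ?_)
      simp only
      rw [← mul_pow, ← _root_.sub_apply]
      exact pow_le_pow_left₀ (norm_nonneg _) ((A s - M).le_opNorm v) 2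
    rw [integral_mul_const] at h1
    exact h1.trans (mul_le_mul_of_nonneg_right h.variance_le (by positivity))

/-- No independence of $X$ and $Y$ is needed, only $\|u+v\|^2\le2\|u\|^2+2\|v\|^2$. This matters
because the two parts of each update use the same batch. -/
theorem smul_add_smul [IsProbabilityMeasure ν] (hX : MeanVar ν X m₁ w₁) (hY : MeanVar ν Y m₂ w₂)
    (a b : ℝ) :
    MeanVar ν (fun s => a • X s + b • Y s) (a • m₁ + b • m₂) (2 * a ^ 2 * w₁ + 2 * b ^ 2 * w₂) where
  memLp := (hX.memLp.const_smul a).add (hY.memLp.const_smul b)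
  mean := by
    have h := integral_add (hX.integrable.smul a) (hY.integrable.smul b)
    simp only [Pi.smul_apply] at h
    rw [h, integral_smul, integral_smul, hX.mean, hY.mean]
  variance_le := by
    have h1 : ∫ s, ‖(a • X s + b • Y s) - (a • m₁ + b • m₂)‖ ^ 2 ∂ν
        ≤ ∫ s, (2 * a ^ 2 * ‖X s - m₁‖ ^ 2 + 2 * b ^ 2 * ‖Y s - m₂‖ ^ 2) ∂ν := by
      refine integral_mono_of_nonneg (Filter.Eventually.of_forall fun s => by positivity)
        (((hX.integrable_norm_sq m₁).const_mul _).add ((hY.integrable_norm_sq m₂).const_mul _))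
        (Filter.Eventually.of_forall fun s => ?_)
      have e : (a • X s + b • Y s) - (a • m₁ + b • m₂) = a • (X s - m₁) + b • (Y s - m₂) := by
        rw [smul_sub, smul_sub]
        abel
      simp only
      rw [e]
      have h2 := norm_add_le (a • (X s - m₁)) (b • (Y s - m₂))
      rw [norm_smul, norm_smul] at h2
      have h3 := pow_le_pow_left₀ (norm_nonneg _) h2 2
      have h4 := sq_abs a
      have h5 := sq_abs b
      rw [← Real.norm_eq_abs] at h4 h5
      refine h3.trans ((add_sq_le (a := ‖a‖ * ‖X s - m₁‖)).trans (le_of_eq ?_))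
      rw [mul_pow, mul_pow, h4, h5]
      ring
    rw [integral_add ((hX.integrable_norm_sq m₁).const_mul _)
      ((hY.integrable_norm_sq m₂).const_mul _), integral_const_mul, integral_const_mul] at h1
    have h2 := mul_le_mul_of_nonneg_left hX.variance_le (show 0 ≤ 2 * a ^ 2 by positivity)
    have h3 := mul_le_mul_of_nonneg_left hY.variance_le (show 0 ≤ 2 * b ^ 2 by positivity)
    linarith

theorem sub [IsProbabilityMeasure ν] (hX : MeanVar ν X m₁ w₁) (hY : MeanVar ν Y m₂ w₂) :
    MeanVar ν (fun s => X s - Y s) (m₁ - m₂) (2 * w₁ + 2 * w₂) := by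
  have h := hX.smul_add_smul hY 1 (-1)
  simpa [← sub_eq_add_neg] using h

/-- The source of variance reduction: for one sample evaluated at two points, the spread is
controlled by the pointwise difference and not by $\sigma^2$. The factor $4=(1+1)^2$ counts the
difference and its mean. -/
theorem sub_of_norm_le [IsProbabilityMeasure ν] (hX : MeanVar ν X m₁ w₁) (hY : MeanVar ν Y m₂ w₂)
    {D : ℝ} (hD : ∀ s, ‖X s - Y s‖ ^ 2 ≤ D) :
    MeanVar ν (fun s => X s - Y s) (m₁ - m₂) (4 * D) where
  memLp := (hX.sub hY).memLp
  mean := (hX.sub hY).mean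
  variance_le := by
    have h0 : ∀ s, ‖X s - Y s‖ ≤ √D := fun s => Real.le_sqrt_of_sq_le (hD s)
    obtain ⟨s₀⟩ : Nonempty S := nonempty_of_isProbabilityMeasure ν
    have hD0 : 0 ≤ D := (by positivity : (0 : ℝ) ≤ ‖X s₀ - Y s₀‖ ^ 2).trans (hD s₀)
    have h1 : ‖m₁ - m₂‖ ≤ √D := by
      rw [← (hX.sub hY).mean]
      simpa using norm_integral_le_of_norm_le_const (μ := ν) (Filter.Eventually.of_forall h0)
    have h2 : ∀ s, ‖(X s - Y s) - (m₁ - m₂)‖ ^ 2 ≤ 4 * D := fun s => by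
      have h3 := pow_le_pow_left₀ (norm_nonneg _)
        ((norm_sub_le (X s - Y s) (m₁ - m₂)).trans (add_le_add (h0 s) h1)) 2
      have h4 := Real.sq_sqrt hD0
      linarith
    have h3 := integral_mono ((hX.sub hY).integrable_norm_sq (m₁ - m₂)) (integrable_const (4 * D)) h2
    simpa using h3

theorem comp (h : MeanVar ν X m₁ w) {φ : S' → S} (hφ : MeasurePreserving φ ν' ν) :
    MeanVar ν' (fun s => X (φ s)) m₁ w where
  memLp := h.memLp.comp_measurePreserving hφ
  mean := by
    rw [← h.mean, ← hφ.map_eq, integral_map hφ.measurable.aemeasurable]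
    rw [hφ.map_eq]
    exact h.memLp.aestronglyMeasurable
  variance_le := by
    refine le_trans (le_of_eq ?_) h.variance_le
    rw [← hφ.map_eq, integral_map hφ.measurable.aemeasurable]
    rw [hφ.map_eq]
    exact (h.memLp.aestronglyMeasurable.sub aestronglyMeasurable_const).norm.pow 2

end MeanVar

end MeanVar

section Inner

variable {S H : Type*} [MeasurableSpace S] [NormedAddCommGroup H] [InnerProductSpace ℝ H]
  [CompleteSpace H] {ν : Measure S} [IsProbabilityMeasure ν]

/-- Bias–variance decomposition: the cross term vanishes because $X-m_1$ has mean zero. -/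
theorem MeanVar.integral_norm_sub_sq {X : S → H} {m₁ : H} {w : ℝ} (h : MeanVar ν X m₁ w) (x : H) :
    ∫ s, ‖X s - x‖ ^ 2 ∂ν = ‖m₁ - x‖ ^ 2 + ∫ s, ‖X s - m₁‖ ^ 2 ∂ν := by
  have e : ∀ s, ‖X s - x‖ ^ 2
      = ‖X s - m₁‖ ^ 2 + (2 * inner ℝ (m₁ - x) (X s - m₁) + ‖m₁ - x‖ ^ 2) := fun s => by
    rw [show X s - x = (X s - m₁) + (m₁ - x) by abel, norm_add_sq_real, real_inner_comm]
    ring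
  have hi : Integrable (fun s => X s - m₁) ν := h.integrable.sub (integrable_const _)
  have h0 : ∫ s, (X s - m₁) ∂ν = 0 := by
    rw [integral_sub h.integrable (integrable_const _), h.mean]
    simp
  have h1 : ∫ s, inner ℝ (m₁ - x) (X s - m₁) ∂ν = 0 := by
    rw [integral_inner hi, h0, inner_zero_right]
  have hi2 : Integrable (fun s => 2 * inner ℝ (m₁ - x) (X s - m₁)) ν :=
    (hi.const_inner (𝕜 := ℝ) (m₁ - x)).const_mul 2
  have hi3 : Integrable (fun s => 2 * inner ℝ (m₁ - x) (X s - m₁) + ‖m₁ - x‖ ^ 2) ν :=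
    hi2.add (integrable_const _)
  simp_rw [e]
  rw [integral_add (h.integrable_norm_sq m₁) hi3,
    integral_add hi2 (integrable_const _), integral_const_mul, h1, integral_const]
  simp
  ring

theorem MeanVar.integral_norm_sub_sq_le {X : S → H} {m₁ : H} {w : ℝ} (h : MeanVar ν X m₁ w)
    (x : H) : ∫ s, ‖X s - x‖ ^ 2 ∂ν ≤ ‖m₁ - x‖ ^ 2 + w := by
  rw [h.integral_norm_sub_sq x]
  linarith [h.variance_le]

omit [CompleteSpace H] in
/-- Averaging over a set of indices does not increase the average variance. -/
theorem MeanVar.average {ι : Type*} (A : Finset ι) {X : ι → S → H} {m₁ : ι → H} {w : ι → ℝ}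
    (h : ∀ i, MeanVar ν (X i) (m₁ i) (w i)) :
    MeanVar ν (fun s => (#A : ℝ)⁻¹ • ∑ i ∈ A, X i s) ((#A : ℝ)⁻¹ • ∑ i ∈ A, m₁ i)
      ((#A : ℝ)⁻¹ * ∑ i ∈ A, w i) where
  memLp := (memLp_finsetSum A fun i _ => (h i).memLp).const_smul _
  mean := by
    rw [integral_smul, integral_finsetSum A fun i _ => (h i).integrable]
    simp_rw [fun i => (h i).mean]
  variance_le := by
    have h1 : ∫ s, ‖(#A : ℝ)⁻¹ • ∑ i ∈ A, X i s - (#A : ℝ)⁻¹ • ∑ i ∈ A, m₁ i‖ ^ 2 ∂ν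
        ≤ ∫ s, (#A : ℝ)⁻¹ * ∑ i ∈ A, ‖X i s - m₁ i‖ ^ 2 ∂ν := by
      refine integral_mono_of_nonneg (Filter.Eventually.of_forall fun s => by positivity)
        ((integrable_finsetSum A fun i _ => (h i).integrable_norm_sq (m₁ i)).const_mul _)
        (Filter.Eventually.of_forall fun s => ?_)
      simp only
      rw [← smul_sub, ← sum_sub_distrib]
      exact norm_average_sq_le A _
    rw [integral_const_mul,
      integral_finsetSum A fun i _ => (h i).integrable_norm_sq (m₁ i)] at h1
    exact h1.trans (mul_le_mul_of_nonneg_left (sum_le_sum fun i _ => (h i).variance_le)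
      (by positivity))

end Inner

/-- The mean of `n` independent samples has variance at most `w / n`. -/
theorem MeanVar.batchMean {S : Type*} [MeasurableSpace S] {ν : Measure S} [IsProbabilityMeasure ν]
    {d n : ℕ} (hn : 1 ≤ n) {X : S → E d} {m₁ : E d} {w : ℝ} (h : MeanVar ν X m₁ w) :
    MeanVar (Measure.pi fun _ : Fin n => ν) (BSVRB.batchMean X) m₁ (w / n) := by
  have hn' : (0 : ℝ) < n := by exact_mod_cast hn
  have hk : ∀ k : Fin n, MeanVar (Measure.pi fun _ : Fin n => ν) (fun b => X (b k)) m₁ w :=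
    fun k => h.comp (measurePreserving_eval (fun _ : Fin n => ν) k)
  have hA := MeanVar.average (univ : Finset (Fin n)) hk
  have e : (#(univ : Finset (Fin n)) : ℝ)⁻¹ • ∑ _i : Fin n, m₁ = m₁ := by
    rw [sum_const, card_univ, Fintype.card_fin, ← Nat.cast_smul_eq_nsmul ℝ, smul_smul,
      inv_mul_cancel₀ hn'.ne', one_smul]
  rw [e] at hA
  have hm : ∀ b : Fin n → S, BSVRB.batchMean X b
      = (#(univ : Finset (Fin n)) : ℝ)⁻¹ • ∑ i, X (b i) := fun b => by
    rw [BSVRB.batchMean, card_univ, Fintype.card_fin]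
  refine ⟨?_, ?_, ?_⟩
  · simpa only [funext hm] using hA.memLp
  · simpa only [funext hm] using hA.mean
  have hl : ∀ l : Fin d, MemLp (fun s => X s l) 2 ν := memLp_piLp_iff.1 h.memLp
  have hml : ∀ l : Fin d, ∫ s, X s l ∂ν = m₁ l := fun l => by
    rw [← h.mean, eval_integral_piLp (integrable_piLp_iff.1 h.integrable)]
  have hsq : ∀ l, Integrable (fun s => (X s l - m₁ l) ^ 2) ν := fun l =>
    ((hl l).sub (memLp_const (m₁ l))).integrable_sq
  have hml' : ∀ l : Fin d, ∫ b, (BSVRB.batchMean X b) l ∂(Measure.pi fun _ : Fin n => ν) = m₁ l :=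
    fun l => by
      have h1 := eval_integral_piLp (integrable_piLp_iff.1 hA.integrable) l
      rw [hA.mean] at h1
      simp_rw [hm]
      exact h1.symm
  have hlA : ∀ l : Fin d, MemLp (fun b => BSVRB.batchMean X b l) 2 (Measure.pi fun _ : Fin n => ν) :=
    fun l => by
      simp_rw [hm]
      exact memLp_piLp_iff.1 hA.memLp l
  -- The gain $1/n$ is additivity of the variance over independent samples. That is a statement
  -- about real random variables, so it is used coordinate by coordinate and summed afterwards.
  have key : ∀ l : Fin d, ∫ b, (BSVRB.batchMean X b l - m₁ l) ^ 2 ∂(Measure.pi fun _ : Fin n => ν)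
      = (∫ s, (X s l - m₁ l) ^ 2 ∂ν) / n := fun l => by
    have h1 := variance_sum_pi (μ := fun _ : Fin n => ν) (X := fun _ s => X s l) fun _ => hl l
    have h2 := variance_eq_integral (hlA l).aestronglyMeasurable.aemeasurable
    rw [hml' l] at h2
    have h3 := variance_eq_integral (hl l).aestronglyMeasurable.aemeasurable
    rw [hml l] at h3
    rw [← h2, ← h3]
    have h4 : (fun b => BSVRB.batchMean X b l)
        = fun b => (n : ℝ)⁻¹ * (∑ i, fun ω : Fin n → S => X (ω i) l) b := by
      funext b
      simp [BSVRB.batchMean]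
    rw [h4, variance_const_mul, h1]
    simp
    field_simp
  simp_rw [EuclideanSpace.real_norm_sq_eq, PiLp.sub_apply]
  have hv := h.variance_le
  simp_rw [EuclideanSpace.real_norm_sq_eq, PiLp.sub_apply] at hv
  rw [integral_finsetSum _ fun l _ => hsq l] at hv
  have hsqA : ∀ l, Integrable (fun b => (BSVRB.batchMean X b l - m₁ l) ^ 2)
      (Measure.pi fun _ : Fin n => ν) := fun l => ((hlA l).sub (memLp_const (m₁ l))).integrable_sq
  rw [integral_finsetSum _ fun l _ => hsqA l]
  simp_rw [key]
  rw [← sum_div]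
  exact div_le_div_of_nonneg_right hv hn'.le

/-! ### Sampling blocks uniformly without replacement -/

section Blocks

/-- The average of `φ` over the subsets of `Fin m` with `I` elements. -/
noncomputable def blockAvg (m I : ℕ) (φ : Finset (Fin m) → ℝ) : ℝ :=
  (m.choose I : ℝ)⁻¹ * ∑ A ∈ powersetCard I univ, φ A

variable {m I : ℕ}

theorem choose_cast_pos (hIm : I ≤ m) : (0 : ℝ) < m.choose I := by
  exact_mod_cast Nat.choose_pos hIm

theorem blockAvg_mono {φ ψ : Finset (Fin m) → ℝ} (h : ∀ A, #A = I → φ A ≤ ψ A) :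
    blockAvg m I φ ≤ blockAvg m I ψ :=
  mul_le_mul_of_nonneg_left (sum_le_sum fun A hA => h A (mem_powersetCard_univ.1 hA))
    (by positivity)

theorem blockAvg_add (φ ψ : Finset (Fin m) → ℝ) :
    blockAvg m I (fun A => φ A + ψ A) = blockAvg m I φ + blockAvg m I ψ := by
  rw [blockAvg, sum_add_distrib, mul_add]
  rfl

theorem blockAvg_const_mul (x : ℝ) (φ : Finset (Fin m) → ℝ) :
    blockAvg m I (fun A => x * φ A) = x * blockAvg m I φ := by
  rw [blockAvg, ← mul_sum, mul_left_comm]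
  rfl

theorem blockAvg_const (hIm : I ≤ m) (x : ℝ) : blockAvg m I (fun _ => x) = x := by
  rw [blockAvg, sum_const, card_powersetCard, card_univ, Fintype.card_fin, nsmul_eq_mul,
    ← mul_assoc, inv_mul_cancel₀ (choose_cast_pos hIm).ne', one_mul]

theorem blockAvg_sum {ι : Type*} (s : Finset ι) (φ : ι → Finset (Fin m) → ℝ) :
    blockAvg m I (fun A => ∑ i ∈ s, φ i A) = ∑ i ∈ s, blockAvg m I (φ i) := by
  simp_rw [blockAvg]
  rw [sum_comm, mul_sum]

/-- A block is chosen with probability `I / m`. -/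
theorem blockAvg_indicator (hI : 1 ≤ I) (hIm : I ≤ m) (i : Fin m) :
    blockAvg m I (fun A => if i ∈ A then 1 else 0) = I / m := by
  have h1 := card_filter_powersetCard_subset {i} (univ : Finset (Fin m)) I (subset_univ _)
    (by simpa using hI)
  simp only [singleton_subset_iff, card_singleton, card_univ, Fintype.card_fin] at h1
  rw [blockAvg, sum_boole, h1]
  obtain ⟨m, rfl⟩ : ∃ n, m = n + 1 := ⟨m - 1, by omega⟩
  obtain ⟨I, rfl⟩ : ∃ n, I = n + 1 := ⟨I - 1, by omega⟩
  have h2 : ((m + 1 : ℕ) : ℝ) * m.choose I = (m + 1).choose (I + 1) * ((I + 1 : ℕ) : ℝ) := by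
    exact_mod_cast Nat.add_one_mul_choose_eq m I
  have h3 := choose_cast_pos hIm
  simp only [Nat.add_sub_cancel]
  have h4 : (0 : ℝ) < ((m + 1 : ℕ) : ℝ) := by positivity
  rw [inv_mul_eq_div, div_eq_div_iff h3.ne' h4.ne']
  linarith

theorem blockAvg_ite (hI : 1 ≤ I) (hIm : I ≤ m) (i : Fin m) (x y : ℝ) :
    blockAvg m I (fun A => if i ∈ A then x else y) = I / m * x + (1 - I / m) * y := by
  have h : (fun A : Finset (Fin m) => if i ∈ A then x else y)
      = fun A => (x - y) * (if i ∈ A then 1 else 0) + y := by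
    funext A
    split_ifs <;> ring
  rw [h, blockAvg_add, blockAvg_const_mul, blockAvg_indicator hI hIm, blockAvg_const hIm]
  ring

theorem blockAvg_sum_mem (hI : 1 ≤ I) (hIm : I ≤ m) (w : Fin m → ℝ) :
    blockAvg m I (fun A => ∑ i ∈ A, w i) = I / m * ∑ i, w i := by
  have h : (fun A : Finset (Fin m) => ∑ i ∈ A, w i)
      = fun A => ∑ i, (if i ∈ A then w i else 0) := by
    funext A
    rw [sum_ite_mem, univ_inter]
  rw [h, blockAvg_sum, mul_sum]
  exact sum_congr rfl fun i _ => by rw [blockAvg_ite hI hIm]; ring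

/-- The probability that two given distinct blocks are chosen does not depend on the blocks. -/
theorem exists_blockAvg_pair (m I : ℕ) : ∃ q : ℝ, 0 ≤ q ∧ ∀ i j : Fin m, i ≠ j →
    blockAvg m I (fun A => if i ∈ A ∧ j ∈ A then 1 else 0) = q := by
  by_cases hI : 2 ≤ I
  · refine ⟨(m.choose I : ℝ)⁻¹ * (m - 2).choose (I - 2), by positivity, fun i j hij => ?_⟩
    have h1 := card_filter_powersetCard_subset {i, j} (univ : Finset (Fin m)) I (subset_univ _)
      (by rwa [card_pair hij])
    simp only [card_pair hij, card_univ, Fintype.card_fin, insert_subset_iff,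
      singleton_subset_iff] at h1
    rw [blockAvg, sum_boole, h1]
  · refine ⟨0, le_rfl, fun i j hij => ?_⟩
    rw [blockAvg, sum_boole, filter_eq_empty_iff.2, card_empty, Nat.cast_zero, mul_zero]
    rintro A hA ⟨h1, h2⟩
    have h3 : #({i, j} : Finset (Fin m)) ≤ #A :=
      card_le_card (insert_subset_iff.2 ⟨h1, singleton_subset_iff.2 h2⟩)
    rw [card_pair hij, mem_powersetCard_univ.1 hA] at h3
    exact hI h3

/-- All pairs of distinct blocks have the same selection probability $q$, so the average equals
$q\|\sum_ix_i\|^2+(I/m-q)\sum_i\|x_i\|^2$. The first term vanishes for a centred family, and $q\ge0$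
bounds the second. -/
theorem blockAvg_norm_sum_sq_le {H : Type*} [NormedAddCommGroup H] [InnerProductSpace ℝ H]
    (hI : 1 ≤ I) (hIm : I ≤ m) (x : Fin m → H) (hx : ∑ i, x i = 0) :
    blockAvg m I (fun A => ‖∑ i ∈ A, x i‖ ^ 2) ≤ I / m * ∑ i, ‖x i‖ ^ 2 := by
  obtain ⟨q, hq0, hq⟩ := exists_blockAvg_pair m I
  have h1 : (fun A : Finset (Fin m) => ‖∑ i ∈ A, x i‖ ^ 2)
      = fun A => ∑ i, ∑ j, inner ℝ (x i) (x j) * (if i ∈ A ∧ j ∈ A then 1 else 0) := by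
    funext A
    rw [← real_inner_self_eq_norm_sq, sum_inner]
    simp_rw [inner_sum]
    simp_rw [mul_ite, mul_one, mul_zero, ite_and]
    rw [← sum_subset (subset_univ A) fun i _ hi => by simp [hi]]
    refine sum_congr rfl fun i hi => ?_
    simp [hi]
  have h2 : ∀ i j, blockAvg m I (fun A => if i ∈ A ∧ j ∈ A then 1 else 0)
      = q + if i = j then ((I : ℝ) / m - q) else 0 := fun i j => by
    split_ifs with hij
    · subst hij
      simp_rw [and_self]
      rw [blockAvg_indicator hI hIm]
      ring
    · rw [hq i j hij, add_zero]
  rw [h1, blockAvg_sum]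
  simp_rw [blockAvg_sum, blockAvg_const_mul, h2, mul_add, sum_add_distrib, mul_ite, mul_zero,
    sum_ite_eq, mem_univ, if_true, real_inner_self_eq_norm_sq, ← sum_mul]
  have h3 : ∑ i, ∑ j, inner ℝ (x i) (x j) = 0 := by
    simp_rw [← inner_sum, ← sum_inner]
    rw [hx, inner_zero_left]
  rw [h3, zero_mul, zero_add, mul_comm]
  exact mul_le_mul_of_nonneg_right (by linarith) (sum_nonneg fun i _ => by positivity)

/-- Mean squared distance of the average over a random set of `I` blocks from a point. -/
theorem blockAvg_norm_average_sub_sq_le {H : Type*} [NormedAddCommGroup H] [InnerProductSpace ℝ H]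
    (hI : 1 ≤ I) (hIm : I ≤ m) (x : Fin m → H) (y : H) :
    blockAvg m I (fun A => ‖(#A : ℝ)⁻¹ • ∑ i ∈ A, x i - y‖ ^ 2)
      ≤ ‖(m : ℝ)⁻¹ • ∑ i, x i - y‖ ^ 2
        + (if I < m then 1 / (I : ℝ) else 0) * ((m : ℝ)⁻¹ * ∑ i, ‖x i‖ ^ 2) := by
  have hI' : (0 : ℝ) < I := by exact_mod_cast hI
  have hm' : (0 : ℝ) < m := by exact_mod_cast hI.trans hIm
  set c : H := (m : ℝ)⁻¹ • ∑ i, x i with hc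
  by_cases hlt : I < m
  swap
  · have : I = m := by omega
    rw [if_neg hlt, zero_mul, add_zero]
    have h1 := blockAvg_const hIm (‖c - y‖ ^ 2)
    rw [← h1]
    refine blockAvg_mono fun A hA => le_of_eq ?_
    have h2 : A = univ := (card_eq_iff_eq_univ A).1 (by rw [hA, this, Fintype.card_fin])
    rw [h2, card_univ, Fintype.card_fin, ← hc]
  rw [if_pos hlt]
  have hsum : ∑ i, x i = (m : ℝ) • c := by rw [hc, smul_smul, mul_inv_cancel₀ hm'.ne', one_smul]
  have h0 : ∑ i, (x i - c) = 0 := by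
    rw [sum_sub_distrib, sum_const, card_univ, Fintype.card_fin, hsum, Nat.cast_smul_eq_nsmul,
      sub_self]
  have hvar : ∑ i, ‖x i - c‖ ^ 2 ≤ ∑ i, ‖x i‖ ^ 2 := by
    have : ∑ i, ‖x i - c‖ ^ 2 = ∑ i, ‖x i‖ ^ 2 - m * ‖c‖ ^ 2 := by
      simp_rw [norm_sub_sq_real]
      rw [sum_add_distrib, sum_sub_distrib, ← mul_sum, ← sum_inner, hsum, inner_smul_left,
        real_inner_self_eq_norm_sq]
      simp
      ring
    rw [this]
    have : 0 ≤ (m : ℝ) * ‖c‖ ^ 2 := by positivity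
    linarith
  -- Expand around the overall mean $c$: the linear term averages to zero, and the quadratic one
  -- falls under `blockAvg_norm_sum_sq_le`.
  have h1 : ∀ A : Finset (Fin m), #A = I → ‖(#A : ℝ)⁻¹ • ∑ i ∈ A, x i - y‖ ^ 2
      = (((I : ℝ)⁻¹) ^ 2 * ‖∑ i ∈ A, (x i - c)‖ ^ 2
        + (2 * (I : ℝ)⁻¹) * ∑ i ∈ A, inner ℝ (x i - c) (c - y)) + ‖c - y‖ ^ 2 := fun A hA => by
    have e : (#A : ℝ)⁻¹ • ∑ i ∈ A, x i - y = (I : ℝ)⁻¹ • ∑ i ∈ A, (x i - c) + (c - y) := by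
      rw [sum_sub_distrib, sum_const, hA, smul_sub, ← Nat.cast_smul_eq_nsmul ℝ, smul_smul,
        inv_mul_cancel₀ hI'.ne', one_smul]
      abel
    rw [e, norm_add_sq_real, inner_smul_left, sum_inner, norm_smul, mul_pow, norm_inv,
      Real.norm_natCast]
    simp only [conj_trivial]
    ring
  refine (blockAvg_mono fun A hA => (h1 A hA).le).trans ?_
  rw [blockAvg_add, blockAvg_add, blockAvg_const_mul, blockAvg_const_mul, blockAvg_const hIm,
    blockAvg_sum_mem hI hIm, ← sum_inner, h0, inner_zero_left, mul_zero, mul_zero, add_zero]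
  have h2 := (blockAvg_norm_sum_sq_le hI hIm _ h0).trans
    (mul_le_mul_of_nonneg_left hvar (by positivity))
  have h3 := mul_le_mul_of_nonneg_left h2 (show 0 ≤ ((I : ℝ)⁻¹) ^ 2 by positivity)
  have h4 : ((I : ℝ)⁻¹) ^ 2 * (I / m * ∑ i, ‖x i‖ ^ 2)
      = 1 / (I : ℝ) * ((m : ℝ)⁻¹ * ∑ i, ‖x i‖ ^ 2) := by
    field_simp
  linarith

end Blocks

/-! ### Integration with respect to the law of one iteration -/

section IterLaw

variable {m dx : ℕ} {dy : Fin m → ℕ} {Ξ Z : Type*} [MeasurableSpace Ξ] [MeasurableSpace Z]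
  (p : Problem m dx dy Ξ Z)

instance (n : ℕ) : IsProbabilityMeasure (batchesLaw p n) := by
  unfold batchesLaw
  infer_instance

/-- As a finite mixture over block sets, the law of an iteration needs integrability only for each
fixed set, and integration becomes `blockAvg` of an integral over the batches. -/
theorem uniformOn_prod_eq_sum {𝓑 : Type*} [MeasurableSpace 𝓑] (ν : Measure 𝓑) [SFinite ν] (I : ℕ) :
    (uniformOn {A : Finset (Fin m) | A.card = I}).prod ν
      = ∑ A ∈ powersetCard I univ, ((m.choose I : ENNReal)⁻¹) • ν.map (Prod.mk A) := by
  have hset : {A : Finset (Fin m) | A.card = I} = ↑(powersetCard I (univ : Finset (Fin m))) := by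
    ext A
    simp
  rw [hset, uniformOn, ProbabilityTheory.cond, Measure.count_apply_finset, card_powersetCard,
    card_univ, Fintype.card_fin]
  ext s hs
  rw [Measure.prod_apply hs, lintegral_smul_measure, lintegral_finset]
  simp only [Measure.count_singleton, mul_one, Measure.coe_finsetSum, Finset.sum_apply,
    Measure.smul_apply]
  rw [smul_eq_mul, mul_sum]
  exact sum_congr rfl fun A _ => by
    rw [Measure.map_apply measurable_prodMk_left hs, smul_eq_mul]

theorem iterLaw_eq_sum (I B : ℕ) : iterLaw p I B
    = ∑ A ∈ powersetCard I univ, ((m.choose I : ENNReal)⁻¹) • (batchesLaw p B).map (Prod.mk A) :=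
  uniformOn_prod_eq_sum _ I

theorem isProbabilityMeasure_iterLaw {I : ℕ} (hIm : I ≤ m) (B : ℕ) :
    IsProbabilityMeasure (iterLaw p I B) := by
  have : IsProbabilityMeasure (uniformOn {A : Finset (Fin m) | A.card = I}) := by
    refine isProbabilityMeasure_uniformOn (Set.toFinite _) ?_
    obtain ⟨A, hA⟩ := powersetCard_nonempty.2 (show I ≤ #(univ : Finset (Fin m)) by simpa)
    exact ⟨A, mem_powersetCard_univ.1 hA⟩
  unfold iterLaw
  infer_instance

variable {p}

theorem integrable_iterLaw {I B : ℕ} {H : Type*} [NormedAddCommGroup H]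
    {φ : IterSample m B Ξ Z → H} (hIm : I ≤ m)
    (hφ : ∀ A, #A = I → Integrable (fun b => φ (A, b)) (batchesLaw p B)) :
    Integrable φ (iterLaw p I B) := by
  rw [iterLaw_eq_sum, integrable_finsetSum_measure]
  intro A hA
  refine Integrable.smul_measure ?_ ?_
  · rw [(measurableEmbedding_prodMk_left A).integrable_map_iff]
    exact hφ A (mem_powersetCard_univ.1 hA)
  · simpa using (Nat.choose_pos hIm).ne'

theorem integral_iterLaw {I B : ℕ} {φ : IterSample m B Ξ Z → ℝ} (hIm : I ≤ m)
    (hφ : ∀ A, #A = I → Integrable (fun b => φ (A, b)) (batchesLaw p B)) :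
    ∫ w, φ w ∂(iterLaw p I B) = blockAvg m I fun A => ∫ b, φ (A, b) ∂(batchesLaw p B) := by
  have h := integrable_iterLaw hIm hφ
  rw [iterLaw_eq_sum, integrable_finsetSum_measure] at h
  rw [iterLaw_eq_sum, integral_finsetSum_measure h, blockAvg, mul_sum]
  refine sum_congr rfl fun A _ => ?_
  rw [integral_smul_measure, (measurableEmbedding_prodMk_left A).integral_map]
  simp

end IterLaw

end BSVRB

namespace BSVRB

/-! ### Elementary inequalities -/

section Elementary

theorem norm_add_sq_le_two {H : Type*} [SeminormedAddCommGroup H] (a b : H) :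
    ‖a + b‖ ^ 2 ≤ 2 * ‖a‖ ^ 2 + 2 * ‖b‖ ^ 2 := by
  have h := pow_le_pow_left₀ (norm_nonneg _) (norm_add_le a b) 2
  have h2 := add_sq_le (a := ‖a‖) (b := ‖b‖)
  linarith

theorem norm_sub_sq_le_two {H : Type*} [SeminormedAddCommGroup H] (a b : H) :
    ‖a - b‖ ^ 2 ≤ 2 * ‖a‖ ^ 2 + 2 * ‖b‖ ^ 2 := by
  simpa [sub_eq_add_neg] using norm_add_sq_le_two a (-b)

theorem norm_add_add_sq_le {H : Type*} [SeminormedAddCommGroup H] (a b c : H) :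
    ‖a + b + c‖ ^ 2 ≤ 3 * ‖a‖ ^ 2 + 3 * ‖b‖ ^ 2 + 3 * ‖c‖ ^ 2 := by
  have h := pow_le_pow_left₀ (norm_nonneg _) (norm_add₃_le (a := a) (b := b) (c := c)) 2
  nlinarith [sq_nonneg (‖a‖ - ‖b‖), sq_nonneg (‖a‖ - ‖c‖), sq_nonneg (‖b‖ - ‖c‖)]

theorem norm_add_sq_le_young {H : Type*} [SeminormedAddCommGroup H] (a b : H) {c : ℝ}
    (hc : 0 < c) : ‖a + b‖ ^ 2 ≤ (1 + c) * ‖a‖ ^ 2 + (1 + 1 / c) * ‖b‖ ^ 2 := by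
  have h := pow_le_pow_left₀ (norm_nonneg _) (norm_add_le a b) 2
  have h2 : 0 ≤ (c * ‖a‖ - ‖b‖) ^ 2 / c := by positivity
  have h3 : (c * ‖a‖ - ‖b‖) ^ 2 / c = c * ‖a‖ ^ 2 + 1 / c * ‖b‖ ^ 2 - 2 * ‖a‖ * ‖b‖ := by
    field_simp
    ring
  nlinarith

/-- Contraction of an inexact gradient step towards a moving target. -/
theorem contraction_step {H : Type*} [SeminormedAddCommGroup H] [NormedSpace ℝ H]
    {e e₁ e₂ r δ : H} {t l : ℝ} (ht : 0 < t) (hl : 0 < l) (htl : t * l ≤ 1)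
    (h₁ : ‖e₁‖ ^ 2 ≤ (1 - t * l) * ‖e‖ ^ 2) (h₂ : ‖e₂‖ ≤ ‖e₁ - t • r‖) :
    ‖e₂ + δ‖ ^ 2 ≤ (1 - t * l / 2) * ‖e‖ ^ 2 + 7 / l * (t * ‖r‖ ^ 2)
      + 5 / l * (‖δ‖ ^ 2 / t) := by
  -- Both Young inequalities use the weight $tl/4$, since $(1+\frac{tl}4)^2(1-tl)\le1-\frac{tl}2$.
  -- Under $tl\le1$ the reciprocal weights give $tl+4\le5$, and $\frac54\cdot5\le7$.
  have hc : 0 < t * l / 4 := by positivity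
  have h3 := norm_add_sq_le_young e₁ (-(t • r)) hc
  rw [← sub_eq_add_neg, norm_neg, norm_smul, Real.norm_of_nonneg ht.le, mul_pow] at h3
  have h4 := norm_add_sq_le_young e₂ δ hc
  have h5 := pow_le_pow_left₀ (norm_nonneg _) h₂ 2
  have h6 : (1 + 1 / (t * l / 4)) * (t ^ 2 * ‖r‖ ^ 2) ≤ 5 / l * (t * ‖r‖ ^ 2) := by
    have : (1 + 1 / (t * l / 4)) * (t ^ 2 * ‖r‖ ^ 2) = (t * l + 4) / l * (t * ‖r‖ ^ 2) := by
      field_simp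
    rw [this]
    gcongr
    linarith
  have h7 : (1 + 1 / (t * l / 4)) * ‖δ‖ ^ 2 ≤ 5 / l * (‖δ‖ ^ 2 / t) := by
    have : (1 + 1 / (t * l / 4)) * ‖δ‖ ^ 2 = (t * l + 4) / l * (‖δ‖ ^ 2 / t) := by
      field_simp
    rw [this]
    gcongr
    linarith
  have h8 : ‖e₂‖ ^ 2 ≤ (1 + t * l / 4) * ((1 - t * l) * ‖e‖ ^ 2) + 5 / l * (t * ‖r‖ ^ 2) :=
    h5.trans (h3.trans (add_le_add (mul_le_mul_of_nonneg_left h₁ (by positivity)) h6))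
  have h9 := mul_le_mul_of_nonneg_left h8 (show 0 ≤ 1 + t * l / 4 by positivity)
  have h10 : (1 + t * l / 4) * ((1 + t * l / 4) * ((1 - t * l) * ‖e‖ ^ 2))
      ≤ (1 - t * l / 2) * ‖e‖ ^ 2 := by
    rw [← mul_assoc, ← mul_assoc]
    gcongr
    nlinarith [mul_pos ht hl, mul_pos (mul_pos ht hl) (mul_pos ht hl)]
  have h11 : (1 + t * l / 4) * (5 / l * (t * ‖r‖ ^ 2)) ≤ 7 / l * (t * ‖r‖ ^ 2) := by
    have h12 : 0 ≤ t * ‖r‖ ^ 2 / l := by positivity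
    have h13 : (1 + t * l / 4) * (5 / l * (t * ‖r‖ ^ 2))
        = (1 + t * l / 4) * 5 * (t * ‖r‖ ^ 2 / l) := by ring
    have h14 : 7 / l * (t * ‖r‖ ^ 2) = 7 * (t * ‖r‖ ^ 2 / l) := by ring
    rw [h13, h14]
    gcongr
    linarith
  linarith

/-- Outside the ball the projection is $ka$ with $k=V/\|a\|<1$. Write $a-b=(ka-b)+(1-k)a$. The cross
term is nonnegative, because $\langle b,a\rangle\le V\|a\|=k\|a\|^2$. -/
theorem norm_projBall_sub_le {n : ℕ} {V : ℝ} (a b : E n) (hb : ‖b‖ ≤ V) :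
    ‖projBall V a - b‖ ≤ ‖a - b‖ := by
  unfold projBall
  split_ifs with h
  · exact le_rfl
  push Not at h
  have hV : 0 ≤ V := (norm_nonneg b).trans hb
  have ha : 0 < ‖a‖ := hV.trans_lt h
  set k := V / ‖a‖ with hk
  have hk1 : k ≤ 1 := (div_le_one ha).2 h.le
  have hka : k * ‖a‖ = V := div_mul_cancel₀ _ ha.ne'
  have e : a - b = (k • a - b) + (1 - k) • a := by
    rw [sub_smul, one_smul]
    abel
  refine le_of_sq_le_sq ?_ (norm_nonneg _)
  rw [e, norm_add_sq_real, inner_smul_right, inner_sub_left, inner_smul_left,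
    real_inner_self_eq_norm_sq]
  simp only [conj_trivial]
  have h1 := real_inner_le_norm b a
  have h2 : ‖b‖ * ‖a‖ ≤ V * ‖a‖ := mul_le_mul_of_nonneg_right hb ha.le
  have h3 : k * ‖a‖ ^ 2 = V * ‖a‖ := by rw [← hka]; ring
  have h4 : 0 ≤ (1 - k) * (k * ‖a‖ ^ 2 - inner ℝ b a) :=
    mul_nonneg (by linarith) (by linarith)
  have h5 : 0 ≤ ‖(1 - k) • a‖ ^ 2 := by positivity
  linarith

theorem norm_projBall_le {n : ℕ} {V : ℝ} (hV : 0 ≤ V) (a : E n) : ‖projBall V a‖ ≤ V := by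
  unfold projBall
  split_ifs with h
  · exact h
  push Not at h
  have ha : 0 < ‖a‖ := hV.trans_lt h
  rw [norm_smul, Real.norm_of_nonneg (by positivity), div_mul_cancel₀ _ ha.ne']

/-- The splitting $(A-A')v+A'(v-v')$ asks only for $v$ to lie in the ball and only for $A'$ to be
bounded. -/
theorem norm_apply_sub_sq_le {F G : Type*} [NormedAddCommGroup F] [NormedSpace ℝ F]
    [NormedAddCommGroup G] [NormedSpace ℝ G] {A A' : F →L[ℝ] G} {v v' : F} {D C V : ℝ}
    (hA : ‖A - A'‖ ^ 2 ≤ D) (hA' : ‖A'‖ ^ 2 ≤ C ^ 2) (hv : ‖v‖ ≤ V) :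
    ‖A v - A' v'‖ ^ 2 ≤ 2 * (V ^ 2 * D) + 2 * (C ^ 2 * ‖v - v'‖ ^ 2) := by
  have e : A v - A' v' = (A - A') v + A' (v - v') := by
    rw [map_sub, _root_.sub_apply]
    abel
  rw [e]
  refine (norm_add_sq_le_two _ _).trans ?_
  have h1 := pow_le_pow_left₀ (norm_nonneg _) ((A - A').le_opNorm v) 2
  have h2 := pow_le_pow_left₀ (norm_nonneg _) (A'.le_opNorm (v - v')) 2
  rw [mul_pow] at h1 h2
  have h3 := pow_le_pow_left₀ (norm_nonneg _) hv 2
  have h4 := mul_le_mul hA h3 (by positivity) ((by positivity : 0 ≤ ‖A - A'‖ ^ 2).trans hA)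
  have h5 := mul_le_mul_of_nonneg_right hA' (show 0 ≤ ‖v - v'‖ ^ 2 by positivity)
  linarith

end Elementary

/-! ### Batch estimators -/

variable {m dx : ℕ} {dy : Fin m → ℕ} {Ξ Z : Type*} [MeasurableSpace Ξ] [MeasurableSpace Z]
  {p : Problem m dx dy Ξ Z} {c : Consts}

/-- `∇_v φ_i(v, x, y) = ∇²_yy g_i(x, y) v - ∇_y f_i(x, y)`. -/
noncomputable def Problem.gradPhi (p : Problem m dx dy Ξ Z) (i : Fin m) (v : E (dy i)) (x : E dx)
    (y : E (dy i)) : E (dy i) :=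
  hessYY (p.gbar i) x y v - gradY (p.fbar i) x y

/-- The contribution of block `i` to the hypergradient estimate. -/
noncomputable def Problem.block (p : Problem m dx dy Ξ Z) (i : Fin m) (x : E dx)
    (y v : E (dy i)) : E dx :=
  gradX (p.fbar i) x y - hessXY (p.gbar i) x y v

/-- The contribution of block `i` to the stochastic hypergradient estimate. -/
noncomputable def blockHat (p : Problem m dx dy Ξ Z) {n : ℕ} (b : Batches m n Ξ Z) (i : Fin m)
    (x : E dx) (y v : E (dy i)) : E dx :=
  batchMean (fun ξ => gradX (p.f i ξ) x y) (b.1 i)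
    - (batchMean (fun ζ => hessXY (p.g i ζ) x y) (b.2 i)) v

theorem batchMean_apply {S F G : Type*} [NormedAddCommGroup F] [NormedSpace ℝ F]
    [NormedAddCommGroup G] [NormedSpace ℝ G] {n : ℕ} (A : S → F →L[ℝ] G) (b : Fin n → S) (v : F) :
    (batchMean A b) v = batchMean (fun s => A s v) b := by
  simp [batchMean, _root_.sum_apply]

theorem batchMean_sub {S H : Type*} [AddCommGroup H] [Module ℝ H] {n : ℕ} (φ ψ : S → H)
    (b : Fin n → S) : batchMean (fun s => φ s - ψ s) b = batchMean φ b - batchMean ψ b := by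
  simp [batchMean, smul_sub, sum_sub_distrib]

theorem measurePreserving_batch_fst (p : Problem m dx dy Ξ Z) (n : ℕ) (i : Fin m) :
    MeasurePreserving (fun b : Batches m n Ξ Z => b.1 i) (batchesLaw p n)
      (Measure.pi fun _ : Fin n => p.P i) :=
  (measurePreserving_eval (fun i => Measure.pi fun _ : Fin n => p.P i) i).comp
    measurePreserving_fst

theorem measurePreserving_batch_snd (p : Problem m dx dy Ξ Z) (n : ℕ) (i : Fin m) :
    MeasurePreserving (fun b : Batches m n Ξ Z => b.2 i) (batchesLaw p n)
      (Measure.pi fun _ : Fin n => p.Q i) :=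
  (measurePreserving_eval (fun i => Measure.pi fun _ : Fin n => p.Q i) i).comp
    measurePreserving_snd

theorem meanVar_batch_sub {n d : ℕ} (hn : 1 ≤ n) (i : Fin m) {φ : Ξ → E d} {ψ : Z → E d}
    {a b : E d} {w₁ w₂ : ℝ} (hφ : MeanVar (p.P i) φ a w₁) (hψ : MeanVar (p.Q i) ψ b w₂) :
    MeanVar (batchesLaw p n) (fun s => batchMean φ (s.1 i) - batchMean ψ (s.2 i)) (a - b)
      ((2 * w₁ + 2 * w₂) / n) :=
  (((hφ.batchMean hn).comp (measurePreserving_batch_fst p n i)).sub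
    ((hψ.batchMean hn).comp (measurePreserving_batch_snd p n i))).mono (le_of_eq (by ring))

theorem meanVar_batch_sub' {n d : ℕ} (hn : 1 ≤ n) (i : Fin m) {φ : Ξ → E d} {ψ : Z → E d}
    {a b : E d} {w₁ w₂ : ℝ} (hφ : MeanVar (p.P i) φ a w₁) (hψ : MeanVar (p.Q i) ψ b w₂) :
    MeanVar (batchesLaw p n) (fun s => batchMean ψ (s.2 i) - batchMean φ (s.1 i)) (b - a)
      ((2 * w₁ + 2 * w₂) / n) :=
  (((hψ.batchMean hn).comp (measurePreserving_batch_snd p n i)).sub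
    ((hφ.batchMean hn).comp (measurePreserving_batch_fst p n i))).mono (le_of_eq (by ring))

/-- Squared Lipschitz constant of the stochastic `∇_v φ_i`, on the ball of radius `V`. -/
noncomputable def Consts.KΦ (c : Consts) : ℝ :=
  2 * c.Lfy ^ 2 + 4 * c.V ^ 2 * c.Lgyy ^ 2 + 4 * c.Cgyy ^ 2 + 4 * c.Lg ^ 2

/-- Squared Lipschitz constant of the stochastic hypergradient blocks. -/
noncomputable def Consts.KB (c : Consts) : ℝ :=
  2 * c.Lfx ^ 2 + 4 * c.V ^ 2 * c.Lgxy ^ 2 + 4 * c.Lgy ^ 2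

theorem Consts.KΦ_nonneg (c : Consts) : 0 ≤ c.KΦ := by unfold Consts.KΦ; positivity

theorem Consts.KB_nonneg (c : Consts) : 0 ≤ c.KB := by unfold Consts.KB; positivity

namespace Problem.Assumptions

variable (hp : p.Assumptions c)
include hp

theorem meanVar_gradGHat {n : ℕ} (hn : 1 ≤ n) (i : Fin m) (x : E dx) (y : E (dy i)) :
    MeanVar (batchesLaw p n) (fun b => gradGHat p b i x y) (gradY (p.gbar i) x y)
      (c.σ ^ 2 / n) :=
  ((hp.var_gy i x y).meanVar.batchMean hn).comp (measurePreserving_batch_snd p n i)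

/-- Both terms see the same batch, so the variance is of the order of the squared move over $n$, in
place of $\sigma^2/n$. -/
theorem meanVar_gradGHat_sub {n : ℕ} (hn : 1 ≤ n) (i : Fin m) (x x' : E dx) (y y' : E (dy i)) :
    MeanVar (batchesLaw p n) (fun b => gradGHat p b i x y - gradGHat p b i x' y')
      (gradY (p.gbar i) x y - gradY (p.gbar i) x' y')
      (4 * (c.Lgy ^ 2 * (‖x - x'‖ ^ 2 + ‖y - y'‖ ^ 2)) / n) := by
  have h := (((hp.var_gy i x y).meanVar.sub_of_norm_le (hp.var_gy i x' y').meanVar fun ζ =>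
    (hp.lip_gy i ζ).norm_sub_sq_le x x' y y').batchMean hn).comp (measurePreserving_batch_snd p n i)
  simp_rw [batchMean_sub] at h
  exact h

theorem meanVar_gradPhiHat {n : ℕ} (hn : 1 ≤ n) (i : Fin m) (v : E (dy i)) (x : E dx)
    (y : E (dy i)) (hv : ‖v‖ ≤ c.V) :
    MeanVar (batchesLaw p n) (fun b => gradPhiHat p b i v x y) (p.gradPhi i v x y)
      (2 * c.σ ^ 2 * (1 + c.V ^ 2) / n) := by
  have h := meanVar_batch_sub' hn i (hp.var_fy i x y).meanVar
    ((hp.var_gyy i x y).meanVar.clm_apply v)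
  simp_rw [← batchMean_apply] at h
  refine h.mono ?_
  have h1 := pow_le_pow_left₀ (norm_nonneg _) hv 2
  gcongr
  nlinarith [sq_nonneg c.σ]

theorem norm_gradPhi_sub_sq_le (i : Fin m) (x x' : E dx) (y y' v v' : E (dy i))
    (hc : c.Valid) (hv : ‖v‖ ≤ c.V) :
    ‖p.gradPhi i v x y - p.gradPhi i v' x' y'‖ ^ 2
      ≤ 2 * c.KΦ * (‖x - x'‖ ^ 2 + ‖y - y'‖ ^ 2 + ‖v - v'‖ ^ 2) := by
  have e : p.gradPhi i v x y - p.gradPhi i v' x' y'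
      = (hessYY (p.gbar i) x y v - hessYY (p.gbar i) x' y' v')
        - (gradY (p.fbar i) x y - gradY (p.fbar i) x' y') := by
    simp only [Problem.gradPhi]
    abel
  rw [e]
  refine (norm_sub_sq_le_two _ _).trans ?_
  have h1 := (hp.lip_gradY_fbar i).norm_sub_sq_le x x' y y'
  have h2 := norm_apply_sub_sq_le (v' := v') ((hp.lip_hessYY_gbar i).norm_sub_sq_le x x' y y')
    (pow_le_pow_left₀ (norm_nonneg _) (hp.norm_hessYY_gbar_le hc i x' y') 2) hv
  unfold Consts.KΦ
  have h3 : 0 ≤ ‖x - x'‖ ^ 2 + ‖y - y'‖ ^ 2 := by positivity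
  have h4 : 0 ≤ ‖v - v'‖ ^ 2 := by positivity
  nlinarith [mul_nonneg (sq_nonneg c.Lg) h3, mul_nonneg (sq_nonneg c.Cgyy) h3,
    mul_nonneg (sq_nonneg c.Lfy) h3, mul_nonneg (sq_nonneg (c.V * c.Lgyy)) h3,
    mul_nonneg (sq_nonneg c.Lg) h4, mul_nonneg (sq_nonneg c.Cgyy) h4,
    mul_nonneg (sq_nonneg c.Lfy) h4, mul_nonneg (sq_nonneg (c.V * c.Lgyy)) h4]

/-- The uniform bound on the sample Hessians enters here: $v$ moves together with $(x,y)$, and the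
sample Hessian is applied to $v-v'$. -/
theorem meanVar_gradPhiHat_sub {n : ℕ} (hn : 1 ≤ n) (i : Fin m) (x x' : E dx)
    (y y' v v' : E (dy i)) (hv : ‖v‖ ≤ c.V) :
    MeanVar (batchesLaw p n) (fun b => gradPhiHat p b i v x y - gradPhiHat p b i v' x' y')
      (p.gradPhi i v x y - p.gradPhi i v' x' y')
      (8 * c.KΦ * (‖x - x'‖ ^ 2 + ‖y - y'‖ ^ 2 + ‖v - v'‖ ^ 2) / n) := by
  have h := meanVar_batch_sub' hn i
    ((hp.var_fy i x y).meanVar.sub_of_norm_le (hp.var_fy i x' y').meanVar fun ξ =>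
      (hp.lip_fy i ξ).norm_sub_sq_le x x' y y')
    (((hp.var_gyy i x y).meanVar.clm_apply v).sub_of_norm_le
      ((hp.var_gyy i x' y').meanVar.clm_apply v') fun ζ =>
      norm_apply_sub_sq_le ((hp.lip_gyy i ζ).norm_sub_sq_le x x' y y') (hp.bdd_gyy i ζ x' y') hv)
  have e : ∀ b : Batches m n Ξ Z, gradPhiHat p b i v x y - gradPhiHat p b i v' x' y'
      = batchMean (fun ζ => hessYY (p.g i ζ) x y v - hessYY (p.g i ζ) x' y' v') (b.2 i)
        - batchMean (fun ξ => gradY (p.f i ξ) x y - gradY (p.f i ξ) x' y') (b.1 i) := fun b => by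
    rw [batchMean_sub, batchMean_sub, gradPhiHat, gradPhiHat, batchMean_apply, batchMean_apply]
    abel
  have e' : p.gradPhi i v x y - p.gradPhi i v' x' y'
      = (hessYY (p.gbar i) x y v - hessYY (p.gbar i) x' y' v')
        - (gradY (p.fbar i) x y - gradY (p.fbar i) x' y') := by
    simp only [Problem.gradPhi]
    abel
  simp_rw [e]
  rw [e']
  refine h.mono ?_
  have h3 : 0 ≤ ‖x - x'‖ ^ 2 + ‖y - y'‖ ^ 2 := by positivity
  have h4 : 0 ≤ ‖v - v'‖ ^ 2 := by positivity
  gcongr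
  unfold Consts.KΦ
  nlinarith [mul_nonneg (sq_nonneg c.Lg) h3, mul_nonneg (sq_nonneg c.Cgyy) h3,
    mul_nonneg (sq_nonneg c.Lfy) h3, mul_nonneg (sq_nonneg (c.V * c.Lgyy)) h3,
    mul_nonneg (sq_nonneg c.Lg) h4, mul_nonneg (sq_nonneg c.Cgyy) h4,
    mul_nonneg (sq_nonneg c.Lfy) h4, mul_nonneg (sq_nonneg (c.V * c.Lgyy)) h4]

theorem meanVar_blockHat {n : ℕ} (hn : 1 ≤ n) (i : Fin m) (x : E dx) (y v : E (dy i))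
    (hv : ‖v‖ ≤ c.V) :
    MeanVar (batchesLaw p n) (fun b => blockHat p b i x y v) (p.block i x y v)
      (2 * c.σ ^ 2 * (1 + c.V ^ 2) / n) := by
  have h := meanVar_batch_sub hn i (hp.var_fx i x y).meanVar
    ((hp.var_gxy i x y).meanVar.clm_apply v)
  simp_rw [← batchMean_apply] at h
  refine h.mono ?_
  have h1 := pow_le_pow_left₀ (norm_nonneg _) hv 2
  gcongr
  nlinarith [sq_nonneg c.σ]

theorem norm_block_sub_sq_le (i : Fin m) (x x' : E dx) (y y' v v' : E (dy i))
    (hc : c.Valid) (hv : ‖v‖ ≤ c.V) :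
    ‖p.block i x y v - p.block i x' y' v'‖ ^ 2
      ≤ 2 * c.KB * (‖x - x'‖ ^ 2 + ‖y - y'‖ ^ 2 + ‖v - v'‖ ^ 2) := by
  have e : p.block i x y v - p.block i x' y' v'
      = (gradX (p.fbar i) x y - gradX (p.fbar i) x' y')
        - (hessXY (p.gbar i) x y v - hessXY (p.gbar i) x' y' v') := by
    simp only [Problem.block]
    abel
  rw [e]
  refine (norm_sub_sq_le_two _ _).trans ?_
  have h1 := (hp.lip_gradX_fbar i).norm_sub_sq_le x x' y y'
  have h2 := norm_apply_sub_sq_le (v' := v') ((hp.lip_hessXY_gbar i).norm_sub_sq_le x x' y y')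
    (pow_le_pow_left₀ (norm_nonneg _) (hp.norm_hessXY_gbar_le hc i x' y') 2) hv
  unfold Consts.KB
  have h3 : 0 ≤ ‖x - x'‖ ^ 2 + ‖y - y'‖ ^ 2 := by positivity
  have h4 : 0 ≤ ‖v - v'‖ ^ 2 := by positivity
  nlinarith [mul_nonneg (sq_nonneg c.Lgy) h3,
    mul_nonneg (sq_nonneg c.Lfx) h3, mul_nonneg (sq_nonneg (c.V * c.Lgxy)) h3,
    mul_nonneg (sq_nonneg c.Lgy) h4,
    mul_nonneg (sq_nonneg c.Lfx) h4, mul_nonneg (sq_nonneg (c.V * c.Lgxy)) h4]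

/-- The sample Jacobians are bounded by $L_{gy}$, as derivatives of $L_{gy}$-Lipschitz sample
gradients, so they need no separate uniform bound. -/
theorem meanVar_blockHat_sub (hc : c.Valid) {n : ℕ} (hn : 1 ≤ n) (i : Fin m) (x x' : E dx)
    (y y' v v' : E (dy i)) (hv : ‖v‖ ≤ c.V) :
    MeanVar (batchesLaw p n) (fun b => blockHat p b i x y v - blockHat p b i x' y' v')
      (p.block i x y v - p.block i x' y' v')
      (8 * c.KB * (‖x - x'‖ ^ 2 + ‖y - y'‖ ^ 2 + ‖v - v'‖ ^ 2) / n) := by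
  have h := meanVar_batch_sub hn i
    ((hp.var_fx i x y).meanVar.sub_of_norm_le (hp.var_fx i x' y').meanVar fun ξ =>
      (hp.lip_fx i ξ).norm_sub_sq_le x x' y y')
    (((hp.var_gxy i x y).meanVar.clm_apply v).sub_of_norm_le
      ((hp.var_gxy i x' y').meanVar.clm_apply v') fun ζ =>
      norm_apply_sub_sq_le ((hp.lip_gxy i ζ).norm_sub_sq_le x x' y y')
        (pow_le_pow_left₀ (norm_nonneg _)
          (norm_hessXY_le hc.Lgy_nonneg (hp.lip_gy i ζ) x' y') 2) hv)
  have e : ∀ b : Batches m n Ξ Z, blockHat p b i x y v - blockHat p b i x' y' v'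
      = batchMean (fun ξ => gradX (p.f i ξ) x y - gradX (p.f i ξ) x' y') (b.1 i)
        - batchMean (fun ζ => hessXY (p.g i ζ) x y v - hessXY (p.g i ζ) x' y' v') (b.2 i) :=
    fun b => by
      rw [batchMean_sub, batchMean_sub, blockHat, blockHat, batchMean_apply, batchMean_apply]
      abel
  have e' : p.block i x y v - p.block i x' y' v'
      = (gradX (p.fbar i) x y - gradX (p.fbar i) x' y')
        - (hessXY (p.gbar i) x y v - hessXY (p.gbar i) x' y' v') := by
    simp only [Problem.block]
    abel
  simp_rw [e]
  rw [e']
  refine h.mono ?_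
  have h3 : 0 ≤ ‖x - x'‖ ^ 2 + ‖y - y'‖ ^ 2 := by positivity
  have h4 : 0 ≤ ‖v - v'‖ ^ 2 := by positivity
  gcongr
  unfold Consts.KB
  nlinarith [mul_nonneg (sq_nonneg c.Lgy) h3,
    mul_nonneg (sq_nonneg c.Lfx) h3, mul_nonneg (sq_nonneg (c.V * c.Lgxy)) h3,
    mul_nonneg (sq_nonneg c.Lgy) h4,
    mul_nonneg (sq_nonneg c.Lfx) h4, mul_nonneg (sq_nonneg (c.V * c.Lgxy)) h4]

end Problem.Assumptions

end BSVRB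

namespace BSVRB

variable {m dx : ℕ} {dy : Fin m → ℕ} {Ξ Z : Type*} [MeasurableSpace Ξ] [MeasurableSpace Z]
  {p : Problem m dx dy Ξ Z} {c : Consts}

/-! ### Second moments of the estimators after one iteration -/

/-- `𝕀(I < m)`. -/
noncomputable def selInd (m I : ℕ) : ℝ := if I < m then 1 else 0

theorem selInd_nonneg (m I : ℕ) : 0 ≤ selInd m I := by
  unfold selInd
  split_ifs <;> norm_num

/-- The coefficients in the error recursion of the block-wise variance-reduced estimator. -/
theorem msvr_coefficients {m I : ℕ} {α : ℝ} (hI : 1 ≤ I) (hIm : I ≤ m) (hα0 : 0 ≤ α)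
    (hα : α ≤ 1 / 2) (X Y W V₁ V₂ : ℝ) (hX : 0 ≤ X) (hY : 0 ≤ Y) (hV₂ : 0 ≤ V₂) :
    (I : ℝ) / m * (((1 - α) ^ 2 * X + 2 * ((1 - α) * (((m : ℝ) - I) / (I * (1 - α)))) * W
        + (((m : ℝ) - I) / (I * (1 - α))) ^ 2 * Y)
        + (2 * α ^ 2 * V₁ + 2 * gam m I α ^ 2 * V₂))
      + (1 - (I : ℝ) / m) * (X - 2 * W + Y)
    ≤ (1 - (I : ℝ) / m * α) * X + 2 * ((I : ℝ) / m * α ^ 2 * V₁)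
      + 8 * ((m : ℝ) / I * V₂) + 4 * ((m : ℝ) / I * selInd m I * Y) := by
  have hI' : (0 : ℝ) < I := by exact_mod_cast hI
  have hm' : (0 : ℝ) < m := by exact_mod_cast hI.trans hIm
  have hIm' : (I : ℝ) ≤ m := by exact_mod_cast hIm
  have h1α : 0 < 1 - α := by linarith
  set k := ((m : ℝ) - I) / (I * (1 - α)) with hk
  have hk1 : (1 - α) * k = ((m : ℝ) - I) / I := by
    rw [hk]
    field_simp
  have hk0 : 0 ≤ k := div_nonneg (by linarith) (by positivity)
  have hk2 : k ≤ 2 * (((m : ℝ) - I) / I) := by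
    rw [← hk1]
    nlinarith
  have hmI : ((m : ℝ) - I) / I = m / I - 1 := by field_simp
  have hγ : gam m I α ≤ 2 * (m / I) := by
    unfold gam
    rw [← hk]
    have : (1 : ℝ) ≤ m / I := (one_le_div hI').2 hIm'
    linarith
  have hγ0 : 0 ≤ gam m I α := by
    unfold gam
    rw [← hk]
    linarith
  have e1 : (I : ℝ) / m * (m / I) = 1 := by field_simp
  set a := (I : ℝ) / m with ha
  have ha0 : 0 < a := by positivity
  have ha1 : a ≤ 1 := (div_le_one hm').2 hIm'
  set b := (m : ℝ) / I with hb
  have hb0 : 0 < b := by positivity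
  -- The point of $\gamma$: selected blocks contribute the cross term $2(1-a)W$, which cancels the
  -- $-2(1-a)W$ of the unselected blocks.
  have hc1 : a * (2 * ((1 - α) * k) * W) = 2 * (1 - a) * W := by
    rw [hk1, hmI]
    linear_combination 2 * W * e1
  have hc2 : a * ((1 - α) ^ 2 * X) + (1 - a) * X ≤ (1 - a * α) * X := by
    have : 0 ≤ a * X * (α * (1 - α)) := by positivity
    nlinarith
  have hc3 : a * (2 * gam m I α ^ 2 * V₂) ≤ 8 * (b * V₂) := by
    have h1 : gam m I α ^ 2 ≤ (2 * b) ^ 2 := pow_le_pow_left₀ hγ0 hγ 2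
    have h2 : a * (2 * gam m I α ^ 2 * V₂) ≤ a * (2 * (2 * b) ^ 2 * V₂) := by gcongr
    have h3 : a * (2 * (2 * b) ^ 2 * V₂) = 8 * (a * b) * (b * V₂) := by ring
    rw [h3, e1] at h2
    linarith
  -- If $I=m$ then $k=0$ and $a=1$, so this contribution disappears; hence the indicator of $I<m$.
  have hc4 : a * (k ^ 2 * Y) + (1 - a) * Y ≤ 4 * (b * selInd m I * Y) := by
    unfold selInd
    split_ifs with hlt
    · have h1 : k ^ 2 ≤ (2 * (b - 1)) ^ 2 := pow_le_pow_left₀ hk0 (by rw [← hmI]; exact hk2) 2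
      have h2 : a * (k ^ 2 * Y) ≤ a * ((2 * (b - 1)) ^ 2 * Y) := by gcongr
      have h3 : a * (2 * (b - 1)) ^ 2 = 4 * (b - 2 + a) := by
        linear_combination (4 * b - 8) * e1
      have h4 : a * ((2 * (b - 1)) ^ 2 * Y) = 4 * (b - 2 + a) * Y := by
        rw [← h3]; ring
      have h5 : (1 - a) * Y + 4 * (b - 2 + a) * Y ≤ 4 * (b * 1 * Y) := by
        nlinarith
      linarith
    · have h1 : I = m := by omega
      have h2 : a = 1 := by rw [ha, h1, div_self hm'.ne']
      have h3 : k = 0 := by rw [hk, h1, sub_self, zero_div]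
      rw [h2, h3]
      simp
  nlinarith

/-- Error recursion of the block-wise variance-reduced estimator. -/
theorem msvr_step {I B d : ℕ} (hI : 1 ≤ I) (hIm : I ≤ m) {i : Fin m} {α : ℝ} (hα0 : 0 ≤ α)
    (hα : α ≤ 1 / 2) {X D : Batches m B Ξ Z → E d} {s g₀ g₁ : E d} {w₁ w₂ : ℝ}
    (hX : MeanVar (batchesLaw p B) X g₁ w₁) (hD : MeanVar (batchesLaw p B) D (g₁ - g₀) w₂) :
    Integrable (fun w : IterSample m B Ξ Z => ‖(if i ∈ w.1 then (1 - α) • s + α • X w.2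
        + gam m I α • D w.2 else s) - g₁‖ ^ 2) (iterLaw p I B) ∧
    ∫ w, ‖(if i ∈ w.1 then (1 - α) • s + α • X w.2 + gam m I α • D w.2 else s) - g₁‖ ^ 2
        ∂(iterLaw p I B)
      ≤ (1 - (I : ℝ) / m * α) * ‖s - g₀‖ ^ 2 + 2 * ((I : ℝ) / m * α ^ 2 * w₁)
        + 8 * ((m : ℝ) / I * w₂) + 4 * ((m : ℝ) / I * selInd m I * ‖g₁ - g₀‖ ^ 2) := by
  have h1α : (1 - α) ≠ 0 := by linarith
  have hXD := hX.smul_add_smul hD α (gam m I α)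
  have e : ∀ b : Batches m B Ξ Z, (1 - α) • s + α • X b + gam m I α • D b - g₁
      = (α • X b + gam m I α • D b) - (g₁ - (1 - α) • s) := fun b => by abel
  have hint : ∀ A : Finset (Fin m), #A = I → Integrable (fun b : Batches m B Ξ Z =>
      ‖(if i ∈ A then (1 - α) • s + α • X b + gam m I α • D b else s) - g₁‖ ^ 2)
      (batchesLaw p B) := fun A _ => by
    split_ifs
    · simp_rw [e]
      exact hXD.integrable_norm_sq _
    · exact integrable_const _
  refine ⟨integrable_iterLaw hIm hint, ?_⟩
  rw [integral_iterLaw hIm hint]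
  set k := ((m : ℝ) - I) / (I * (1 - α)) with hk
  have hle : ∀ A : Finset (Fin m), #A = I →
      ∫ b, ‖(if i ∈ A then (1 - α) • s + α • X b + gam m I α • D b else s) - g₁‖ ^ 2
        ∂(batchesLaw p B)
      ≤ if i ∈ A then ‖(1 - α) • (s - g₀) + k • (g₁ - g₀)‖ ^ 2
          + (2 * α ^ 2 * w₁ + 2 * gam m I α ^ 2 * w₂)
        else ‖(s - g₀) - (g₁ - g₀)‖ ^ 2 := fun A _ => by
    split_ifs
    · simp_rw [e]
      refine (hXD.integral_norm_sub_sq_le _).trans (le_of_eq ?_)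
      -- Subtracting $\gamma=k+(1-\alpha)$ against the drift of the target leaves the mean error
      -- $(1-\alpha)(s-g_0)+k(g_1-g_0)$.
      congr 3
      rw [gam, ← hk]
      simp only [smul_sub, sub_smul, add_smul, one_smul]
      abel
    · rw [integral_const, sub_sub_sub_cancel_right]
      simp
  refine (blockAvg_mono hle).trans ?_
  rw [blockAvg_ite hI hIm, norm_sub_sq_real, norm_add_sq_real, norm_smul, norm_smul, mul_pow,
    mul_pow, Real.norm_eq_abs, Real.norm_eq_abs, sq_abs, sq_abs, inner_smul_left, inner_smul_right]
  simp only [conj_trivial]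
  have := msvr_coefficients (m := m) (I := I) hI hIm hα0 hα (‖s - g₀‖ ^ 2) (‖g₁ - g₀‖ ^ 2)
    (inner ℝ (s - g₀) (g₁ - g₀)) w₁ w₂ (by positivity) (by positivity) hD.nonneg
  rw [← hk] at this
  refine le_trans (le_of_eq ?_) this
  ring

/-- Error recursion of the variance-reduced estimator with sampled blocks. -/
theorem storm_step {I B d : ℕ} (hI : 1 ≤ I) (hIm : I ≤ m) {β : ℝ} (hβ0 : 0 ≤ β) (hβ : β ≤ 1)
    {X₁ X₀ : Fin m → Batches m B Ξ Z → E d} {x₁ x₀ : Fin m → E d} {w₁ C D : ℝ} {w₂ : Fin m → ℝ}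
    {l : Fin m → ℝ} {z : E d}
    (hX₁ : ∀ i, MeanVar (batchesLaw p B) (X₁ i) (x₁ i) w₁)
    (hD : ∀ i, MeanVar (batchesLaw p B) (fun b => X₁ i b - X₀ i b) (x₁ i - x₀ i) (w₂ i))
    (hC : ∀ i, ‖x₁ i‖ ^ 2 ≤ C) (hl : ∀ i, ‖x₁ i - x₀ i‖ ^ 2 ≤ D * l i) :
    Integrable (fun w : IterSample m B Ξ Z => ‖((1 - β) • (z - (#w.1 : ℝ)⁻¹ • ∑ i ∈ w.1, X₀ i w.2)
        + (#w.1 : ℝ)⁻¹ • ∑ i ∈ w.1, X₁ i w.2) - (m : ℝ)⁻¹ • ∑ i, x₁ i‖ ^ 2) (iterLaw p I B) ∧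
    ∫ w, ‖((1 - β) • (z - (#w.1 : ℝ)⁻¹ • ∑ i ∈ w.1, X₀ i w.2)
        + (#w.1 : ℝ)⁻¹ • ∑ i ∈ w.1, X₁ i w.2) - (m : ℝ)⁻¹ • ∑ i, x₁ i‖ ^ 2 ∂(iterLaw p I B)
      ≤ (1 - β) * ‖z - (m : ℝ)⁻¹ • ∑ i, x₀ i‖ ^ 2
        + (2 * β ^ 2 * w₁ + 2 * ((m : ℝ)⁻¹ * ∑ i, w₂ i))
        + (if I < m then 1 / (I : ℝ) else 0)
          * (2 * β ^ 2 * C + 2 * (D * ((m : ℝ)⁻¹ * ∑ i, l i))) := by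
  have hm' : (0 : ℝ) < m := by exact_mod_cast hI.trans hIm
  have hI' : (0 : ℝ) < I := by exact_mod_cast hI
  have hY := fun i => (hX₁ i).smul_add_smul (hD i) β (1 - β)
  -- Up to a term that does not depend on the sample, the update averages $\beta
  -- X_1+(1-\beta)(X_1-X_0)$ over the selected blocks, and `x i` is the mean of this for block `i`.
  -- The first part carries a factor $\beta^2$ in the second moment, the second part is controlled
  -- by the squared move.
  set x : Fin m → E d := fun i => β • x₁ i + (1 - β) • (x₁ i - x₀ i) with hx
  set y : E d := (m : ℝ)⁻¹ • ∑ i, x₁ i - (1 - β) • z with hy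
  set w : Fin m → ℝ := fun i => 2 * β ^ 2 * w₁ + 2 * (1 - β) ^ 2 * w₂ i with hw
  have hA := fun A : Finset (Fin m) => MeanVar.average A hY
  have e0 : ∀ u v : E d, β • u + (1 - β) • (u - v) = u - (1 - β) • v := fun u v => by
    simp only [smul_sub, sub_smul, one_smul]
    abel
  have e : ∀ (A : Finset (Fin m)) (b : Batches m B Ξ Z),
      ((1 - β) • (z - (#A : ℝ)⁻¹ • ∑ i ∈ A, X₀ i b)
        + (#A : ℝ)⁻¹ • ∑ i ∈ A, X₁ i b) - (m : ℝ)⁻¹ • ∑ i, x₁ i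
      = (#A : ℝ)⁻¹ • ∑ i ∈ A, (β • X₁ i b + (1 - β) • (X₁ i b - X₀ i b)) - y := fun A b => by
    simp_rw [e0]
    rw [sum_sub_distrib, ← smul_sum, smul_sub, smul_sub, smul_comm (#A : ℝ)⁻¹ (1 - β), hy]
    abel
  have hint : ∀ A : Finset (Fin m), #A = I → Integrable (fun b : Batches m B Ξ Z =>
      ‖((1 - β) • (z - (#A : ℝ)⁻¹ • ∑ i ∈ A, X₀ i b)
        + (#A : ℝ)⁻¹ • ∑ i ∈ A, X₁ i b) - (m : ℝ)⁻¹ • ∑ i, x₁ i‖ ^ 2) (batchesLaw p B) :=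
    fun A _ => by
      simp_rw [e]
      exact (hA A).integrable_norm_sq y
  refine ⟨integrable_iterLaw hIm hint, ?_⟩
  rw [integral_iterLaw hIm hint]
  have hle : ∀ A : Finset (Fin m), #A = I →
      ∫ b, ‖((1 - β) • (z - (#A : ℝ)⁻¹ • ∑ i ∈ A, X₀ i b)
        + (#A : ℝ)⁻¹ • ∑ i ∈ A, X₁ i b) - (m : ℝ)⁻¹ • ∑ i, x₁ i‖ ^ 2 ∂(batchesLaw p B)
      ≤ ‖(#A : ℝ)⁻¹ • ∑ i ∈ A, x i - y‖ ^ 2 + (I : ℝ)⁻¹ * ∑ i ∈ A, w i := fun A hAI => by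
    simp_rw [e]
    refine ((hA A).integral_norm_sub_sq_le y).trans (le_of_eq ?_)
    rw [hAI]
  refine (blockAvg_mono hle).trans ?_
  rw [blockAvg_add, blockAvg_const_mul, blockAvg_sum_mem hI hIm]
  have h1 := blockAvg_norm_average_sub_sq_le hI hIm x y
  have e1 : (m : ℝ)⁻¹ • ∑ i, x i - y = (1 - β) • (z - (m : ℝ)⁻¹ • ∑ i, x₀ i) := by
    simp_rw [hx, e0]
    rw [sum_sub_distrib, ← smul_sum, smul_sub, smul_comm (m : ℝ)⁻¹ (1 - β), hy, smul_sub]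
    abel
  rw [e1, norm_smul, mul_pow, Real.norm_eq_abs, sq_abs] at h1
  have hβ2 : (1 - β) ^ 2 ≤ 1 := by nlinarith
  have h2 : (1 - β) ^ 2 * ‖z - (m : ℝ)⁻¹ • ∑ i, x₀ i‖ ^ 2
      ≤ (1 - β) * ‖z - (m : ℝ)⁻¹ • ∑ i, x₀ i‖ ^ 2 := by
    gcongr
    nlinarith
  have h3 : ∑ i, w i ≤ m * (2 * β ^ 2 * w₁) + 2 * ∑ i, w₂ i := by
    have : ∑ i, w i ≤ ∑ i, (2 * β ^ 2 * w₁ + 2 * w₂ i) := by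
      refine sum_le_sum fun i _ => ?_
      have := (hD i).nonneg
      simp only [hw]
      nlinarith
    refine this.trans (le_of_eq ?_)
    rw [sum_add_distrib, sum_const, card_univ, Fintype.card_fin, nsmul_eq_mul, ← mul_sum]
  have h4 : ∑ i, ‖x i‖ ^ 2 ≤ m * (2 * β ^ 2 * C) + 2 * (D * ∑ i, l i) := by
    have : ∑ i, ‖x i‖ ^ 2 ≤ ∑ i, (2 * β ^ 2 * C + 2 * (D * l i)) := by
      refine sum_le_sum fun i _ => ?_
      simp only [hx]
      refine (norm_add_sq_le_two _ _).trans ?_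
      rw [norm_smul, norm_smul, mul_pow, mul_pow, Real.norm_eq_abs, Real.norm_eq_abs, sq_abs,
        sq_abs]
      have h5 := mul_le_mul_of_nonneg_left (hC i) (sq_nonneg β)
      have h6 : (1 - β) ^ 2 * ‖x₁ i - x₀ i‖ ^ 2 ≤ 1 * ‖x₁ i - x₀ i‖ ^ 2 := by gcongr
      have h7 := hl i
      linarith
    refine this.trans (le_of_eq ?_)
    rw [sum_add_distrib, sum_const, card_univ, Fintype.card_fin, nsmul_eq_mul, ← mul_sum,
      ← mul_sum]
  have h5 : (I : ℝ)⁻¹ * ((I : ℝ) / m * ∑ i, w i)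
      ≤ 2 * β ^ 2 * w₁ + 2 * ((m : ℝ)⁻¹ * ∑ i, w₂ i) := by
    have : (I : ℝ)⁻¹ * ((I : ℝ) / m * ∑ i, w i) = (m : ℝ)⁻¹ * ∑ i, w i := by field_simp
    rw [this]
    refine (mul_le_mul_of_nonneg_left h3 (by positivity)).trans (le_of_eq ?_)
    field_simp
  have h6 : (if I < m then 1 / (I : ℝ) else 0) * ((m : ℝ)⁻¹ * ∑ i, ‖x i‖ ^ 2)
      ≤ (if I < m then 1 / (I : ℝ) else 0)
        * (2 * β ^ 2 * C + 2 * (D * ((m : ℝ)⁻¹ * ∑ i, l i))) := by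
    refine mul_le_mul_of_nonneg_left ?_ (by split_ifs <;> positivity)
    refine (mul_le_mul_of_nonneg_left h4 (by positivity)).trans (le_of_eq ?_)
    field_simp
  linarith

/-! ### Error functionals of a state -/

section Errors

variable (p) (q : State m dx dy)

/-- Mean squared error of the estimators `s_i`. -/
noncomputable def Problem.errS : ℝ :=
  (m : ℝ)⁻¹ * ∑ i, ‖q.s i - gradY (p.gbar i) q.xPrev (q.yPrev i)‖ ^ 2

/-- Mean squared error of the estimators `u_i`. -/
noncomputable def Problem.errU : ℝ :=
  (m : ℝ)⁻¹ * ∑ i, ‖q.u i - p.gradPhi i (q.vPrev i) q.xPrev (q.yPrev i)‖ ^ 2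

/-- Squared error of the estimator `z`. -/
noncomputable def Problem.errZ : ℝ := ‖q.z - p.hyperGrad q.xPrev q.yPrev q.vPrev‖ ^ 2

/-- Mean squared distance of `y_i` to the lower-level solutions. -/
noncomputable def Problem.errY : ℝ := (m : ℝ)⁻¹ * ∑ i, ‖q.y i - p.ySol i q.x‖ ^ 2

/-- Mean squared distance of `v_i` to the Hessian-inverse-vector products. -/
noncomputable def Problem.errV : ℝ := (m : ℝ)⁻¹ * ∑ i, ‖q.v i - p.vSol i q.x‖ ^ 2

/-- Squared length of the last move in block `i`. -/
noncomputable def State.moveSq (i : Fin m) : ℝ :=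
  ‖q.x - q.xPrev‖ ^ 2 + ‖q.y i - q.yPrev i‖ ^ 2 + ‖q.v i - q.vPrev i‖ ^ 2

/-- Mean squared length of the last move. -/
noncomputable def State.lag : ℝ := (m : ℝ)⁻¹ * ∑ i, q.moveSq i

theorem State.moveSq_nonneg (i : Fin m) : 0 ≤ q.moveSq i := by unfold State.moveSq; positivity

theorem State.lag_nonneg : 0 ≤ q.lag :=
  mul_nonneg (by positivity) (sum_nonneg fun i _ => q.moveSq_nonneg i)

theorem Problem.errS_nonneg : 0 ≤ p.errS q := by unfold Problem.errS; positivity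
theorem Problem.errU_nonneg : 0 ≤ p.errU q := by unfold Problem.errU; positivity
theorem Problem.errZ_nonneg : 0 ≤ p.errZ q := by unfold Problem.errZ; positivity
theorem Problem.errY_nonneg : 0 ≤ p.errY q := by unfold Problem.errY; positivity
theorem Problem.errV_nonneg : 0 ≤ p.errV q := by unfold Problem.errV; positivity

end Errors

/-- Averaging block-wise bounds. -/
theorem average_block_le (hm : 1 ≤ m) {k₀ k₁ k₂ k₃ k₄ : ℝ} {a b₁ b₂ b₃ b₄ : Fin m → ℝ}
    (h : ∀ i, a i ≤ k₀ + k₁ * b₁ i + k₂ * b₂ i + k₃ * b₃ i + k₄ * b₄ i) :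
    (m : ℝ)⁻¹ * ∑ i, a i ≤ k₀ + k₁ * ((m : ℝ)⁻¹ * ∑ i, b₁ i) + k₂ * ((m : ℝ)⁻¹ * ∑ i, b₂ i)
      + k₃ * ((m : ℝ)⁻¹ * ∑ i, b₃ i) + k₄ * ((m : ℝ)⁻¹ * ∑ i, b₄ i) := by
  have hm' : (0 : ℝ) < m := by exact_mod_cast hm
  refine (mul_le_mul_of_nonneg_left (sum_le_sum fun i _ => h i) (by positivity)).trans
    (le_of_eq ?_)
  simp only [sum_add_distrib, ← mul_sum, sum_const, card_univ, Fintype.card_fin, nsmul_eq_mul]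
  field_simp

/-- Constant in the error recursion of `s`. -/
noncomputable def Consts.KS (c : Consts) : ℝ := 2 * c.σ ^ 2 + 32 * c.Lgy ^ 2

/-- Constant in the error recursion of `u`. -/
noncomputable def Consts.KU (c : Consts) : ℝ := 4 * c.σ ^ 2 * (1 + c.V ^ 2) + 64 * c.KΦ

/-- Constant in the error recursion of `z`. -/
noncomputable def Consts.KZ (c : Consts) : ℝ :=
  4 * c.σ ^ 2 * (1 + c.V ^ 2) + 2 * (c.Cfx + c.Lgy * c.V) ^ 2 + 16 * c.KB

theorem rho_eq (m I B : ℕ) : rho m I B = (if I < m then 1 / (I : ℝ) else 0) + 1 / B := rfl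

namespace Problem.Assumptions

variable (hp : p.Assumptions c) {I B : ℕ} {V τ : ℝ} {h : Steps} {t : ℕ} {q : State m dx dy}
include hp

/-- The new `s` aims at the gradient at the current point of `q`, which is the previous point of the
new state, so `msvr_step` applies block by block. The move enters through the batch variance, with
factor $1/B$, and through the unselected blocks, with factor $\mathbb I(I<m)$. -/
theorem errS_step (hI : 1 ≤ I) (hIm : I ≤ m) (hB : 1 ≤ B) (hα0 : 0 ≤ h.α t) (hα : h.α t ≤ 1 / 2) :
    Integrable (fun w : IterSample m B Ξ Z => p.errS (step p I V τ h t w q)) (iterLaw p I B) ∧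
    ∫ w, p.errS (step p I V τ h t w q) ∂(iterLaw p I B)
      ≤ (1 - (I : ℝ) / m * h.α t) * p.errS q + c.KS * ((I : ℝ) / m * h.α t ^ 2 / B)
        + c.KS * ((m : ℝ) / I * (selInd m I + 1 / B) * q.lag) := by
  have hB' : (0 : ℝ) < B := by exact_mod_cast hB
  have hi := fun i => msvr_step hI hIm (i := i) (s := q.s i) hα0 hα
    (hp.meanVar_gradGHat hB i q.x (q.y i))
    (hp.meanVar_gradGHat_sub hB i q.x q.xPrev (q.y i) (q.yPrev i))
  have hint := integrable_finsetSum univ fun i _ => (hi i).1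
  refine ⟨hint.const_mul _, ?_⟩
  have e : ∫ w, p.errS (step p I V τ h t w q) ∂(iterLaw p I B)
      = (m : ℝ)⁻¹ * ∑ i, ∫ w : IterSample m B Ξ Z, ‖(if i ∈ w.1 then (1 - h.α t) • q.s i
          + h.α t • gradGHat p w.2 i q.x (q.y i) + gam m I (h.α t) •
            (gradGHat p w.2 i q.x (q.y i) - gradGHat p w.2 i q.xPrev (q.yPrev i)) else q.s i)
          - gradY (p.gbar i) q.x (q.y i)‖ ^ 2 ∂(iterLaw p I B) := by
    rw [← integral_finsetSum univ fun i _ => (hi i).1, ← integral_const_mul]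
    rfl
  rw [e]
  have hle : ∀ i, ∫ w : IterSample m B Ξ Z, ‖(if i ∈ w.1 then (1 - h.α t) • q.s i
          + h.α t • gradGHat p w.2 i q.x (q.y i) + gam m I (h.α t) •
            (gradGHat p w.2 i q.x (q.y i) - gradGHat p w.2 i q.xPrev (q.yPrev i)) else q.s i)
          - gradY (p.gbar i) q.x (q.y i)‖ ^ 2 ∂(iterLaw p I B)
      ≤ c.KS * ((I : ℝ) / m * h.α t ^ 2 / B)
        + (1 - (I : ℝ) / m * h.α t) * ‖q.s i - gradY (p.gbar i) q.xPrev (q.yPrev i)‖ ^ 2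
        + c.KS * ((m : ℝ) / I * (selInd m I + 1 / B)) * q.moveSq i + 0 * 0 + 0 * 0 := fun i => by
    refine (hi i).2.trans ?_
    have h1 := (hp.lip_gradY_gbar i).norm_sub_sq_le q.x q.xPrev (q.y i) (q.yPrev i)
    have h2 : ‖q.x - q.xPrev‖ ^ 2 + ‖q.y i - q.yPrev i‖ ^ 2 ≤ q.moveSq i := by
      unfold State.moveSq
      linarith [sq_nonneg ‖q.v i - q.vPrev i‖]
    have h3 : c.Lgy ^ 2 * (‖q.x - q.xPrev‖ ^ 2 + ‖q.y i - q.yPrev i‖ ^ 2)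
        ≤ c.Lgy ^ 2 * q.moveSq i := by gcongr
    have h4 := h1.trans h3
    have hs := selInd_nonneg m I
    have hq := q.moveSq_nonneg i
    have h5 : 8 * ((m : ℝ) / I * (4 * (c.Lgy ^ 2 * (‖q.x - q.xPrev‖ ^ 2
        + ‖q.y i - q.yPrev i‖ ^ 2)) / B)) ≤ 8 * ((m : ℝ) / I * (4 * (c.Lgy ^ 2 * q.moveSq i) / B)) := by
      gcongr
    have h6 : 4 * ((m : ℝ) / I * selInd m I * ‖gradY (p.gbar i) q.x (q.y i)
        - gradY (p.gbar i) q.xPrev (q.yPrev i)‖ ^ 2)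
        ≤ 4 * ((m : ℝ) / I * selInd m I * (c.Lgy ^ 2 * q.moveSq i)) := by gcongr
    have h7 : 2 * ((I : ℝ) / m * h.α t ^ 2 * (c.σ ^ 2 / B))
        ≤ c.KS * ((I : ℝ) / m * h.α t ^ 2 / B) := by
      have : 2 * ((I : ℝ) / m * h.α t ^ 2 * (c.σ ^ 2 / B))
        = 2 * c.σ ^ 2 * ((I : ℝ) / m * h.α t ^ 2 / B) := by ring
      rw [this]
      gcongr
      unfold Consts.KS
      linarith [sq_nonneg c.Lgy]
    have h8 : 8 * ((m : ℝ) / I * (4 * (c.Lgy ^ 2 * q.moveSq i) / B))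
        + 4 * ((m : ℝ) / I * selInd m I * (c.Lgy ^ 2 * q.moveSq i))
        ≤ c.KS * ((m : ℝ) / I * (selInd m I + 1 / B)) * q.moveSq i := by
      have e1 : c.KS * ((m : ℝ) / I * (selInd m I + 1 / B)) * q.moveSq i
          = 8 * ((m : ℝ) / I * (4 * (c.Lgy ^ 2 * q.moveSq i) / B))
          + 4 * ((m : ℝ) / I * selInd m I * (c.Lgy ^ 2 * q.moveSq i))
          + (28 * c.Lgy ^ 2 * ((m : ℝ) / I * selInd m I * q.moveSq i)
            + 2 * c.σ ^ 2 * ((m : ℝ) / I * (selInd m I + 1 / B) * q.moveSq i)) := by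
        unfold Consts.KS
        ring
      rw [e1]
      have : 0 ≤ 28 * c.Lgy ^ 2 * ((m : ℝ) / I * selInd m I * q.moveSq i)
            + 2 * c.σ ^ 2 * ((m : ℝ) / I * (selInd m I + 1 / B) * q.moveSq i) := by positivity
      linarith
    linarith
  refine (average_block_le (hI.trans hIm) (b₃ := fun _ => 0) (b₄ := fun _ => 0) hle).trans
    (le_of_eq ?_)
  simp only [Problem.errS, State.lag]
  ring

theorem errU_step (hc : c.Valid) (hI : 1 ≤ I) (hIm : I ≤ m) (hB : 1 ≤ B) (hα0 : 0 ≤ h.α' t)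
    (hα : h.α' t ≤ 1 / 2) (hv : ∀ i, ‖q.v i‖ ≤ c.V) :
    Integrable (fun w : IterSample m B Ξ Z => p.errU (step p I V τ h t w q)) (iterLaw p I B) ∧
    ∫ w, p.errU (step p I V τ h t w q) ∂(iterLaw p I B)
      ≤ (1 - (I : ℝ) / m * h.α' t) * p.errU q + c.KU * ((I : ℝ) / m * h.α' t ^ 2 / B)
        + c.KU * ((m : ℝ) / I * (selInd m I + 1 / B) * q.lag) := by
  have hB' : (0 : ℝ) < B := by exact_mod_cast hB
  have hi := fun i => msvr_step hI hIm (i := i) (s := q.u i) hα0 hα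
    (hp.meanVar_gradPhiHat hB i (q.v i) q.x (q.y i) (hv i))
    (hp.meanVar_gradPhiHat_sub hB i q.x q.xPrev (q.y i) (q.yPrev i) (q.v i) (q.vPrev i) (hv i))
  have hint := integrable_finsetSum univ fun i _ => (hi i).1
  refine ⟨hint.const_mul _, ?_⟩
  have e : ∫ w, p.errU (step p I V τ h t w q) ∂(iterLaw p I B)
      = (m : ℝ)⁻¹ * ∑ i, ∫ w : IterSample m B Ξ Z, ‖(if i ∈ w.1 then (1 - h.α' t) • q.u i
          + h.α' t • gradPhiHat p w.2 i (q.v i) q.x (q.y i) + gam m I (h.α' t) •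
            (gradPhiHat p w.2 i (q.v i) q.x (q.y i)
              - gradPhiHat p w.2 i (q.vPrev i) q.xPrev (q.yPrev i)) else q.u i)
          - p.gradPhi i (q.v i) q.x (q.y i)‖ ^ 2 ∂(iterLaw p I B) := by
    rw [← integral_finsetSum univ fun i _ => (hi i).1, ← integral_const_mul]
    rfl
  rw [e]
  have hK := c.KΦ_nonneg
  have hle : ∀ i, ∫ w : IterSample m B Ξ Z, ‖(if i ∈ w.1 then (1 - h.α' t) • q.u i
          + h.α' t • gradPhiHat p w.2 i (q.v i) q.x (q.y i) + gam m I (h.α' t) •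
            (gradPhiHat p w.2 i (q.v i) q.x (q.y i)
              - gradPhiHat p w.2 i (q.vPrev i) q.xPrev (q.yPrev i)) else q.u i)
          - p.gradPhi i (q.v i) q.x (q.y i)‖ ^ 2 ∂(iterLaw p I B)
      ≤ c.KU * ((I : ℝ) / m * h.α' t ^ 2 / B)
        + (1 - (I : ℝ) / m * h.α' t) * ‖q.u i - p.gradPhi i (q.vPrev i) q.xPrev (q.yPrev i)‖ ^ 2
        + c.KU * ((m : ℝ) / I * (selInd m I + 1 / B)) * q.moveSq i + 0 * 0 + 0 * 0 := fun i => by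
    refine (hi i).2.trans ?_
    have h4 := hp.norm_gradPhi_sub_sq_le i q.x q.xPrev (q.y i) (q.yPrev i) (q.v i) (q.vPrev i) hc
      (hv i)
    change _ ≤ 2 * c.KΦ * q.moveSq i at h4
    have hs := selInd_nonneg m I
    have hq := q.moveSq_nonneg i
    change _ + _ + 8 * ((m : ℝ) / I * (8 * c.KΦ * q.moveSq i / B)) + _ ≤ _
    have h6 : 4 * ((m : ℝ) / I * selInd m I * ‖p.gradPhi i (q.v i) q.x (q.y i)
        - p.gradPhi i (q.vPrev i) q.xPrev (q.yPrev i)‖ ^ 2)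
        ≤ 4 * ((m : ℝ) / I * selInd m I * (2 * c.KΦ * q.moveSq i)) := by gcongr
    have h7 : 2 * ((I : ℝ) / m * h.α' t ^ 2 * (2 * c.σ ^ 2 * (1 + c.V ^ 2) / B))
        ≤ c.KU * ((I : ℝ) / m * h.α' t ^ 2 / B) := by
      have : 2 * ((I : ℝ) / m * h.α' t ^ 2 * (2 * c.σ ^ 2 * (1 + c.V ^ 2) / B))
        = 4 * c.σ ^ 2 * (1 + c.V ^ 2) * ((I : ℝ) / m * h.α' t ^ 2 / B) := by ring
      rw [this]
      gcongr
      unfold Consts.KU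
      linarith
    have h8 : 8 * ((m : ℝ) / I * (8 * c.KΦ * q.moveSq i / B))
        + 4 * ((m : ℝ) / I * selInd m I * (2 * c.KΦ * q.moveSq i))
        ≤ c.KU * ((m : ℝ) / I * (selInd m I + 1 / B)) * q.moveSq i := by
      have e1 : c.KU * ((m : ℝ) / I * (selInd m I + 1 / B)) * q.moveSq i
          = 8 * ((m : ℝ) / I * (8 * c.KΦ * q.moveSq i / B))
          + 4 * ((m : ℝ) / I * selInd m I * (2 * c.KΦ * q.moveSq i))
          + (56 * c.KΦ * ((m : ℝ) / I * selInd m I * q.moveSq i)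
            + 4 * c.σ ^ 2 * (1 + c.V ^ 2)
              * ((m : ℝ) / I * (selInd m I + 1 / B) * q.moveSq i)) := by
        unfold Consts.KU
        ring
      rw [e1]
      have : 0 ≤ 56 * c.KΦ * ((m : ℝ) / I * selInd m I * q.moveSq i)
            + 4 * c.σ ^ 2 * (1 + c.V ^ 2)
              * ((m : ℝ) / I * (selInd m I + 1 / B) * q.moveSq i) := by positivity
      linarith
    linarith
  refine (average_block_le (hI.trans hIm) (b₃ := fun _ => 0) (b₄ := fun _ => 0) hle).trans
    (le_of_eq ?_)
  simp only [Problem.errU, State.lag]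
  ring

/-- In contrast to $s$ and $u$, a single vector is updated at every iteration. So the contraction is
$1-\beta$ with no factor $I/m$, and the move is weighted by $\rho$ with no factor $m/I$. -/
theorem errZ_step (hc : c.Valid) (hI : 1 ≤ I) (hIm : I ≤ m) (hB : 1 ≤ B) (hβ0 : 0 ≤ h.β t)
    (hβ : h.β t ≤ 1) (hv : ∀ i, ‖q.v i‖ ≤ c.V) :
    Integrable (fun w : IterSample m B Ξ Z => p.errZ (step p I V τ h t w q)) (iterLaw p I B) ∧
    ∫ w, p.errZ (step p I V τ h t w q) ∂(iterLaw p I B)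
      ≤ (1 - h.β t) * p.errZ q + c.KZ * (h.β t ^ 2 * rho m I B)
        + c.KZ * (rho m I B * q.lag) := by
  have hB' : (0 : ℝ) < B := by exact_mod_cast hB
  have h0 := storm_step hI hIm (z := q.z) hβ0 hβ (l := fun i => q.moveSq i)
    (fun i => hp.meanVar_blockHat hB i q.x (q.y i) (q.v i) (hv i))
    (fun i => hp.meanVar_blockHat_sub hc hB i q.x q.xPrev (q.y i) (q.yPrev i) (q.v i) (q.vPrev i)
      (hv i))
    (fun i => pow_le_pow_left₀ (norm_nonneg _) (hp.norm_block_le hc i q.x (q.y i) (q.v i) (hv i)) 2)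
    (fun i => hp.norm_block_sub_sq_le i q.x q.xPrev (q.y i) (q.yPrev i) (q.v i) (q.vPrev i) hc
      (hv i))
  refine ⟨h0.1, ?_⟩
  have h1 := h0.2
  change ∫ w, p.errZ (step p I V τ h t w q) ∂(iterLaw p I B) ≤ (1 - h.β t) * p.errZ q + _ + _
    at h1
  refine h1.trans ?_
  rw [rho_eq]
  set S : ℝ := if I < m then 1 / (I : ℝ) else 0 with hS
  have hS0 : 0 ≤ S := by rw [hS]; split_ifs <;> positivity
  have hl := q.lag_nonneg
  have hK := c.KB_nonneg
  have e1 : 2 * ((m : ℝ)⁻¹ * ∑ i, 8 * c.KB * (‖q.x - q.xPrev‖ ^ 2 + ‖q.y i - q.yPrev i‖ ^ 2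
      + ‖q.v i - q.vPrev i‖ ^ 2) / (B : ℝ)) = 16 * c.KB * (1 / B) * q.lag := by
    rw [← sum_div, ← mul_sum]
    simp only [State.lag, State.moveSq]
    ring
  rw [e1]
  change _ + (_ + _) + S * (2 * h.β t ^ 2 * (c.Cfx + c.Lgy * c.V) ^ 2
    + 2 * (2 * c.KB * q.lag)) ≤ _
  have e2 : (1 - h.β t) * p.errZ q + c.KZ * (h.β t ^ 2 * (S + 1 / B)) + c.KZ * ((S + 1 / B) * q.lag)
      = (1 - h.β t) * p.errZ q + (2 * h.β t ^ 2 * (2 * c.σ ^ 2 * (1 + c.V ^ 2) / B)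
        + 16 * c.KB * (1 / B) * q.lag)
        + S * (2 * h.β t ^ 2 * (c.Cfx + c.Lgy * c.V) ^ 2 + 2 * (2 * c.KB * q.lag))
        + ((2 * (c.Cfx + c.Lgy * c.V) ^ 2 + 16 * c.KB) * (h.β t ^ 2 * (1 / B))
          + (4 * c.σ ^ 2 * (1 + c.V ^ 2) + 16 * c.KB) * (h.β t ^ 2 * S)
          + (4 * c.σ ^ 2 * (1 + c.V ^ 2) + 2 * (c.Cfx + c.Lgy * c.V) ^ 2) * ((1 / B) * q.lag)
          + (4 * c.σ ^ 2 * (1 + c.V ^ 2) + 2 * (c.Cfx + c.Lgy * c.V) ^ 2 + 12 * c.KB)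
            * (S * q.lag)) := by
    unfold Consts.KZ
    ring
  rw [e2]
  have : 0 ≤ (2 * (c.Cfx + c.Lgy * c.V) ^ 2 + 16 * c.KB) * (h.β t ^ 2 * (1 / B))
          + (4 * c.σ ^ 2 * (1 + c.V ^ 2) + 16 * c.KB) * (h.β t ^ 2 * S)
          + (4 * c.σ ^ 2 * (1 + c.V ^ 2) + 2 * (c.Cfx + c.Lgy * c.V) ^ 2) * ((1 / B) * q.lag)
          + (4 * c.σ ^ 2 * (1 + c.V ^ 2) + 2 * (c.Cfx + c.Lgy * c.V) ^ 2 + 12 * c.KB)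
            * (S * q.lag) := by positivity
  linarith

end Problem.Assumptions

end BSVRB

namespace BSVRB

variable {m dx : ℕ} {dy : Fin m → ℕ} {Ξ Z : Type*} [MeasurableSpace Ξ] [MeasurableSpace Z]
  {p : Problem m dx dy Ξ Z} {c : Consts}

/-! ### Deterministic progress of one iteration -/

namespace Problem.Assumptions

variable (hp : p.Assumptions c) (hc : c.Valid) {I B : ℕ} {τ : ℝ} {h : Steps} {t : ℕ}
  {q : State m dx dy}
include hp hc

/-- The inner product gains $2s\lambda$ by strong monotonicity, and the quadratic term costs at most
$s\lambda$ because $sL_g^2\le\lambda$. -/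
theorem norm_sub_smul_gradY_sq_le {s : ℝ} (hs : 0 ≤ s) (hsL : s * c.Lg ^ 2 ≤ c.lam) (i : Fin m)
    (x : E dx) (y : E (dy i)) :
    ‖(y - p.ySol i x) - s • gradY (p.gbar i) x y‖ ^ 2
      ≤ (1 - s * c.lam) * ‖y - p.ySol i x‖ ^ 2 := by
  have h1 := hp.strong_monotone i x y (p.ySol i x)
  have h2 := hp.g_smooth i x y (p.ySol i x)
  rw [hp.gradY_ySol hc, sub_zero] at h1 h2
  have h3 := pow_le_pow_left₀ (norm_nonneg _) h2 2
  rw [norm_sub_sq_real, inner_smul_right, real_inner_comm, norm_smul, mul_pow, Real.norm_eq_abs,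
    sq_abs]
  have h4 := mul_le_mul_of_nonneg_left h1 hs
  have h5 : s ^ 2 * ‖gradY (p.gbar i) x y‖ ^ 2 ≤ s * (c.lam * ‖y - p.ySol i x‖ ^ 2) := by
    calc s ^ 2 * ‖gradY (p.gbar i) x y‖ ^ 2 ≤ s ^ 2 * (c.Lg * ‖y - p.ySol i x‖) ^ 2 := by gcongr
      _ = s * (s * c.Lg ^ 2 * ‖y - p.ySol i x‖ ^ 2) := by ring
      _ ≤ _ := by gcongr
  linarith

theorem norm_sub_smul_hessYY_sq_le {s : ℝ} (hs : 0 ≤ s) (hsL : s * c.Lg ^ 2 ≤ c.lam) (i : Fin m)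
    (x : E dx) (y e : E (dy i)) :
    ‖e - s • hessYY (p.gbar i) x y e‖ ^ 2 ≤ (1 - s * c.lam) * ‖e‖ ^ 2 := by
  have h1 := hp.coercive i x y e
  have h2 := ((hessYY (p.gbar i) x y).le_opNorm e).trans
    (mul_le_mul_of_nonneg_right (hp.norm_hessYY_gbar_le hc i x y) (norm_nonneg e))
  rw [norm_sub_sq_real, inner_smul_right, real_inner_comm, norm_smul, mul_pow, Real.norm_eq_abs,
    sq_abs]
  have h4 := mul_le_mul_of_nonneg_left h1 hs
  have h5 : s ^ 2 * ‖hessYY (p.gbar i) x y e‖ ^ 2 ≤ s * (c.lam * ‖e‖ ^ 2) := by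
    calc s ^ 2 * ‖hessYY (p.gbar i) x y e‖ ^ 2 ≤ s ^ 2 * (c.Lg * ‖e‖) ^ 2 := by gcongr
      _ = s * (s * c.Lg ^ 2 * ‖e‖ ^ 2) := by ring
      _ ≤ _ := by gcongr
  linarith

theorem norm_gradPhi_ySol (i : Fin m) (x : E dx) (v : E (dy i)) :
    p.gradPhi i v x (p.ySol i x) = hessYY (p.gbar i) x (p.ySol i x) (v - p.vSol i x) := by
  rw [Problem.gradPhi, map_sub, hp.hessYY_vSol hc]

/-- The step in $v$ is compared with the gradient of the quadratic at the exact $y_i(x)$, whose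
minimizer is $v_i(x)$. The price is the distance of $y_i$ from $y_i(x)$, besides the estimation
error and the last move. -/
theorem norm_u_sub_sq_le (hv : ∀ i, ‖q.v i‖ ≤ c.V) (i : Fin m) :
    ‖q.u i - p.gradPhi i (q.v i) q.x (p.ySol i q.x)‖ ^ 2
      ≤ 2 * ‖q.u i - p.gradPhi i (q.vPrev i) q.xPrev (q.yPrev i)‖ ^ 2
        + 8 * c.KΦ * (q.moveSq i + ‖q.y i - p.ySol i q.x‖ ^ 2) := by
  have e : q.u i - p.gradPhi i (q.v i) q.x (p.ySol i q.x)
      = (q.u i - p.gradPhi i (q.vPrev i) q.xPrev (q.yPrev i))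
        - (p.gradPhi i (q.v i) q.x (p.ySol i q.x)
          - p.gradPhi i (q.vPrev i) q.xPrev (q.yPrev i)) := by abel
  rw [e]
  refine (norm_sub_sq_le_two _ _).trans ?_
  have h1 := hp.norm_gradPhi_sub_sq_le i q.x q.xPrev (p.ySol i q.x) (q.yPrev i) (q.v i) (q.vPrev i)
    hc (hv i)
  have e2 : p.ySol i q.x - q.yPrev i = (q.y i - q.yPrev i) - (q.y i - p.ySol i q.x) := by abel
  have h2 := norm_sub_sq_le_two (q.y i - q.yPrev i) (q.y i - p.ySol i q.x)
  rw [← e2] at h2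
  have h3 : ‖q.x - q.xPrev‖ ^ 2 + ‖p.ySol i q.x - q.yPrev i‖ ^ 2 + ‖q.v i - q.vPrev i‖ ^ 2
      ≤ 2 * (q.moveSq i + ‖q.y i - p.ySol i q.x‖ ^ 2) := by
    unfold State.moveSq
    linarith [sq_nonneg ‖q.x - q.xPrev‖, sq_nonneg ‖q.v i - q.vPrev i‖]
  have h4 := mul_le_mul_of_nonneg_left h3 (show 0 ≤ 2 * c.KΦ by have := c.KΦ_nonneg; positivity)
  linarith

/-- A gradient step on $g_i(x,\cdot)$ with an inexact gradient, followed by a shift of the target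
from $y_i(x)$ to $y_i(x')$. The error of `s` at the current point is its error at the previous point
plus the change of the gradient in between, which gives the lag term. -/
theorem errY_step (hs : 0 < τ * h.τy t) (hsl : τ * h.τy t * c.lam ≤ 1)
    (hsL : τ * h.τy t * c.Lg ^ 2 ≤ c.lam) (hm : 1 ≤ m) (w : IterSample m B Ξ Z) :
    p.errY (step p I c.V τ h t w q) ≤ (1 - τ * h.τy t * c.lam / 2) * p.errY q
      + 14 / c.lam * (τ * h.τy t) * p.errS q + 14 / c.lam * c.Lgy ^ 2 * (τ * h.τy t) * q.lag
      + 5 / c.lam * c.Ky ^ 2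
        * (‖(step p I c.V τ h t w q).x - q.x‖ ^ 2 / (τ * h.τy t)) := by
  set q' := step p I c.V τ h t w q with hq'
  set s := τ * h.τy t with hs'
  have hl := hc.lam_pos
  have hle : ∀ i, ‖q'.y i - p.ySol i q'.x‖ ^ 2
      ≤ 5 / c.lam * c.Ky ^ 2 * (‖q'.x - q.x‖ ^ 2 / s)
        + (1 - s * c.lam / 2) * ‖q.y i - p.ySol i q.x‖ ^ 2
        + 14 / c.lam * s * ‖q.s i - gradY (p.gbar i) q.xPrev (q.yPrev i)‖ ^ 2
        + 14 / c.lam * c.Lgy ^ 2 * s * q.moveSq i + 0 * 0 := fun i => by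
    set g₁ := gradY (p.gbar i) q.x (q.y i)
    set g₀ := gradY (p.gbar i) q.xPrev (q.yPrev i)
    have e : q'.y i - p.ySol i q'.x
        = (((q.y i - p.ySol i q.x) - s • g₁) - s • (q.s i - g₁))
          + (p.ySol i q.x - p.ySol i q'.x) := by
      have : q'.y i = q.y i - s • q.s i := rfl
      rw [this, smul_sub]
      abel
    rw [e]
    refine (contraction_step hs hl hsl
      (hp.norm_sub_smul_gradY_sq_le hc hs.le hsL i q.x (q.y i)) le_rfl).trans ?_
    have h1 : ‖p.ySol i q.x - p.ySol i q'.x‖ ^ 2 ≤ c.Ky ^ 2 * ‖q'.x - q.x‖ ^ 2 := by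
      rw [← mul_pow, norm_sub_rev q'.x q.x]
      exact pow_le_pow_left₀ (norm_nonneg _) (hp.norm_ySol_sub_le hc i q.x q'.x) 2
    have h2 : ‖q.s i - g₁‖ ^ 2 ≤ 2 * ‖q.s i - g₀‖ ^ 2 + 2 * (c.Lgy ^ 2 * q.moveSq i) := by
      have e2 : q.s i - g₁ = (q.s i - g₀) - (g₁ - g₀) := by abel
      rw [e2]
      refine (norm_sub_sq_le_two _ _).trans ?_
      have h3 := (hp.lip_gradY_gbar i).norm_sub_sq_le q.x q.xPrev (q.y i) (q.yPrev i)
      have h4 : ‖q.x - q.xPrev‖ ^ 2 + ‖q.y i - q.yPrev i‖ ^ 2 ≤ q.moveSq i := by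
        unfold State.moveSq
        linarith [sq_nonneg ‖q.v i - q.vPrev i‖]
      have h5 := mul_le_mul_of_nonneg_left h4 (sq_nonneg c.Lgy)
      linarith
    have h6 : 7 / c.lam * (s * ‖q.s i - g₁‖ ^ 2)
        ≤ 7 / c.lam * (s * (2 * ‖q.s i - g₀‖ ^ 2 + 2 * (c.Lgy ^ 2 * q.moveSq i))) := by gcongr
    have h7 : 5 / c.lam * (‖p.ySol i q.x - p.ySol i q'.x‖ ^ 2 / s)
        ≤ 5 / c.lam * (c.Ky ^ 2 * ‖q'.x - q.x‖ ^ 2 / s) := by gcongr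
    refine (add_le_add (add_le_add le_rfl h6) h7).trans (le_of_eq ?_)
    ring
  refine (average_block_le hm (b₄ := fun _ => 0) hle).trans (le_of_eq ?_)
  simp only [Problem.errY, Problem.errS, State.lag]
  ring

/-- At the exact $y_i(x)$ the gradient in $v$ equals $H(v-v_i(x))$, so a step along it contracts.
The projection is harmless because $v_i(x)$ lies in the ball. -/
theorem errV_step (hs : 0 < h.τv t) (hsl : h.τv t * c.lam ≤ 1)
    (hsL : h.τv t * c.Lg ^ 2 ≤ c.lam) (hm : 1 ≤ m) (hv : ∀ i, ‖q.v i‖ ≤ c.V)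
    (w : IterSample m B Ξ Z) :
    p.errV (step p I c.V τ h t w q) ≤ (1 - h.τv t * c.lam / 2) * p.errV q
      + 14 / c.lam * h.τv t * p.errU q + 56 / c.lam * c.KΦ * h.τv t * (q.lag + p.errY q)
      + 5 / c.lam * c.Kv ^ 2 * (‖(step p I c.V τ h t w q).x - q.x‖ ^ 2 / h.τv t) := by
  set q' := step p I c.V τ h t w q with hq'
  set s := h.τv t with hs'
  have hl := hc.lam_pos
  have hle : ∀ i, ‖q'.v i - p.vSol i q'.x‖ ^ 2
      ≤ 5 / c.lam * c.Kv ^ 2 * (‖q'.x - q.x‖ ^ 2 / s)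
        + (1 - s * c.lam / 2) * ‖q.v i - p.vSol i q.x‖ ^ 2
        + 14 / c.lam * s * ‖q.u i - p.gradPhi i (q.vPrev i) q.xPrev (q.yPrev i)‖ ^ 2
        + 56 / c.lam * c.KΦ * s * q.moveSq i
        + 56 / c.lam * c.KΦ * s * ‖q.y i - p.ySol i q.x‖ ^ 2 := fun i => by
    set g₁ := p.gradPhi i (q.v i) q.x (p.ySol i q.x) with hg₁
    have e : q'.v i - p.vSol i q'.x
        = (q'.v i - p.vSol i q.x) + (p.vSol i q.x - p.vSol i q'.x) := by abel
    rw [e]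
    have hcontr := hp.norm_sub_smul_hessYY_sq_le hc hs.le hsL i q.x (p.ySol i q.x)
      (q.v i - p.vSol i q.x)
    rw [← hp.norm_gradPhi_ySol hc, ← hg₁] at hcontr
    have hproj : ‖q'.v i - p.vSol i q.x‖
        ≤ ‖((q.v i - p.vSol i q.x) - s • g₁) - s • (q.u i - g₁)‖ := by
      have e2 : ((q.v i - p.vSol i q.x) - s • g₁) - s • (q.u i - g₁)
          = (q.v i - s • q.u i) - p.vSol i q.x := by
        rw [smul_sub]
        abel
      rw [e2]
      exact norm_projBall_sub_le _ _ (hp.norm_vSol_le hc i q.x)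
    refine (contraction_step hs hl hsl hcontr hproj).trans ?_
    have h1 : ‖p.vSol i q.x - p.vSol i q'.x‖ ^ 2 ≤ c.Kv ^ 2 * ‖q'.x - q.x‖ ^ 2 := by
      rw [← mul_pow, norm_sub_rev q'.x q.x]
      exact pow_le_pow_left₀ (norm_nonneg _) (hp.norm_vSol_sub_le hc i q.x q'.x) 2
    have h2 := hp.norm_u_sub_sq_le hc hv i
    have h6 : 7 / c.lam * (s * ‖q.u i - g₁‖ ^ 2)
        ≤ 7 / c.lam * (s * (2 * ‖q.u i - p.gradPhi i (q.vPrev i) q.xPrev (q.yPrev i)‖ ^ 2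
        + 8 * c.KΦ * (q.moveSq i + ‖q.y i - p.ySol i q.x‖ ^ 2))) := by gcongr
    have h7 : 5 / c.lam * (‖p.vSol i q.x - p.vSol i q'.x‖ ^ 2 / s)
        ≤ 5 / c.lam * (c.Kv ^ 2 * ‖q'.x - q.x‖ ^ 2 / s) := by gcongr
    refine (add_le_add (add_le_add le_rfl h6) h7).trans (le_of_eq ?_)
    ring
  refine (average_block_le hm hle).trans (le_of_eq ?_)
  simp only [Problem.errY, Problem.errU, Problem.errV, State.lag]
  ring

/-- Each of $s$ and $u$ is split into estimation error, change since the last iterate, and a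
gradient that vanishes at the exact solution and is bounded by the distance to it. Every
contribution apart from the move of $x$ carries a squared step size. -/
theorem lag_step (hm : 1 ≤ m) (hs : 0 ≤ h.τv t) (hv : ∀ i, ‖q.v i‖ ≤ c.V)
    (w : IterSample m B Ξ Z) :
    (step p I c.V τ h t w q).lag ≤ ‖(step p I c.V τ h t w q).x - q.x‖ ^ 2
      + (τ * h.τy t) ^ 2 * (3 * p.errS q + 3 * c.Lgy ^ 2 * q.lag + 3 * c.Lg ^ 2 * p.errY q)
      + h.τv t ^ 2 * (4 * p.errU q + 16 * c.KΦ * (q.lag + p.errY q)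
        + 2 * c.Lg ^ 2 * p.errV q) := by
  set q' := step p I c.V τ h t w q with hq'
  set r := τ * h.τy t with hr
  set s := h.τv t with hs'
  have hm' : (0 : ℝ) < m := by exact_mod_cast hm
  have hY : ∀ i, ‖q'.y i - q.y i‖ ^ 2
      ≤ 0 + r ^ 2 * 3 * ‖q.s i - gradY (p.gbar i) q.xPrev (q.yPrev i)‖ ^ 2
        + r ^ 2 * 3 * c.Lgy ^ 2 * q.moveSq i
        + r ^ 2 * 3 * c.Lg ^ 2 * ‖q.y i - p.ySol i q.x‖ ^ 2 + 0 * 0 := fun i => by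
    set g₁ := gradY (p.gbar i) q.x (q.y i)
    set g₀ := gradY (p.gbar i) q.xPrev (q.yPrev i)
    have e : q'.y i - q.y i = -(r • q.s i) := by
      have : q'.y i = q.y i - r • q.s i := rfl
      rw [this]
      abel
    rw [e, norm_neg, norm_smul, mul_pow, Real.norm_eq_abs, sq_abs]
    have e2 : q.s i = (q.s i - g₀) + (g₀ - g₁) + g₁ := by abel
    have h1 := norm_add_add_sq_le (q.s i - g₀) (g₀ - g₁) g₁
    rw [← e2] at h1
    have h2 := hp.g_smooth i q.x (q.y i) (p.ySol i q.x)
    rw [hp.gradY_ySol hc, sub_zero] at h2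
    have h3 := pow_le_pow_left₀ (norm_nonneg _) h2 2
    rw [mul_pow] at h3
    have h4 := (hp.lip_gradY_gbar i).norm_sub_sq_le q.x q.xPrev (q.y i) (q.yPrev i)
    have h5 : ‖q.x - q.xPrev‖ ^ 2 + ‖q.y i - q.yPrev i‖ ^ 2 ≤ q.moveSq i := by
      unfold State.moveSq
      linarith [sq_nonneg ‖q.v i - q.vPrev i‖]
    have h6 := h4.trans (mul_le_mul_of_nonneg_left h5 (sq_nonneg c.Lgy))
    rw [norm_sub_rev] at h6
    have h7 : ‖q.s i‖ ^ 2 ≤ 3 * ‖q.s i - g₀‖ ^ 2 + 3 * (c.Lgy ^ 2 * q.moveSq i)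
        + 3 * (c.Lg ^ 2 * ‖q.y i - p.ySol i q.x‖ ^ 2) := by linarith
    refine (mul_le_mul_of_nonneg_left h7 (sq_nonneg r)).trans (le_of_eq ?_)
    ring
  have hV : ∀ i, ‖q'.v i - q.v i‖ ^ 2
      ≤ 0 + s ^ 2 * 4 * ‖q.u i - p.gradPhi i (q.vPrev i) q.xPrev (q.yPrev i)‖ ^ 2
        + s ^ 2 * 16 * c.KΦ * q.moveSq i
        + s ^ 2 * 16 * c.KΦ * ‖q.y i - p.ySol i q.x‖ ^ 2
        + s ^ 2 * 2 * c.Lg ^ 2 * ‖q.v i - p.vSol i q.x‖ ^ 2 := fun i => by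
    set g₁ := p.gradPhi i (q.v i) q.x (p.ySol i q.x) with hg₁
    -- The old $v_i$ lies in the ball, so projecting does not lengthen the step.
    have h0 : ‖q'.v i - q.v i‖ ≤ s * ‖q.u i‖ := by
      have := norm_projBall_sub_le (q.v i - s • q.u i) (q.v i) (hv i)
      rwa [sub_sub_cancel_left, norm_neg, norm_smul, Real.norm_of_nonneg hs] at this
    have h1 := pow_le_pow_left₀ (norm_nonneg _) h0 2
    rw [mul_pow] at h1
    have h2 := norm_add_sq_le_two (q.u i - g₁) g₁
    rw [sub_add_cancel] at h2
    have h3 := hp.norm_u_sub_sq_le hc hv i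
    have h4 : ‖g₁‖ ≤ c.Lg * ‖q.v i - p.vSol i q.x‖ := by
      rw [hg₁, hp.norm_gradPhi_ySol hc]
      exact ((hessYY (p.gbar i) q.x (p.ySol i q.x)).le_opNorm _).trans
        (mul_le_mul_of_nonneg_right (hp.norm_hessYY_gbar_le hc i _ _) (norm_nonneg _))
    have h5 := pow_le_pow_left₀ (norm_nonneg _) h4 2
    rw [mul_pow] at h5
    have h6 : ‖q.u i‖ ^ 2 ≤ 2 * (2 * ‖q.u i - p.gradPhi i (q.vPrev i) q.xPrev (q.yPrev i)‖ ^ 2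
        + 8 * c.KΦ * (q.moveSq i + ‖q.y i - p.ySol i q.x‖ ^ 2))
        + 2 * (c.Lg ^ 2 * ‖q.v i - p.vSol i q.x‖ ^ 2) := by linarith
    refine h1.trans ((mul_le_mul_of_nonneg_left h6 (sq_nonneg s)).trans (le_of_eq ?_))
    ring
  have hY' := average_block_le hm (b₄ := fun _ => 0) hY
  have hV' := average_block_le hm hV
  have e : q'.lag = ‖q'.x - q.x‖ ^ 2 + (m : ℝ)⁻¹ * ∑ i, ‖q'.y i - q.y i‖ ^ 2
      + (m : ℝ)⁻¹ * ∑ i, ‖q'.v i - q.v i‖ ^ 2 := by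
    have h1 : q'.lag = (m : ℝ)⁻¹ * ∑ i, (‖q'.x - q.x‖ ^ 2 + ‖q'.y i - q.y i‖ ^ 2
      + ‖q'.v i - q.v i‖ ^ 2) := rfl
    rw [h1, sum_add_distrib, sum_add_distrib, sum_const, card_univ, Fintype.card_fin, nsmul_eq_mul]
    field_simp
  rw [e]
  refine (add_le_add (add_le_add le_rfl hY') hV').trans (le_of_eq ?_)
  simp only [Problem.errY, Problem.errU, Problem.errV, Problem.errS, State.lag]
  ring

theorem norm_gradient_sub_hyperGrad_sq_le (hm : 1 ≤ m) :
    ‖gradient p.F q.x - p.hyperGrad q.x q.y q.v‖ ^ 2 ≤ 2 * c.KB * (p.errY q + p.errV q) := by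
  rw [hp.gradient_F hc, Problem.hyperGrad, Problem.hyperGrad, ← smul_sub, ← sum_sub_distrib]
  have h0 := norm_average_sq_le (univ : Finset (Fin m)) fun i =>
    p.block i q.x (p.ySol i q.x) (p.vSol i q.x) - p.block i q.x (q.y i) (q.v i)
  rw [card_univ, Fintype.card_fin] at h0
  refine h0.trans ?_
  have hle : ∀ i, ‖p.block i q.x (p.ySol i q.x) (p.vSol i q.x) - p.block i q.x (q.y i) (q.v i)‖ ^ 2
      ≤ 0 + 2 * c.KB * ‖q.y i - p.ySol i q.x‖ ^ 2 + 2 * c.KB * ‖q.v i - p.vSol i q.x‖ ^ 2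
        + 0 * 0 + 0 * 0 := fun i => by
    have h1 := hp.norm_block_sub_sq_le i q.x q.x (p.ySol i q.x) (q.y i) (p.vSol i q.x) (q.v i) hc
      (hp.norm_vSol_le hc i q.x)
    rw [norm_sub_rev (p.ySol i q.x), norm_sub_rev (p.vSol i q.x), sub_self, norm_zero] at h1
    linarith
  refine (average_block_le hm (b₃ := fun _ => 0) (b₄ := fun _ => 0) hle).trans (le_of_eq ?_)
  simp only [Problem.errY, Problem.errV]
  ring

/-- The move of $x$ uses the new `z`, so the error of the new state enters. For this reason `errZ`
is later weighted by $A_Z+\eta$. -/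
theorem F_step (hm : 1 ≤ m) (hη : 0 ≤ h.η t) (hη' : c.KF * h.η t ≤ 1 / 4)
    (w : IterSample m B Ξ Z) :
    p.F (step p I c.V τ h t w q).x ≤ p.F q.x - h.η t / 2 * ‖gradient p.F q.x‖ ^ 2
      - h.η t / 4 * ‖(step p I c.V τ h t w q).z‖ ^ 2
      + h.η t * (2 * c.KB * (p.errY q + p.errV q)) + h.η t * p.errZ (step p I c.V τ h t w q) := by
  set q' := step p I c.V τ h t w q with hq'
  have h1 := hp.descent hc q.x q'.z hη hη'
  have h2 := norm_sub_sq_le_two (gradient p.F q.x - p.hyperGrad q.x q.y q.v)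
    (q'.z - p.hyperGrad q.x q.y q.v)
  rw [sub_sub_sub_cancel_right] at h2
  have h3 := hp.norm_gradient_sub_hyperGrad_sq_le hc (q := q) hm
  have h4 : ‖q'.z - p.hyperGrad q.x q.y q.v‖ ^ 2 = p.errZ q' := rfl
  have h5 : q'.x = q.x - h.η t • q'.z := rfl
  rw [h5]
  rw [h4] at h2
  have h6 : h.η t / 2 * ‖gradient p.F q.x - q'.z‖ ^ 2
      ≤ h.η t / 2 * (2 * (2 * c.KB * (p.errY q + p.errV q)) + 2 * p.errZ q') := by
    gcongr
    linarith
  linarith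

omit hp hc in
theorem norm_x_step_sub_sq (V : ℝ) (w : IterSample m B Ξ Z) :
    ‖(step p I V τ h t w q).x - q.x‖ ^ 2
      = h.η t ^ 2 * ‖(step p I V τ h t w q).z‖ ^ 2 := by
  have h5 : (step p I V τ h t w q).x - q.x
      = -(h.η t • (step p I V τ h t w q).z) := by
    have : (step p I V τ h t w q).x
      = q.x - h.η t • (step p I V τ h t w q).z := rfl
    rw [this]
    abel
  rw [h5, norm_neg, norm_smul, mul_pow, Real.norm_eq_abs, sq_abs]

end Problem.Assumptions

/-! ### The Lyapunov function -/

/-- A constant dominating all constants in the one-iteration estimates. -/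
noncomputable def Consts.K (c : Consts) (τ : ℝ) : ℝ :=
  1 + c.KS + c.KU + c.KZ + 2 * c.KB + 2 / (τ * c.lam) + 2 / c.lam
    + 14 / c.lam * τ + 14 / c.lam * c.Lgy ^ 2 * τ + 5 / c.lam * c.Ky ^ 2 / τ
    + 14 / c.lam + 56 / c.lam * c.KΦ + 5 / c.lam * c.Kv ^ 2
    + τ ^ 2 * (3 + 3 * c.Lgy ^ 2 + 3 * c.Lg ^ 2) + (4 + 16 * c.KΦ + 2 * c.Lg ^ 2)

/-- Coefficients of the Lyapunov function. -/
structure Coeffs where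
  S : ℝ
  U : ℝ
  Z : ℝ
  Y : ℝ
  V : ℝ
  L : ℝ

/-- Nonnegative coefficients. -/
structure Coeffs.Nonneg (A : Coeffs) : Prop where
  S : 0 ≤ A.S
  U : 0 ≤ A.U
  Z : 0 ≤ A.Z
  Y : 0 ≤ A.Y
  V : 0 ≤ A.V
  L : 0 ≤ A.L

/-- The Lyapunov function, without the objective. -/
noncomputable def Problem.lyap (p : Problem m dx dy Ξ Z) (A : Coeffs) (q : State m dx dy) : ℝ :=
  A.S * p.errS q + A.U * p.errU q + A.Z * p.errZ q + A.Y * p.errY q + A.V * p.errV q + A.L * q.lag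

theorem Problem.lyap_nonneg (p : Problem m dx dy Ξ Z) {A : Coeffs} (hA : A.Nonneg)
    (q : State m dx dy) : 0 ≤ p.lyap A q := by
  have := hA.S
  have := hA.U
  have := hA.Z
  have := hA.Y
  have := hA.V
  have := hA.L
  have := p.errS_nonneg q
  have := p.errU_nonneg q
  have := p.errZ_nonneg q
  have := p.errY_nonneg q
  have := p.errV_nonneg q
  have := q.lag_nonneg
  unfold Problem.lyap
  positivity

/-- Conditions on the step sizes of iteration `t`, for the Lyapunov function with coefficients `A`
to decrease up to `N`. -/
structure Balanced (K : ℝ) (A : Coeffs) (m I B : ℕ) (h : Steps) (t : ℕ) (N : ℝ) : Prop where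
  move : h.η t * (A.Y * K / h.τy t + A.V * K / h.τv t + A.L) ≤ 1 / 4
  Y : h.η t * K + A.V * K * h.τv t + A.L * K * (h.τy t ^ 2 + h.τv t ^ 2) ≤ A.Y * h.τy t / K
  V : h.η t * K + A.L * K * h.τv t ^ 2 ≤ A.V * h.τv t / K
  S : A.Y * K * h.τy t + A.L * K * h.τy t ^ 2 ≤ A.S * ((I : ℝ) / m * h.α t)
  U : A.V * K * h.τv t + A.L * K * h.τv t ^ 2 ≤ A.U * ((I : ℝ) / m * h.α' t)
  Z : h.η t ≤ A.Z * h.β t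
  L : A.Y * K * h.τy t + A.V * K * h.τv t + A.L * K * (h.τy t ^ 2 + h.τv t ^ 2)
    + (A.S + A.U) * K * ((m : ℝ) / I * (selInd m I + 1 / B)) + (A.Z + h.η t) * K * rho m I B ≤ A.L
  noise : A.S * K * ((I : ℝ) / m * h.α t ^ 2 / B) + A.U * K * ((I : ℝ) / m * h.α' t ^ 2 / B)
    + (A.Z + h.η t) * K * (h.β t ^ 2 * rho m I B) ≤ N

/-- Elementary conditions on the step sizes of iteration `t`. -/
structure StepOk (c : Consts) (τ : ℝ) (h : Steps) (t : ℕ) : Prop where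
  α_nonneg : 0 ≤ h.α t
  α_le : h.α t ≤ 1 / 2
  α'_nonneg : 0 ≤ h.α' t
  α'_le : h.α' t ≤ 1 / 2
  β_nonneg : 0 ≤ h.β t
  β_le : h.β t ≤ 1
  τy_pos : 0 < h.τy t
  τy_lam : τ * h.τy t * c.lam ≤ 1
  τy_Lg : τ * h.τy t * c.Lg ^ 2 ≤ c.lam
  τv_pos : 0 < h.τv t
  τv_lam : h.τv t * c.lam ≤ 1
  τv_Lg : h.τv t * c.Lg ^ 2 ≤ c.lam
  η_nonneg : 0 ≤ h.η t
  η_le : c.KF * h.η t ≤ 1 / 4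

end BSVRB

/-! ### One-iteration decrease of the Lyapunov function -/

namespace BSVRB

variable {m dx : ℕ} {dy : Fin m → ℕ} {Ξ Z : Type*} [MeasurableSpace Ξ] [MeasurableSpace Z]
  {p : Problem m dx dy Ξ Z} {c : Consts}

theorem Consts.Valid.K_bounds (hc : c.Valid) {τ : ℝ} (hτ : 0 < τ) :
    1 ≤ c.K τ ∧ c.KS ≤ c.K τ ∧ c.KU ≤ c.K τ ∧ c.KZ ≤ c.K τ ∧ 2 * c.KB ≤ c.K τ
      ∧ 2 / (τ * c.lam) ≤ c.K τ ∧ 2 / c.lam ≤ c.K τ ∧ 14 / c.lam * τ ≤ c.K τ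
      ∧ 14 / c.lam * c.Lgy ^ 2 * τ ≤ c.K τ ∧ 5 / c.lam * c.Ky ^ 2 / τ ≤ c.K τ
      ∧ 14 / c.lam ≤ c.K τ ∧ 56 / c.lam * c.KΦ ≤ c.K τ ∧ 5 / c.lam * c.Kv ^ 2 ≤ c.K τ
      ∧ τ ^ 2 * (3 + 3 * c.Lgy ^ 2 + 3 * c.Lg ^ 2) ≤ c.K τ
      ∧ 4 + 16 * c.KΦ + 2 * c.Lg ^ 2 ≤ c.K τ := by
  have hl := hc.lam_pos
  have hΦ := c.KΦ_nonneg
  have hB := c.KB_nonneg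
  have h1 : 0 ≤ c.KS := by unfold Consts.KS; positivity
  have h2 : 0 ≤ c.KU := by unfold Consts.KU; positivity
  have h3 : 0 ≤ c.KZ := by unfold Consts.KZ; positivity
  have h4 : 0 ≤ 2 / (τ * c.lam) := by positivity
  have h5 : 0 ≤ 2 / c.lam := by positivity
  have h6 : 0 ≤ 14 / c.lam * τ := by positivity
  have h7 : 0 ≤ 14 / c.lam * c.Lgy ^ 2 * τ := by positivity
  have h8 : 0 ≤ 5 / c.lam * c.Ky ^ 2 / τ := by positivity
  have h9 : 0 ≤ 14 / c.lam := by positivity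
  have h10 : 0 ≤ 56 / c.lam * c.KΦ := by positivity
  have h11 : 0 ≤ 5 / c.lam * c.Kv ^ 2 := by positivity
  have h12 : 0 ≤ τ ^ 2 * (3 + 3 * c.Lgy ^ 2 + 3 * c.Lg ^ 2) := by positivity
  have h13 : 0 ≤ 4 + 16 * c.KΦ + 2 * c.Lg ^ 2 := by positivity
  unfold Consts.K
  refine ⟨?_, ?_, ?_, ?_, ?_, ?_, ?_, ?_, ?_, ?_, ?_, ?_, ?_, ?_, ?_⟩ <;> linarith

/-- The one-iteration change of the Lyapunov function, as an inequality between real numbers. -/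
theorem lyap_arith {A : Coeffs} (hA : A.Nonneg) {K ty tv η S U Y V L G W F S' U' E' Y' V' L' F' : ℝ}
    {aα aα' Lc : ℝ} (hY0 : 0 ≤ Y) (hV0 : 0 ≤ V) (hS0 : 0 ≤ S) (hU0 : 0 ≤ U) (hL0 : 0 ≤ L)
    (hW0 : 0 ≤ W) (hη : 0 ≤ η)
    (hF : F' ≤ F - η / 2 * G - η / 4 * W + η * (K * (Y + V)) + η * E')
    (hY : Y' ≤ (1 - ty / K) * Y + K * ty * S + K * ty * L + K * (η ^ 2 * W / ty))
    (hV : V' ≤ (1 - tv / K) * V + K * tv * U + K * tv * (L + Y) + K * (η ^ 2 * W / tv))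
    (hL : L' ≤ η ^ 2 * W + ty ^ 2 * (K * (S + L + Y)) + tv ^ 2 * (K * (U + (L + Y) + V)))
    (cM : η * (A.Y * K / ty + A.V * K / tv + A.L) ≤ 1 / 4)
    (cY : η * K + A.V * K * tv + A.L * K * (ty ^ 2 + tv ^ 2) ≤ A.Y * ty / K)
    (cV : η * K + A.L * K * tv ^ 2 ≤ A.V * tv / K)
    (cS : A.Y * K * ty + A.L * K * ty ^ 2 ≤ A.S * aα)
    (cU : A.V * K * tv + A.L * K * tv ^ 2 ≤ A.U * aα')
    (cL : A.Y * K * ty + A.V * K * tv + A.L * K * (ty ^ 2 + tv ^ 2) + Lc ≤ A.L) :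
    F' + (A.S * S' + A.U * U' + A.Z * E' + A.Y * Y' + A.V * V' + A.L * L') + η / 2 * G
      ≤ F + A.S * aα * S + A.U * aα' * U + A.Y * Y + A.V * V + (A.L - Lc) * L
        + A.S * S' + A.U * U' + (A.Z + η) * E' := by
  have e1 := mul_le_mul_of_nonneg_left hY hA.Y
  have e2 := mul_le_mul_of_nonneg_left hV hA.V
  have e3 := mul_le_mul_of_nonneg_left hL hA.L
  -- Each balance condition is multiplied by the quantity it controls: $\eta W$ is paid by the
  -- descent of $F$, the errors $Y,V,S,U$ by their own contractions, and the lag by its own weight,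
  -- as the old lag is spent completely.
  have f1 := mul_le_mul_of_nonneg_right cM (show 0 ≤ η * W by positivity)
  have f2 := mul_le_mul_of_nonneg_right cY hY0
  have f3 := mul_le_mul_of_nonneg_right cV hV0
  have f4 := mul_le_mul_of_nonneg_right cS hS0
  have f5 := mul_le_mul_of_nonneg_right cU hU0
  have f6 := mul_le_mul_of_nonneg_right cL hL0
  simp only [div_eq_mul_inv] at *
  linarith

set_option maxHeartbeats 800000 in
/-- Bound on the Lyapunov function after one iteration in terms of the new estimation errors. -/
theorem Problem.Assumptions.lyap_step_le (hp : p.Assumptions c) (hc : c.Valid) {I B : ℕ} {τ : ℝ}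
    (hτ : 0 < τ) (hm : 1 ≤ m) {h : Steps} {t : ℕ} (hs : StepOk c τ h t)
    {A : Coeffs} (hA : A.Nonneg) {N F₀ : ℝ} (hbal : Balanced (c.K τ) A m I B h t N)
    {q : State m dx dy} (hv : ∀ i, ‖q.v i‖ ≤ c.V) (w : IterSample m B Ξ Z) :
    (p.F (step p I c.V τ h t w q).x - F₀ + p.lyap A (step p I c.V τ h t w q))
        + h.η t / 2 * ‖gradient p.F q.x‖ ^ 2
      ≤ (p.F q.x - F₀ + A.S * ((I : ℝ) / m * h.α t) * p.errS q
        + A.U * ((I : ℝ) / m * h.α' t) * p.errU q + A.Y * p.errY q + A.V * p.errV q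
        + (A.L - ((A.S + A.U) * c.K τ * ((m : ℝ) / I * (selInd m I + 1 / B))
        + (A.Z + h.η t) * c.K τ * rho m I B)) * q.lag)
        + A.S * p.errS (step p I c.V τ h t w q) + A.U * p.errU (step p I c.V τ h t w q)
        + (A.Z + h.η t) * p.errZ (step p I c.V τ h t w q) := by
  obtain ⟨k1, k2, k3, k4, k5, k6, k7, k8, k9, k10, k11, k12, k13, k14, k15⟩ := hc.K_bounds hτ
  set K := c.K τ with hK
  have hK0 : 0 < K := by linarith
  have hl := hc.lam_pos
  have hS0 := p.errS_nonneg q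
  have hU0 := p.errU_nonneg q
  have hY0 := p.errY_nonneg q
  have hV0 := p.errV_nonneg q
  have hL0 := q.lag_nonneg
  have hty := hs.τy_pos
  have htv := hs.τv_pos
  have hs' : 0 < τ * h.τy t := by positivity
  have hΦ := c.KΦ_nonneg
  have hη := hs.η_nonneg
  -- The share of the lag weight reserved for the recursions of `errS`, `errU`, `errZ`, which hold
  -- only in expectation and are inserted in `lyap_step`.
  set Lc := (A.S + A.U) * K * ((m : ℝ) / I * (selInd m I + 1 / B))
    + (A.Z + h.η t) * K * rho m I B with hLc
  have gF := hp.F_step hc (τ := τ) (I := I) (q := q) hm hs.η_nonneg hs.η_le w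
  have gY := hp.errY_step hc (I := I) (q := q) hs' hs.τy_lam hs.τy_Lg hm w
  have gV := hp.errV_step hc (τ := τ) (I := I) hs.τv_pos hs.τv_lam hs.τv_Lg hm hv w
  have gL := hp.lag_step hc (τ := τ) (I := I) hm hs.τv_pos.le hv w
  -- With the drift of $x$ written as $\eta^2\|z\|^2$ it can be absorbed by the negative term of the
  -- descent inequality.
  rw [norm_x_step_sub_sq c.V w] at gY gV gL
  set q' := step p I c.V τ h t w q
  set W := ‖q'.z‖ ^ 2 with hW
  have hW0 : 0 ≤ W := by positivity
  have hF : p.F q'.x - F₀ ≤ (p.F q.x - F₀) - h.η t / 2 * ‖gradient p.F q.x‖ ^ 2 - h.η t / 4 * W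
      + h.η t * (K * (p.errY q + p.errV q)) + h.η t * p.errZ q' := by
    have : h.η t * (2 * c.KB * (p.errY q + p.errV q))
        ≤ h.η t * (K * (p.errY q + p.errV q)) := by gcongr
    linarith
  have hY : p.errY q' ≤ (1 - h.τy t / K) * p.errY q + K * h.τy t * p.errS q
      + K * h.τy t * q.lag + K * (h.η t ^ 2 * W / h.τy t) := by
    refine gY.trans ?_
    have a1 : h.τy t / K ≤ τ * h.τy t * c.lam / 2 := by
      rw [div_le_iff₀ hK0]
      rw [div_le_iff₀ (by positivity)] at k6
      have := mul_le_mul_of_nonneg_left k6 hty.le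
      linarith
    have a2 : 14 / c.lam * (τ * h.τy t) ≤ K * h.τy t := by
      rw [← mul_assoc]
      gcongr
    have a3 : 14 / c.lam * c.Lgy ^ 2 * (τ * h.τy t) ≤ K * h.τy t := by
      rw [← mul_assoc]
      gcongr
    have a4 : 5 / c.lam * c.Ky ^ 2 * (h.η t ^ 2 * W / (τ * h.τy t))
        ≤ K * (h.η t ^ 2 * W / h.τy t) := by
      have : 5 / c.lam * c.Ky ^ 2 * (h.η t ^ 2 * W / (τ * h.τy t))
        = 5 / c.lam * c.Ky ^ 2 / τ * (h.η t ^ 2 * W / h.τy t) := by field_simp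
      rw [this]
      gcongr
    gcongr
  have hV : p.errV q' ≤ (1 - h.τv t / K) * p.errV q + K * h.τv t * p.errU q
      + K * h.τv t * (q.lag + p.errY q) + K * (h.η t ^ 2 * W / h.τv t) := by
    refine gV.trans ?_
    have a1 : h.τv t / K ≤ h.τv t * c.lam / 2 := by
      rw [div_le_iff₀ hK0]
      rw [div_le_iff₀ (by positivity)] at k7
      have := mul_le_mul_of_nonneg_left k7 htv.le
      linarith
    gcongr
  have hL : q'.lag ≤ h.η t ^ 2 * W + h.τy t ^ 2 * (K * (p.errS q + q.lag + p.errY q))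
      + h.τv t ^ 2 * (K * (p.errU q + (q.lag + p.errY q) + p.errV q)) := by
    refine gL.trans ?_
    have a1 : (τ * h.τy t) ^ 2 * (3 * p.errS q + 3 * c.Lgy ^ 2 * q.lag + 3 * c.Lg ^ 2 * p.errY q)
        ≤ h.τy t ^ 2 * (K * (p.errS q + q.lag + p.errY q)) := by
      rw [mul_comm τ, mul_pow, mul_assoc]
      have b1 : 3 * p.errS q + 3 * c.Lgy ^ 2 * q.lag + 3 * c.Lg ^ 2 * p.errY q
          ≤ (3 + 3 * c.Lgy ^ 2 + 3 * c.Lg ^ 2) * (p.errS q + q.lag + p.errY q) := by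
        have := mul_nonneg (sq_nonneg c.Lgy) hS0
        have := mul_nonneg (sq_nonneg c.Lgy) hY0
        have := mul_nonneg (sq_nonneg c.Lg) hS0
        have := mul_nonneg (sq_nonneg c.Lg) hL0
        linarith
      refine mul_le_mul_of_nonneg_left ?_ (sq_nonneg _)
      refine (mul_le_mul_of_nonneg_left b1 (sq_nonneg τ)).trans ?_
      rw [← mul_assoc]
      gcongr
    have a2 : 4 * p.errU q + 16 * c.KΦ * (q.lag + p.errY q) + 2 * c.Lg ^ 2 * p.errV q
        ≤ K * (p.errU q + (q.lag + p.errY q) + p.errV q) := by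
      have b1 : 4 * p.errU q + 16 * c.KΦ * (q.lag + p.errY q) + 2 * c.Lg ^ 2 * p.errV q
          ≤ (4 + 16 * c.KΦ + 2 * c.Lg ^ 2) * (p.errU q + (q.lag + p.errY q) + p.errV q) := by
        have := mul_nonneg hΦ hU0
        have := mul_nonneg hΦ hV0
        have := mul_nonneg (sq_nonneg c.Lg) hU0
        have := mul_nonneg (sq_nonneg c.Lg) (add_nonneg hL0 hY0)
        linarith
      refine b1.trans ?_
      gcongr
    gcongr
  have := lyap_arith (S' := p.errS q') (U' := p.errU q') hA hY0 hV0 hS0 hU0 hL0 hW0 hη hF hY hV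
    hL hbal.move hbal.Y hbal.V hbal.S hbal.U
    (by have := hbal.L; rw [hLc]; linarith : _ + Lc ≤ A.L)
  unfold Problem.lyap
  linarith
set_option maxHeartbeats 800000 in
/-- Expected decrease of the Lyapunov function in one iteration from a fixed state. -/
theorem Problem.Assumptions.lyap_step (hp : p.Assumptions c) (hc : c.Valid) {I B : ℕ} {τ : ℝ}
    (hτ : 0 < τ) (hI : 1 ≤ I) (hIm : I ≤ m) (hB : 1 ≤ B) {h : Steps} {t : ℕ} (hs : StepOk c τ h t)
    {A : Coeffs} (hA : A.Nonneg) {N F₀ : ℝ} (hbal : Balanced (c.K τ) A m I B h t N)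
    (hF₀ : ∀ x, F₀ ≤ p.F x) {q : State m dx dy} (hv : ∀ i, ‖q.v i‖ ≤ c.V) :
    ∫⁻ w, ENNReal.ofReal (p.F (step p I c.V τ h t w q).x - F₀ + p.lyap A (step p I c.V τ h t w q))
        ∂(iterLaw p I B) + ENNReal.ofReal (h.η t / 2 * ‖gradient p.F q.x‖ ^ 2)
      ≤ ENNReal.ofReal (p.F q.x - F₀ + p.lyap A q) + ENNReal.ofReal N := by
  obtain ⟨k1, k2, k3, k4, -⟩ := hc.K_bounds hτ
  have hm : 1 ≤ m := hI.trans hIm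
  have key := hp.lyap_step_le hc hτ hm hs hA (F₀ := F₀) hbal hv
  set K := c.K τ with hK
  have hK0 : 0 < K := by linarith
  have hS0 := p.errS_nonneg q
  have hU0 := p.errU_nonneg q
  have hZ0 := p.errZ_nonneg q
  have hL0 := q.lag_nonneg
  have hη := hs.η_nonneg
  have hprob := isProbabilityMeasure_iterLaw p hIm B
  set Lc := (A.S + A.U) * K * ((m : ℝ) / I * (selInd m I + 1 / B))
    + (A.Z + h.η t) * K * rho m I B with hLc
  set C₀ := p.F q.x - F₀ + A.S * ((I : ℝ) / m * h.α t) * p.errS q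
    + A.U * ((I : ℝ) / m * h.α' t) * p.errU q + A.Y * p.errY q + A.V * p.errV q
    + (A.L - Lc) * q.lag with hC₀
  obtain ⟨iS, bS⟩ := hp.errS_step (V := c.V) (τ := τ) (q := q) hI hIm hB hs.α_nonneg hs.α_le
  obtain ⟨iU, bU⟩ := hp.errU_step (V := c.V) (τ := τ) (q := q) hc hI hIm hB hs.α'_nonneg hs.α'_le hv
  obtain ⟨iZ, bZ⟩ := hp.errZ_step (V := c.V) (τ := τ) (q := q) hc hI hIm hB hs.β_nonneg hs.β_le hv
  set g := h.η t / 2 * ‖gradient p.F q.x‖ ^ 2 with hg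
  have hg0 : 0 ≤ g := by positivity
  have hΦ0 : ∀ w : IterSample m B Ξ Z, 0 ≤ p.F (step p I c.V τ h t w q).x - F₀
      + p.lyap A (step p I c.V τ h t w q) := fun w =>
    add_nonneg (sub_nonneg.2 (hF₀ _)) (p.lyap_nonneg hA _)
  have hN0 : 0 ≤ N := by
    refine le_trans ?_ hbal.noise
    have := hA.S
    have := hA.U
    have := hA.Z
    have : 0 ≤ rho m I B := by rw [rho_eq]; split_ifs <;> positivity
    positivity
  have hiC := integrable_const C₀ (μ := iterLaw p I B)
  have i1 := hiC.add (iS.const_mul A.S)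
  have i2 := i1.add (iU.const_mul A.U)
  have i3 := i2.add (iZ.const_mul (A.Z + h.η t))
  have hint : Integrable (fun w => C₀ + A.S * p.errS (step p I c.V τ h t w q)
      + A.U * p.errU (step p I c.V τ h t w q)
      + (A.Z + h.η t) * p.errZ (step p I c.V τ h t w q)) (iterLaw p I B) := i3
  have hval : ∫ w, (C₀ + A.S * p.errS (step p I c.V τ h t w q)
      + A.U * p.errU (step p I c.V τ h t w q)
      + (A.Z + h.η t) * p.errZ (step p I c.V τ h t w q)) ∂(iterLaw p I B)
      ≤ p.F q.x - F₀ + p.lyap A q + N := by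
    have v1 := integral_add i2 (iZ.const_mul (A.Z + h.η t))
    have v2 := integral_add i1 (iU.const_mul A.U)
    have v3 := integral_add hiC (iS.const_mul A.S)
    simp only [Pi.add_apply, integral_const_mul, integral_const, probReal_univ, one_smul]
      at v1 v2 v3
    rw [v1, v2, v3]
    have hρ : 0 ≤ rho m I B := by rw [rho_eq]; split_ifs <;> positivity
    have hsel := selInd_nonneg m I
    have eS : ∫ w, p.errS (step p I c.V τ h t w q) ∂(iterLaw p I B)
      ≤ (1 - (I : ℝ) / m * h.α t) * p.errS q + K * ((I : ℝ) / m * h.α t ^ 2 / B)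
        + K * ((m : ℝ) / I * (selInd m I + 1 / B) * q.lag) := bS.trans (by gcongr)
    have eU : ∫ w, p.errU (step p I c.V τ h t w q) ∂(iterLaw p I B)
      ≤ (1 - (I : ℝ) / m * h.α' t) * p.errU q + K * ((I : ℝ) / m * h.α' t ^ 2 / B)
        + K * ((m : ℝ) / I * (selInd m I + 1 / B) * q.lag) := bU.trans (by gcongr)
    have eZ : ∫ w, p.errZ (step p I c.V τ h t w q) ∂(iterLaw p I B)
      ≤ (1 - h.β t) * p.errZ q + K * (h.β t ^ 2 * rho m I B)
        + K * (rho m I B * q.lag) := bZ.trans (by gcongr)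
    have m1 := mul_le_mul_of_nonneg_left eS hA.S
    have m2 := mul_le_mul_of_nonneg_left eU hA.U
    have m3 := mul_le_mul_of_nonneg_left eZ (add_nonneg hA.Z hη)
    -- Since $\eta\le A_Z\beta$, one has $(A_Z+\eta)(1-\beta)\le A_Z$: the momentum pays for the
    -- error of `z` in the descent.
    have m4 := mul_le_mul_of_nonneg_right hbal.Z hZ0
    have m5 : 0 ≤ h.η t * h.β t * p.errZ q := by have := hs.β_nonneg; positivity
    have m6 := hbal.noise
    rw [hC₀, hLc]
    unfold Problem.lyap
    linarith
  -- Integrability is at hand only for the three estimator errors. The rest is dominated pointwise,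
  -- so the new Lyapunov value is handled as a lower integral and compared with an integrable
  -- majorant.
  have hconst : ∫⁻ _w, ENNReal.ofReal g ∂(iterLaw p I B) = ENNReal.ofReal g := by simp
  rw [← hconst, ← lintegral_add_right _ measurable_const]
  refine (lintegral_mono fun w => ?_ : _ ≤ ∫⁻ w, ENNReal.ofReal (C₀
    + A.S * p.errS (step p I c.V τ h t w q) + A.U * p.errU (step p I c.V τ h t w q)
    + (A.Z + h.η t) * p.errZ (step p I c.V τ h t w q)) ∂(iterLaw p I B)).trans ?_
  · rw [← ENNReal.ofReal_add (hΦ0 w) hg0]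
    exact ENNReal.ofReal_le_ofReal (key w)
  · rw [← ofReal_integral_eq_lintegral_ofReal hint
      (Filter.Eventually.of_forall fun w => (add_nonneg (hΦ0 w) hg0).trans (key w)),
      ← ENNReal.ofReal_add (add_nonneg (sub_nonneg.2 (hF₀ _)) (p.lyap_nonneg hA _)) hN0]
    exact ENNReal.ofReal_le_ofReal hval

end BSVRB

namespace BSVRB

variable {m dx : ℕ} {dy : Fin m → ℕ} {Ξ Z : Type*} [MeasurableSpace Ξ] [MeasurableSpace Z]
  {p : Problem m dx dy Ξ Z} {c : Consts}

/-! ### Measurability -/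

/-- The components of a state. -/
def State.toProd (q : State m dx dy) :
    (E dx × E dx) × (((i : Fin m) → E (dy i)) × ((i : Fin m) → E (dy i)))
      × (((i : Fin m) → E (dy i)) × ((i : Fin m) → E (dy i)))
      × (((i : Fin m) → E (dy i)) × ((i : Fin m) → E (dy i))) × E dx :=
  ((q.x, q.xPrev), (q.y, q.yPrev), (q.v, q.vPrev), (q.s, q.u), q.z)

/-- The $\sigma$-algebra is pulled back from the product of the components, so a map into states is
measurable exactly when its components are. -/
instance : MeasurableSpace (State m dx dy) := MeasurableSpace.comap State.toProd inferInstance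

namespace State

theorem measurable_toProd : Measurable (State.toProd (m := m) (dx := dx) (dy := dy)) :=
  comap_measurable _

theorem measurable_x : Measurable fun q : State m dx dy => q.x :=
  measurable_toProd.fst.fst

theorem measurable_xPrev : Measurable fun q : State m dx dy => q.xPrev :=
  measurable_toProd.fst.snd

theorem measurable_y (i : Fin m) : Measurable fun q : State m dx dy => q.y i :=
  (measurable_pi_apply i).comp measurable_toProd.snd.fst.fst

theorem measurable_yPrev (i : Fin m) : Measurable fun q : State m dx dy => q.yPrev i :=
  (measurable_pi_apply i).comp measurable_toProd.snd.fst.snd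

theorem measurable_v (i : Fin m) : Measurable fun q : State m dx dy => q.v i :=
  (measurable_pi_apply i).comp measurable_toProd.snd.snd.fst.fst

theorem measurable_vPrev (i : Fin m) : Measurable fun q : State m dx dy => q.vPrev i :=
  (measurable_pi_apply i).comp measurable_toProd.snd.snd.fst.snd

theorem measurable_s (i : Fin m) : Measurable fun q : State m dx dy => q.s i :=
  (measurable_pi_apply i).comp measurable_toProd.snd.snd.snd.fst.fst

theorem measurable_u (i : Fin m) : Measurable fun q : State m dx dy => q.u i :=
  (measurable_pi_apply i).comp measurable_toProd.snd.snd.snd.fst.snd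

theorem measurable_z : Measurable fun q : State m dx dy => q.z :=
  measurable_toProd.snd.snd.snd.snd

theorem measurable_of {T : Type*} [MeasurableSpace T] {f : T → State m dx dy}
    (hx : Measurable fun t => (f t).x) (hx' : Measurable fun t => (f t).xPrev)
    (hy : ∀ i, Measurable fun t => (f t).y i) (hy' : ∀ i, Measurable fun t => (f t).yPrev i)
    (hv : ∀ i, Measurable fun t => (f t).v i) (hv' : ∀ i, Measurable fun t => (f t).vPrev i)
    (hs : ∀ i, Measurable fun t => (f t).s i) (hu : ∀ i, Measurable fun t => (f t).u i)
    (hz : Measurable fun t => (f t).z) : Measurable f := by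
  rw [measurable_comap_iff]
  exact (hx.prodMk hx').prodMk (((measurable_pi_lambda _ hy).prodMk
    (measurable_pi_lambda _ hy')).prodMk (((measurable_pi_lambda _ hv).prodMk
    (measurable_pi_lambda _ hv')).prodMk (((measurable_pi_lambda _ hs).prodMk
    (measurable_pi_lambda _ hu)).prodMk hz)))

end State

theorem measurable_projBall {n : ℕ} (V : ℝ) : Measurable (projBall V : E n → E n) := by
  unfold projBall
  refine Measurable.ite (measurableSet_le measurable_norm measurable_const) measurable_id ?_
  exact (measurable_const.div measurable_norm).smul measurable_id

/-- Carathéodory argument: continuity in the parameter and measurability in the sample give joint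
measurability, needed because a random sample is evaluated at a random iterate. -/
theorem measurable_batchMean {S ι T : Type*} [MeasurableSpace S] [TopologicalSpace ι]
    [TopologicalSpace.MetrizableSpace ι] [MeasurableSpace ι] [SecondCountableTopology ι]
    [OpensMeasurableSpace ι] [MeasurableSpace T] {d n : ℕ} {φ : S → ι → E d}
    (hc : ∀ s, Continuous (φ s)) (hm : ∀ j, StronglyMeasurable fun s => φ s j)
    {b : T → Fin n → S} {j : T → ι} (hb : Measurable b) (hj : Measurable j) :
    Measurable fun t => batchMean (fun s => φ s (j t)) (b t) := by
  have h : Measurable (Function.uncurry fun (j : ι) (s : S) => φ s j) :=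
    measurable_uncurry_of_continuous_of_measurable hc fun j => (hm j).measurable
  have hsum : Measurable fun t => ∑ k, φ (b t k) (j t) :=
    Finset.measurable_fun_sum _ fun k _ => h.comp (hj.prodMk ((measurable_pi_apply k).comp hb))
  exact hsum.const_smul ((n : ℝ)⁻¹)

theorem measurable_smul_fun {T : Type*} [MeasurableSpace T] {d : ℕ} {f : T → E d}
    (hf : Measurable f) (r : ℝ) : Measurable fun t => r • f t :=
  hf.const_smul r

theorem measurable_sub_fun {T : Type*} [MeasurableSpace T] {d : ℕ} {f g : T → E d}
    (hf : Measurable f) (hg : Measurable g) : Measurable fun t => f t - g t :=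
  hf.sub hg

theorem measurable_add_fun {T : Type*} [MeasurableSpace T] {d : ℕ} {f g : T → E d}
    (hf : Measurable f) (hg : Measurable g) : Measurable fun t => f t + g t :=
  hf.add hg

section Hat

variable (hp : p.Assumptions c) (hc : c.Valid) {T : Type*} [MeasurableSpace T] {n : ℕ}
  {b : T → Batches m n Ξ Z} (hb : Measurable b) (i : Fin m) {x : T → E dx} {y v : T → E (dy i)}
  (hx : Measurable x) (hy : Measurable y) (hv : Measurable v)
include hp hc hb hx hy

theorem measurable_gradGHat : Measurable fun t => gradGHat p (b t) i (x t) (y t) := by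
  have := measurable_batchMean (ι := E dx × E (dy i)) (T := T) (d := dy i) (n := n)
    (φ := fun ζ q => gradY (p.g i ζ) q.1 q.2) (b := fun t => (b t).2 i)
    (j := fun t => (x t, y t)) (fun ζ => (hp.lip_gy i ζ).continuous hc.Lgy_nonneg)
    (fun q => (hp.var_gy i q.1 q.2).stronglyMeasurable)
    ((measurable_pi_apply i).comp hb.snd) (hx.prodMk hy)
  exact this

include hv

theorem measurable_gradPhiHat : Measurable fun t => gradPhiHat p (b t) i (v t) (x t) (y t) := by
  have h1 := measurable_batchMean (ι := (E dx × E (dy i)) × E (dy i)) (T := T) (d := dy i) (n := n)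
    (φ := fun ζ q => hessYY (p.g i ζ) q.1.1 q.1.2 q.2) (b := fun t => (b t).2 i)
    (j := fun t => ((x t, y t), v t))
    (fun ζ => (((hp.lip_gyy i ζ).continuous hc.Lgyy_nonneg).comp continuous_fst).clm_apply
        continuous_snd)
    (fun q => (ContinuousLinearMap.apply ℝ (E (dy i)) q.2).continuous.comp_stronglyMeasurable
      (hp.var_gyy i q.1.1 q.1.2).stronglyMeasurable)
    ((measurable_pi_apply i).comp hb.snd) ((hx.prodMk hy).prodMk hv)
  have h2 := measurable_batchMean (ι := E dx × E (dy i)) (T := T) (d := dy i) (n := n)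
    (φ := fun ξ q => gradY (p.f i ξ) q.1 q.2) (b := fun t => (b t).1 i)
    (j := fun t => (x t, y t)) (fun ξ => (hp.lip_fy i ξ).continuous hc.Lfy_nonneg)
    (fun q => (hp.var_fy i q.1 q.2).stronglyMeasurable)
    ((measurable_pi_apply i).comp hb.fst) (hx.prodMk hy)
  unfold gradPhiHat
  simp_rw [batchMean_apply]
  exact h1.sub h2

theorem measurable_blockHat : Measurable fun t => blockHat p (b t) i (x t) (y t) (v t) := by
  have h1 := measurable_batchMean (ι := (E dx × E (dy i)) × E (dy i)) (T := T) (d := dx) (n := n)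
    (φ := fun ζ q => hessXY (p.g i ζ) q.1.1 q.1.2 q.2) (b := fun t => (b t).2 i)
    (j := fun t => ((x t, y t), v t))
    (fun ζ => (((hp.lip_gxy i ζ).continuous hc.Lgxy_nonneg).comp continuous_fst).clm_apply
        continuous_snd)
    (fun q => (ContinuousLinearMap.apply ℝ (E dx) q.2).continuous.comp_stronglyMeasurable
      (hp.var_gxy i q.1.1 q.1.2).stronglyMeasurable)
    ((measurable_pi_apply i).comp hb.snd) ((hx.prodMk hy).prodMk hv)
  have h2 := measurable_batchMean (ι := E dx × E (dy i)) (T := T) (d := dx) (n := n)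
    (φ := fun ξ q => gradX (p.f i ξ) q.1 q.2) (b := fun t => (b t).1 i)
    (j := fun t => (x t, y t)) (fun ξ => (hp.lip_fx i ξ).continuous hc.Lfx_nonneg)
    (fun q => (hp.var_fx i q.1 q.2).stronglyMeasurable)
    ((measurable_pi_apply i).comp hb.fst) (hx.prodMk hy)
  unfold blockHat
  simp_rw [batchMean_apply]
  exact h2.sub h1

end Hat

/-- The index set of the sum is random. Summing over all blocks with indicators leaves finitely many
measurable events. -/
theorem measurable_hyperGradHat (hp : p.Assumptions c) (hc : c.Valid) {T : Type*}
    [MeasurableSpace T] {n : ℕ} {b : T → Batches m n Ξ Z} (hb : Measurable b)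
    {A : T → Finset (Fin m)} (hA : Measurable A) {x : T → E dx}
    {y v : T → (i : Fin m) → E (dy i)} (hx : Measurable x)
    (hy : ∀ i, Measurable fun t => y t i) (hv : ∀ i, Measurable fun t => v t i) :
    Measurable fun t => hyperGradHat p (b t) (A t) (x t) (y t) (v t) := by
  have e : (fun t => hyperGradHat p (b t) (A t) (x t) (y t) (v t))
      = fun t => (#(A t) : ℝ)⁻¹ • ∑ i, if i ∈ A t then blockHat p (b t) i (x t) (y t i) (v t i)
        else 0 := by
    funext t
    rw [sum_ite_mem, univ_inter]
    rfl
  rw [e]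
  have hsum : Measurable fun t => ∑ i, if i ∈ A t then blockHat p (b t) i (x t) (y t i) (v t i)
      else 0 :=
    Finset.measurable_fun_sum _ fun i _ =>
      Measurable.ite (hA (Set.toFinite {A : Finset (Fin m) | i ∈ A}).measurableSet)
        (measurable_blockHat hp hc hb i hx (hy i) (hv i)) measurable_const
  exact ((measurable_of_finite fun A : Finset (Fin m) => (#A : ℝ)⁻¹).comp hA).smul hsum

theorem measurable_step (hp : p.Assumptions c) (hc : c.Valid) (I : ℕ) {B : ℕ} (V τ : ℝ)
    (h : Steps) (t : ℕ) :
    Measurable fun a : State m dx dy × IterSample m B Ξ Z => step p I V τ h t a.2 a.1 := by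
  have hb : Measurable fun a : State m dx dy × IterSample m B Ξ Z => a.2.2 :=
    measurable_snd.comp measurable_snd
  have hA : Measurable fun a : State m dx dy × IterSample m B Ξ Z => a.2.1 :=
    measurable_fst.comp measurable_snd
  have hmem : ∀ i, MeasurableSet {a : State m dx dy × IterSample m B Ξ Z | i ∈ a.2.1} :=
    fun i => hA (Set.toFinite {A : Finset (Fin m) | i ∈ A}).measurableSet
  have hx : Measurable fun a : State m dx dy × IterSample m B Ξ Z => a.1.x :=
    State.measurable_x.comp measurable_fst
  have hx' : Measurable fun a : State m dx dy × IterSample m B Ξ Z => a.1.xPrev :=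
    State.measurable_xPrev.comp measurable_fst
  have hy : ∀ i, Measurable fun a : State m dx dy × IterSample m B Ξ Z => a.1.y i :=
    fun i => (State.measurable_y i).comp measurable_fst
  have hy' : ∀ i, Measurable fun a : State m dx dy × IterSample m B Ξ Z => a.1.yPrev i :=
    fun i => (State.measurable_yPrev i).comp measurable_fst
  have hv : ∀ i, Measurable fun a : State m dx dy × IterSample m B Ξ Z => a.1.v i :=
    fun i => (State.measurable_v i).comp measurable_fst
  have hv' : ∀ i, Measurable fun a : State m dx dy × IterSample m B Ξ Z => a.1.vPrev i :=
    fun i => (State.measurable_vPrev i).comp measurable_fst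
  have hs : ∀ i, Measurable fun a : State m dx dy × IterSample m B Ξ Z => a.1.s i :=
    fun i => (State.measurable_s i).comp measurable_fst
  have hu : ∀ i, Measurable fun a : State m dx dy × IterSample m B Ξ Z => a.1.u i :=
    fun i => (State.measurable_u i).comp measurable_fst
  have hz : Measurable fun a : State m dx dy × IterSample m B Ξ Z => a.1.z :=
    State.measurable_z.comp measurable_fst
  have hz' : Measurable fun a : State m dx dy × IterSample m B Ξ Z =>
      (step p I V τ h t a.2 a.1).z :=
    measurable_add_fun (measurable_smul_fun (measurable_sub_fun hz
      (measurable_hyperGradHat hp hc hb hA hx' hy' hv')) (1 - h.β t))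
      (measurable_hyperGradHat hp hc hb hA hx hy hv)
  have hs' : ∀ i, Measurable fun a : State m dx dy × IterSample m B Ξ Z =>
      (step p I V τ h t a.2 a.1).s i := fun i => by
    have h1 := measurable_gradGHat hp hc hb i hx (hy i)
    have h0 := measurable_gradGHat hp hc hb i hx' (hy' i)
    exact Measurable.ite (hmem i) (measurable_add_fun (measurable_add_fun
      (measurable_smul_fun (hs i) (1 - h.α t)) (measurable_smul_fun h1 (h.α t)))
      (measurable_smul_fun (measurable_sub_fun h1 h0) (gam m I (h.α t)))) (hs i)
  have hu' : ∀ i, Measurable fun a : State m dx dy × IterSample m B Ξ Z =>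
      (step p I V τ h t a.2 a.1).u i := fun i => by
    have h1 := measurable_gradPhiHat hp hc hb i hx (hy i) (hv i)
    have h0 := measurable_gradPhiHat hp hc hb i hx' (hy' i) (hv' i)
    exact Measurable.ite (hmem i) (measurable_add_fun (measurable_add_fun
      (measurable_smul_fun (hu i) (1 - h.α' t)) (measurable_smul_fun h1 (h.α' t)))
      (measurable_smul_fun (measurable_sub_fun h1 h0) (gam m I (h.α' t)))) (hu i)
  exact State.measurable_of (measurable_sub_fun hx (measurable_smul_fun hz' (h.η t))) hx
    (fun i => measurable_sub_fun (hy i) (measurable_smul_fun (hs i) (τ * h.τy t))) hy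
    (fun i => (measurable_projBall V).comp
      (measurable_sub_fun (hv i) (measurable_smul_fun (hu i) (h.τv t)))) hv hs' hu' hz'

theorem measurable_initState (hp : p.Assumptions c) (hc : c.Valid) {S : ℕ} (x₁ : E dx)
    (y₁ v₁ : (i : Fin m) → E (dy i)) :
    Measurable fun b : Batches m S Ξ Z => initState p b x₁ y₁ v₁ :=
  State.measurable_of measurable_const measurable_const (fun _ => measurable_const)
    (fun _ => measurable_const) (fun _ => measurable_const) (fun _ => measurable_const)
    (fun i => measurable_gradGHat hp hc measurable_id i measurable_const measurable_const)
    (fun i => measurable_gradPhiHat hp hc measurable_id i measurable_const measurable_const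
      measurable_const)
    (measurable_hyperGradHat hp hc measurable_id measurable_const measurable_const
      (fun _ => measurable_const) (fun _ => measurable_const))

theorem measurable_average {T : Type*} [MeasurableSpace T] {φ : Fin m → T → ℝ}
    (hφ : ∀ i, Measurable (φ i)) : Measurable fun t => (m : ℝ)⁻¹ * ∑ i, φ i t :=
  (Finset.measurable_fun_sum univ fun i _ => hφ i).const_mul _

section Errors

variable (hp : p.Assumptions c) (hc : c.Valid)
include hp hc

theorem continuous_ySol (i : Fin m) : Continuous fun x => p.ySol i x :=
  (LipschitzWith.of_dist_le_mul (K := c.Ky.toNNReal) fun x x' => by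
    rw [Real.coe_toNNReal _ hc.Ky_nonneg, dist_eq_norm, dist_eq_norm]
    exact hp.norm_ySol_sub_le hc i x x').continuous

theorem continuous_vSol (i : Fin m) : Continuous fun x => p.vSol i x :=
  (LipschitzWith.of_dist_le_mul (K := c.Kv.toNNReal) fun x x' => by
    rw [Real.coe_toNNReal _ hc.Kv_nonneg, dist_eq_norm, dist_eq_norm]
    exact hp.norm_vSol_sub_le hc i x x').continuous

theorem continuous_gradient_F : Continuous fun x => gradient p.F x :=
  (LipschitzWith.of_dist_le_mul (K := c.KF.toNNReal) fun x x' => by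
    rw [Real.coe_toNNReal _ hc.KF_nonneg, dist_eq_norm, dist_eq_norm]
    exact hp.norm_gradient_F_sub_le hc x x').continuous

theorem continuous_gradPhi (i : Fin m) :
    Continuous fun a : (E dx × E (dy i)) × E (dy i) => p.gradPhi i a.2 a.1.1 a.1.2 :=
  ((((hp.lip_hessYY_gbar i).continuous hc.Lgyy_nonneg).comp continuous_fst).clm_apply
    continuous_snd).sub (((hp.lip_gradY_fbar i).continuous hc.Lfy_nonneg).comp continuous_fst)

theorem continuous_block (i : Fin m) :
    Continuous fun a : (E dx × E (dy i)) × E (dy i) => p.block i a.1.1 a.1.2 a.2 :=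
  (((hp.lip_gradX_fbar i).continuous hc.Lfx_nonneg).comp continuous_fst).sub
    ((((hp.lip_hessXY_gbar i).continuous hc.Lgxy_nonneg).comp continuous_fst).clm_apply
      continuous_snd)

theorem measurable_errS : Measurable fun q : State m dx dy => p.errS q := by
  unfold Problem.errS
  refine measurable_average fun i => ?_
  have h1 : Measurable fun q : State m dx dy => gradY (p.gbar i) q.xPrev (q.yPrev i) :=
    ((hp.lip_gradY_gbar i).continuous hc.Lgy_nonneg).measurable.comp
      (State.measurable_xPrev.prodMk (State.measurable_yPrev i))
  exact ((State.measurable_s i).sub h1).norm.pow_const 2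

omit hp hc in
theorem measurable_prev (i : Fin m) : Measurable fun q : State m dx dy =>
    ((q.xPrev, q.yPrev i), q.vPrev i) :=
  (State.measurable_xPrev.prodMk (State.measurable_yPrev i)).prodMk (State.measurable_vPrev i)

theorem measurable_errU : Measurable fun q : State m dx dy => p.errU q := by
  unfold Problem.errU
  refine measurable_average fun i => ?_
  have h1 := (continuous_gradPhi hp hc i).measurable.comp (measurable_prev i)
  exact (measurable_sub_fun (State.measurable_u i) h1).norm.pow_const 2

theorem measurable_errZ : Measurable fun q : State m dx dy => p.errZ q := by
  have h1 := fun i => (continuous_block hp hc i).measurable.comp (measurable_prev i)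
  have h2 := Finset.measurable_fun_sum univ fun i _ => h1 i
  exact (measurable_sub_fun State.measurable_z (measurable_smul_fun h2 (m : ℝ)⁻¹)).norm.pow_const 2

theorem measurable_errY : Measurable fun q : State m dx dy => p.errY q := by
  unfold Problem.errY
  refine measurable_average fun i => ?_
  have h1 : Measurable fun q : State m dx dy => p.ySol i q.x :=
    (continuous_ySol hp hc i).measurable.comp State.measurable_x
  exact ((State.measurable_y i).sub h1).norm.pow_const 2

theorem measurable_errV : Measurable fun q : State m dx dy => p.errV q := by
  unfold Problem.errV
  refine measurable_average fun i => ?_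
  have h1 : Measurable fun q : State m dx dy => p.vSol i q.x :=
    (continuous_vSol hp hc i).measurable.comp State.measurable_x
  exact ((State.measurable_v i).sub h1).norm.pow_const 2

omit hp hc in
theorem measurable_lag : Measurable fun q : State m dx dy => q.lag := by
  unfold State.lag State.moveSq
  refine measurable_average fun i => ?_
  exact (((State.measurable_x.sub State.measurable_xPrev).norm.pow_const 2).add
    (((State.measurable_y i).sub (State.measurable_yPrev i)).norm.pow_const 2)).add
      (((State.measurable_v i).sub (State.measurable_vPrev i)).norm.pow_const 2)

theorem measurable_lyap (A : Coeffs) : Measurable fun q : State m dx dy => p.lyap A q := by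
  unfold Problem.lyap
  exact ((((((measurable_errS hp hc).const_mul _).add ((measurable_errU hp hc).const_mul _)).add
    ((measurable_errZ hp hc).const_mul _)).add ((measurable_errY hp hc).const_mul _)).add
    ((measurable_errV hp hc).const_mul _)).add (measurable_lag.const_mul _)

theorem measurable_objective_add_lyap (A : Coeffs) (F₀ : ℝ) :
    Measurable fun q : State m dx dy => p.F q.x - F₀ + p.lyap A q :=
  (((hp.differentiable_F hc).continuous.measurable.comp State.measurable_x).sub
    measurable_const).add (measurable_lyap hp hc A)

end Errors

/-! ### Independence of the state and the next sample -/

section Independence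

variable {Ω : Type*} [MeasurableSpace Ω] {μ : Measure Ω} [IsProbabilityMeasure μ]

/-- The hypotheses make the law of $(X,(Y,W))$ a product of three laws; reassociating it gives the
independence of $(X,Y)$ and $W$. -/
theorem indepFun_prodMk_left_of_indepFun {α β γ : Type*} [MeasurableSpace α] [MeasurableSpace β]
    [MeasurableSpace γ] {X : Ω → α} {Y : Ω → β} {W : Ω → γ} (hX : Measurable X)
    (hY : Measurable Y) (hW : Measurable W) (h : IndepFun X (fun ω => (Y ω, W ω)) μ)
    (h' : IndepFun Y W μ) : IndepFun (fun ω => (X ω, Y ω)) W μ := by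
  have h1 := (indepFun_iff_map_prod_eq_prod_map_map hX.aemeasurable
    (hY.prodMk hW).aemeasurable).1 h
  have h2 := (indepFun_iff_map_prod_eq_prod_map_map hY.aemeasurable hW.aemeasurable).1 h'
  have h3 := (indepFun_iff_map_prod_eq_prod_map_map hX.aemeasurable hY.aemeasurable).1
    (h.comp measurable_id measurable_fst : IndepFun (id ∘ X) (Prod.fst ∘ fun ω => (Y ω, W ω)) μ)
  have : IsProbabilityMeasure (μ.map X) := Measure.isProbabilityMeasure_map hX.aemeasurable
  have : IsProbabilityMeasure (μ.map Y) := Measure.isProbabilityMeasure_map hY.aemeasurable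
  have : IsProbabilityMeasure (μ.map W) := Measure.isProbabilityMeasure_map hW.aemeasurable
  rw [indepFun_iff_map_prod_eq_prod_map_map (hX.prodMk hY).aemeasurable hW.aemeasurable]
  rw [h2, ← Measure.prodAssoc_prod] at h1
  change μ.map (fun ω => (X ω, Y ω)) = _ at h3
  have h4 := congrArg (Measure.map (MeasurableEquiv.prodAssoc (α := α) (β := β) (γ := γ)).symm) h1
  rw [Measure.map_map (MeasurableEquiv.measurable _) (hX.prodMk (hY.prodMk hW)),
    MeasurableEquiv.map_symm_map] at h4
  rw [h3]
  exact h4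

variable {I B S : ℕ} {init : Ω → Batches m S Ξ Z} {smp : ℕ → Ω → IterSample m B Ξ Z} {V τ : ℝ}
  {h : Steps} {x₁ : E dx} {y₁ v₁ : (i : Fin m) → E (dy i)}

omit [MeasurableSpace Ω] in
-- The state before iteration $t$ depends only on the initial batch and the samples with index below
-- $t$. With a measurable dependence, this yields independence of the sample $t$.
theorem exists_run_eq (hp : p.Assumptions c) (hc : c.Valid) (t : ℕ) :
    ∃ R : Batches m S Ξ Z × ((i : Finset.range t) → IterSample m B Ξ Z) → State m dx dy,
      Measurable R ∧ ∀ ω, run p I V τ h x₁ y₁ v₁ init smp t ω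
        = R (init ω, fun i => smp i ω) := by
  induction t with
  | zero =>
    exact ⟨fun a => initState p a.1 x₁ y₁ v₁,
      (measurable_initState hp hc x₁ y₁ v₁).comp measurable_fst, fun ω => rfl⟩
  | succ t ih =>
    obtain ⟨R, hR, hR'⟩ := ih
    refine ⟨fun a => step p I V τ h t (a.2 ⟨t, by simp⟩)
      (R (a.1, fun i => a.2 ⟨i, by have := Finset.mem_range.1 i.2; simp; omega⟩)), ?_, fun ω => ?_⟩
    · refine (measurable_step hp hc I V τ h t).comp (Measurable.prodMk (hR.comp ?_) ?_)
      · refine measurable_fst.prodMk (measurable_pi_lambda _ fun i => ?_)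
        exact (measurable_pi_apply _).comp measurable_snd
      · exact (measurable_pi_apply _).comp measurable_snd
    · change step p I V τ h t (smp t ω) (run p I V τ h x₁ y₁ v₁ init smp t ω) = _
      rw [hR']

omit [IsProbabilityMeasure μ] in
theorem measurable_run (hp : p.Assumptions c) (hc : c.Valid)
    (hS : IsSampling p I B S μ init smp) (t : ℕ) :
    Measurable (run p I V τ h x₁ y₁ v₁ init smp t) := by
  obtain ⟨R, hR, hR'⟩ := exists_run_eq (p := p) (I := I) (V := V) (τ := τ) (h := h) (x₁ := x₁)
    (y₁ := y₁) (v₁ := v₁) (init := init) (smp := smp) hp hc t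
  rw [funext hR']
  exact hR.comp (hS.init_measurable.prodMk (measurable_pi_lambda _ fun i => hS.smp_measurable i))

theorem indepFun_run_smp (hp : p.Assumptions c) (hc : c.Valid)
    (hS : IsSampling p I B S μ init smp) (t : ℕ) :
    IndepFun (run p I V τ h x₁ y₁ v₁ init smp t) (smp t) μ := by
  obtain ⟨R, hR, hR'⟩ := exists_run_eq (p := p) (I := I) (V := V) (τ := τ) (h := h) (x₁ := x₁)
    (y₁ := y₁) (v₁ := v₁) (init := init) (smp := smp) hp hc t
  have h1 : IndepFun (fun ω (i : Finset.range t) => smp i ω) (smp t) μ := by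
    have := (hS.smp_indep.indepFun_finset (Finset.range t) {t}
      (by simp) hS.smp_measurable).comp
      (measurable_id (α := (i : Finset.range t) → IterSample m B Ξ Z))
      (measurable_pi_apply (⟨t, by simp⟩ : ({t} : Finset ℕ)))
    exact this
  have h2 : IndepFun init (fun ω => ((fun (i : Finset.range t) => smp i ω), smp t ω)) μ := by
    have hm : Measurable fun s : ℕ → IterSample m B Ξ Z =>
        ((fun (i : Finset.range t) => s i), s t) :=
      (measurable_pi_lambda _ fun i => measurable_pi_apply _).prodMk (measurable_pi_apply t)
    exact hS.init_indep.comp measurable_id hm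
  have h3 := indepFun_prodMk_left_of_indepFun (Y := fun ω (i : Finset.range t) => smp i ω)
    hS.init_measurable (measurable_pi_lambda _ fun i => hS.smp_measurable i) (hS.smp_measurable t) h2 h1
  rw [funext hR']
  exact h3.comp hR measurable_id

/-- The Markov property: the joint law of the state and the next sample is a product, so Tonelli
applies. With nonnegative integrands no integrability is required. -/
theorem lintegral_run_succ (hp : p.Assumptions c) (hc : c.Valid) (hIm : I ≤ m)
    (hS : IsSampling p I B S μ init smp) (t : ℕ) {φ : State m dx dy → ENNReal}
    (hφ : Measurable φ) :
    ∫⁻ ω, φ (run p I V τ h x₁ y₁ v₁ init smp (t + 1) ω) ∂μ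
      = ∫⁻ ω, ∫⁻ w, φ (step p I V τ h t w (run p I V τ h x₁ y₁ v₁ init smp t ω)) ∂(iterLaw p I B)
        ∂μ := by
  have hprob := isProbabilityMeasure_iterLaw p hIm B
  have hr := measurable_run (V := V) (τ := τ) (h := h) (x₁ := x₁) (y₁ := y₁) (v₁ := v₁) hp hc hS t
  have h1 := (indepFun_iff_map_prod_eq_prod_map_map hr.aemeasurable
    (hS.smp_measurable t).aemeasurable).1 (indepFun_run_smp hp hc hS t)
  rw [hS.smp_law t] at h1
  have hψ : Measurable fun a : State m dx dy × IterSample m B Ξ Z =>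
      φ (step p I V τ h t a.2 a.1) := hφ.comp (measurable_step hp hc I V τ h t)
  have h2 := lintegral_map (μ := μ) hψ (hr.prodMk (hS.smp_measurable t))
  rw [h1, lintegral_prod _ hψ.aemeasurable, lintegral_map hψ.lintegral_prod_right' hr] at h2
  exact h2.symm

omit [MeasurableSpace Ω] in
theorem norm_run_v_le (hV : 0 ≤ V) (hv : ∀ i, ‖v₁ i‖ ≤ V) (t : ℕ) (ω : Ω) (i : Fin m) :
    ‖(run p I V τ h x₁ y₁ v₁ init smp t ω).v i‖ ≤ V := by
  cases t with
  | zero => exact hv i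
  | succ t => exact norm_projBall_le hV _

end Independence

end BSVRB

namespace BSVRB

variable {m dx : ℕ} {dy : Fin m → ℕ} {Ξ Z : Type*} [MeasurableSpace Ξ] [MeasurableSpace Z]
  {p : Problem m dx dy Ξ Z} {c : Consts}

/-! ### Telescoping the one-iteration estimates -/

theorem integrable_average_integral_le {S : Type*} [MeasurableSpace S] {ν : Measure S} (hm : 1 ≤ m)
    {φ : Fin m → S → ℝ} {w : ℝ} (hi : ∀ i, Integrable (φ i) ν) (h : ∀ i, ∫ s, φ i s ∂ν ≤ w) :
    Integrable (fun s => (m : ℝ)⁻¹ * ∑ i, φ i s) ν ∧ ∫ s, (m : ℝ)⁻¹ * ∑ i, φ i s ∂ν ≤ w := by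
  have hm' : (0 : ℝ) < m := by exact_mod_cast hm
  refine ⟨(integrable_finsetSum univ fun i _ => hi i).const_mul _, ?_⟩
  rw [integral_const_mul, integral_finsetSum univ fun i _ => hi i]
  refine (mul_le_mul_of_nonneg_left (sum_le_sum fun i _ => h i) (by positivity)).trans
    (le_of_eq ?_)
  rw [sum_const, card_univ, Fintype.card_fin, nsmul_eq_mul]
  field_simp

/-- The initial lag is zero because $x_0=x_1$, $y_0=y_1$, $v_0=v_1$. The three estimators have
variance $O(1/S)$, and $v_{i,1}$ and $v_i(x_1)$ lie in the same ball of radius $V$. -/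
theorem Problem.Assumptions.lyap_init (hp : p.Assumptions c) (hc : c.Valid) {τ : ℝ} (hτ : 0 < τ)
    (hm : 1 ≤ m) {S : ℕ} (hS : 1 ≤ S) {A : Coeffs} (hA : A.Nonneg) {F₀ Dy : ℝ} {x₁ : E dx}
    {y₁ v₁ : (i : Fin m) → E (dy i)} (hF₀ : F₀ ≤ p.F x₁)
    (hy : ∑ i, ‖y₁ i - p.ySol i x₁‖ ^ 2 ≤ Dy * m) (hv : ∀ i, ‖v₁ i‖ ≤ c.V) :
    ∫⁻ b, ENNReal.ofReal (p.F x₁ - F₀ + p.lyap A (initState p b x₁ y₁ v₁)) ∂(batchesLaw p S)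
      ≤ ENNReal.ofReal (p.F x₁ - F₀ + (A.S + A.U + A.Z) * c.K τ / S + A.Y * Dy
        + A.V * (4 * c.V ^ 2)) := by
  obtain ⟨k1, k2, k3, -⟩ := hc.K_bounds hτ
  have hm' : (0 : ℝ) < m := by exact_mod_cast hm
  have hS' : (0 : ℝ) < S := by exact_mod_cast hS
  have hKS : c.σ ^ 2 / S ≤ c.K τ / S := by
    gcongr
    refine le_trans ?_ k2
    unfold Consts.KS
    nlinarith [sq_nonneg c.σ, sq_nonneg c.Lgy]
  have hKU : 2 * c.σ ^ 2 * (1 + c.V ^ 2) / S ≤ c.K τ / S := by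
    gcongr
    refine le_trans ?_ k3
    have := c.KΦ_nonneg
    have : 0 ≤ c.σ ^ 2 * (1 + c.V ^ 2) := by positivity
    unfold Consts.KU
    linarith
  have hs := integrable_average_integral_le hm
    (fun i => (hp.meanVar_gradGHat hS i x₁ (y₁ i)).integrable_norm_sq (gradY (p.gbar i) x₁ (y₁ i)))
    (fun i => (hp.meanVar_gradGHat hS i x₁ (y₁ i)).variance_le.trans hKS)
  have hu := integrable_average_integral_le hm
    (fun i => (hp.meanVar_gradPhiHat hS i (v₁ i) x₁ (y₁ i) (hv i)).integrable_norm_sq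
      (p.gradPhi i (v₁ i) x₁ (y₁ i)))
    (fun i => (hp.meanVar_gradPhiHat hS i (v₁ i) x₁ (y₁ i) (hv i)).variance_le.trans hKU)
  have hz := (MeanVar.average univ fun i =>
    hp.meanVar_blockHat hS i x₁ (y₁ i) (v₁ i) (hv i))
  have eZ : ∀ b : Batches m S Ξ Z, p.errZ (initState p b x₁ y₁ v₁)
      = ‖(#(univ : Finset (Fin m)) : ℝ)⁻¹ • ∑ i, blockHat p b i x₁ (y₁ i) (v₁ i)
        - (#(univ : Finset (Fin m)) : ℝ)⁻¹ • ∑ i, p.block i x₁ (y₁ i) (v₁ i)‖ ^ 2 := fun b => by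
    have e0 : (#(univ : Finset (Fin m)) : ℝ) = m := by simp
    rw [Problem.errZ, Problem.hyperGrad, ← e0]
    rfl
  have hz1 : Integrable (fun b => p.errZ (initState p b x₁ y₁ v₁)) (batchesLaw p S) := by
    simp_rw [eZ]
    exact hz.integrable_norm_sq _
  have hz2 : ∫ b, p.errZ (initState p b x₁ y₁ v₁) ∂(batchesLaw p S) ≤ c.K τ / S := by
    simp_rw [eZ]
    refine hz.variance_le.trans (le_trans (le_of_eq ?_) hKU)
    rw [sum_const, card_univ, Fintype.card_fin, nsmul_eq_mul]
    field_simp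
  have hY : (m : ℝ)⁻¹ * ∑ i, ‖y₁ i - p.ySol i x₁‖ ^ 2 ≤ Dy := by
    rw [inv_mul_le_iff₀ hm']
    linarith
  have hV : (m : ℝ)⁻¹ * ∑ i, ‖v₁ i - p.vSol i x₁‖ ^ 2 ≤ 4 * c.V ^ 2 := by
    rw [inv_mul_le_iff₀ hm']
    have h1 : ∀ i ∈ (univ : Finset (Fin m)), ‖v₁ i - p.vSol i x₁‖ ^ 2 ≤ 4 * c.V ^ 2 := fun i _ => by
      have h2 := (norm_sub_le (v₁ i) (p.vSol i x₁)).trans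
        (add_le_add (hv i) (hp.norm_vSol_le hc i x₁))
      have h3 := pow_le_pow_left₀ (norm_nonneg _) h2 2
      linarith
    have := sum_le_sum h1
    rwa [sum_const, card_univ, Fintype.card_fin, nsmul_eq_mul] at this
  have hs1 : Integrable (fun b => p.errS (initState p b x₁ y₁ v₁)) (batchesLaw p S) := hs.1
  have hs2 : ∫ b, p.errS (initState p b x₁ y₁ v₁) ∂(batchesLaw p S) ≤ c.K τ / S := hs.2
  have hu1 : Integrable (fun b => p.errU (initState p b x₁ y₁ v₁)) (batchesLaw p S) := hu.1
  have hu2 : ∫ b, p.errU (initState p b x₁ y₁ v₁) ∂(batchesLaw p S) ≤ c.K τ / S := hu.2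
  have e : ∀ b : Batches m S Ξ Z, p.F x₁ - F₀ + p.lyap A (initState p b x₁ y₁ v₁)
      = A.S * p.errS (initState p b x₁ y₁ v₁) + A.U * p.errU (initState p b x₁ y₁ v₁)
        + A.Z * p.errZ (initState p b x₁ y₁ v₁)
        + (p.F x₁ - F₀ + A.Y * ((m : ℝ)⁻¹ * ∑ i, ‖y₁ i - p.ySol i x₁‖ ^ 2)
          + A.V * ((m : ℝ)⁻¹ * ∑ i, ‖v₁ i - p.vSol i x₁‖ ^ 2)) := fun b => by
    have hl : (initState p b x₁ y₁ v₁).lag = 0 := by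
      simp [State.lag, State.moveSq, initState]
    rw [Problem.lyap, hl]
    change _ + (_ + A.Y * ((m : ℝ)⁻¹ * ∑ i, ‖y₁ i - p.ySol i x₁‖ ^ 2)
      + A.V * ((m : ℝ)⁻¹ * ∑ i, ‖v₁ i - p.vSol i x₁‖ ^ 2) + _) = _
    ring
  set k₀ := p.F x₁ - F₀ + A.Y * ((m : ℝ)⁻¹ * ∑ i, ‖y₁ i - p.ySol i x₁‖ ^ 2)
    + A.V * ((m : ℝ)⁻¹ * ∑ i, ‖v₁ i - p.vSol i x₁‖ ^ 2)
  have i1 : Integrable (fun b => A.S * p.errS (initState p b x₁ y₁ v₁)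
      + A.U * p.errU (initState p b x₁ y₁ v₁)) (batchesLaw p S) :=
    (hs1.const_mul A.S).add (hu1.const_mul A.U)
  have i2 : Integrable (fun b => A.S * p.errS (initState p b x₁ y₁ v₁)
      + A.U * p.errU (initState p b x₁ y₁ v₁) + A.Z * p.errZ (initState p b x₁ y₁ v₁))
      (batchesLaw p S) := i1.add (hz1.const_mul A.Z)
  have i3 : Integrable (fun b => A.S * p.errS (initState p b x₁ y₁ v₁)
      + A.U * p.errU (initState p b x₁ y₁ v₁) + A.Z * p.errZ (initState p b x₁ y₁ v₁) + k₀)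
      (batchesLaw p S) := i2.add (integrable_const _)
  have hnn : ∀ b : Batches m S Ξ Z, 0 ≤ p.F x₁ - F₀ + p.lyap A (initState p b x₁ y₁ v₁) :=
    fun b => add_nonneg (by linarith) (p.lyap_nonneg hA _)
  simp_rw [e] at hnn ⊢
  rw [← ofReal_integral_eq_lintegral_ofReal i3 (Filter.Eventually.of_forall hnn)]
  refine ENNReal.ofReal_le_ofReal ?_
  rw [integral_add i2 (integrable_const _), integral_add i1 (hz1.const_mul A.Z),
    integral_add (hs1.const_mul A.S) (hu1.const_mul A.U),
    integral_const_mul, integral_const_mul, integral_const_mul, integral_const]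
  have j1 := mul_le_mul_of_nonneg_left hs2 hA.S
  have j2 := mul_le_mul_of_nonneg_left hu2 hA.U
  have j3 := mul_le_mul_of_nonneg_left hz2 hA.Z
  have j4 := mul_le_mul_of_nonneg_left hY hA.Y
  have j5 := mul_le_mul_of_nonneg_left hV hA.V
  have e5 : (A.S + A.U + A.Z) * c.K τ / S = A.S * (c.K τ / S) + A.U * (c.K τ / S)
    + A.Z * (c.K τ / S) := by ring
  rw [e5]
  simp only [probReal_univ, one_smul, k₀]
  linarith

section Telescope

variable {Ω : Type*} [MeasurableSpace Ω] {μ : Measure Ω} [IsProbabilityMeasure μ]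
  {I B S : ℕ} {init : Ω → Batches m S Ξ Z} {smp : ℕ → Ω → IterSample m B Ξ Z} {V τ : ℝ}
  {h : Steps} {x₁ : E dx} {y₁ v₁ : (i : Fin m) → E (dy i)}

theorem integrable_norm_gradient_run (hp : p.Assumptions c) (hc : c.Valid)
    (hS : IsSampling p I B S μ init smp) (t : ℕ) :
    Integrable (fun ω => ‖gradient p.F (run p I V τ h x₁ y₁ v₁ init smp t ω).x‖ ^ 2) μ := by
  have hr := measurable_run (V := V) (τ := τ) (h := h) (x₁ := x₁) (y₁ := y₁) (v₁ := v₁) hp hc hS t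
  have hmeas : Measurable fun ω => ‖gradient p.F (run p I V τ h x₁ y₁ v₁ init smp t ω).x‖ ^ 2 :=
    (((continuous_gradient_F hp hc).norm.pow 2).measurable.comp State.measurable_x).comp hr
  refine Integrable.of_bound hmeas.aestronglyMeasurable ((c.Cfx + c.Lgy * c.V) ^ 2)
    (Filter.Eventually.of_forall fun ω => ?_)
  rw [Real.norm_of_nonneg (by positivity)]
  exact pow_le_pow_left₀ (norm_nonneg _) (hp.norm_gradient_F_le hc _) 2

/-- Condition on the state with `lintegral_run_succ`, apply `lyap_step` from that state, and
telescope in the extended nonnegative reals. Finiteness of the initial value then gives the real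
inequality, so no integrability of the Lyapunov function is needed. -/
theorem sum_integral_norm_gradient_le (hp : p.Assumptions c) (hc : c.Valid) (hτ : 0 < τ)
    (hI : 1 ≤ I) (hIm : I ≤ m) (hB : 1 ≤ B) (hS1 : 1 ≤ S) (hS : IsSampling p I B S μ init smp)
    (hs : ∀ t, StepOk c τ h t) {A : Coeffs} (hA : A.Nonneg) {N Δ Dy η₀ : ℝ}
    (hbal : ∀ t, Balanced (c.K τ) A m I B h t N) (hN : 0 ≤ N) (hη₀ : 0 ≤ η₀)
    (hη : ∀ t, η₀ ≤ h.η t) (hΔ : ∀ x, p.F x₁ - p.F x ≤ Δ)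
    (hy : ∑ i, ‖y₁ i - p.ySol i x₁‖ ^ 2 ≤ Dy * m) (hv : ∀ i, ‖v₁ i‖ ≤ c.V) (T : ℕ) :
    η₀ / 2 * ∑ t ∈ Finset.range T,
        ∫ ω, ‖gradient p.F (run p I c.V τ h x₁ y₁ v₁ init smp t ω).x‖ ^ 2 ∂μ
      ≤ Δ + (A.S + A.U + A.Z) * c.K τ / S + A.Y * Dy + A.V * (4 * c.V ^ 2) + T * N := by
  set R := run p I c.V τ h x₁ y₁ v₁ init smp with hR
  -- This lower bound of $F$ replaces the infimum and makes the Lyapunov function nonnegative.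
  set F₀ := p.F x₁ - Δ with hF₀
  have hF : ∀ x, F₀ ≤ p.F x := fun x => by linarith [hΔ x]
  have hΔ0 : 0 ≤ Δ := by linarith [hΔ x₁]
  have hm : 1 ≤ m := hI.trans hIm
  have hm' : (0 : ℝ) < m := by exact_mod_cast hm
  have hDy : 0 ≤ Dy := by
    have : 0 ≤ ∑ i, ‖y₁ i - p.ySol i x₁‖ ^ 2 := by positivity
    nlinarith
  obtain ⟨k1, -⟩ := hc.K_bounds hτ
  set Φ₀ := Δ + (A.S + A.U + A.Z) * c.K τ / S + A.Y * Dy + A.V * (4 * c.V ^ 2) with hΦ₀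
  have hΦ0 : 0 ≤ Φ₀ := by
    have := hA.S
    have := hA.U
    have := hA.Z
    have := hA.Y
    have := hA.V
    positivity
  set φ : State m dx dy → ENNReal := fun q => ENNReal.ofReal (p.F q.x - F₀ + p.lyap A q) with hφ
  have hφm : Measurable φ := (measurable_objective_add_lyap hp hc A F₀).ennreal_ofReal
  set a : ℕ → ENNReal := fun t => ∫⁻ ω, φ (R t ω) ∂μ with ha
  set g : ℕ → ENNReal := fun t =>
    ∫⁻ ω, ENNReal.ofReal (h.η t / 2 * ‖gradient p.F (R t ω).x‖ ^ 2) ∂μ with hg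
  have hgm : ∀ t, Measurable fun ω =>
      ENNReal.ofReal (h.η t / 2 * ‖gradient p.F (R t ω).x‖ ^ 2) := fun t =>
    ((((continuous_gradient_F hp hc).norm.pow 2).measurable.comp State.measurable_x).comp
      (measurable_run hp hc hS t)).const_mul _ |>.ennreal_ofReal
  have hstep : ∀ t, a (t + 1) + g t ≤ a t + ENNReal.ofReal N := fun t => by
    have e := lintegral_run_succ (V := c.V) (τ := τ) (h := h) (x₁ := x₁) (y₁ := y₁) (v₁ := v₁)
      hp hc hIm hS t hφm
    have h1 : a t + ENNReal.ofReal N = ∫⁻ ω, (φ (R t ω) + ENNReal.ofReal N) ∂μ := by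
      rw [lintegral_add_right _ measurable_const, lintegral_const, measure_univ, mul_one]
    rw [h1]
    change (∫⁻ ω, φ (run p I c.V τ h x₁ y₁ v₁ init smp (t + 1) ω) ∂μ) + _ ≤ _
    rw [e, hg, ← lintegral_add_right _ (hgm t)]
    exact lintegral_mono fun ω => hp.lyap_step hc hτ hI hIm hB (hs t) hA (hbal t) hF
      (norm_run_v_le hc.V_nonneg hv t ω)
  have htel : ∀ T : ℕ, a T + ∑ t ∈ Finset.range T, g t ≤ a 0 + T * ENNReal.ofReal N := fun T => by
    induction T with
    | zero => simp
    | succ T ih =>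
      rw [sum_range_succ]
      calc a (T + 1) + (∑ t ∈ Finset.range T, g t + g T)
          = (a (T + 1) + g T) + ∑ t ∈ Finset.range T, g t := by ring
        _ ≤ (a T + ENNReal.ofReal N) + ∑ t ∈ Finset.range T, g t := add_le_add_left (hstep T) _
        _ = (a T + ∑ t ∈ Finset.range T, g t) + ENNReal.ofReal N := by ring
        _ ≤ (a 0 + T * ENNReal.ofReal N) + ENNReal.ofReal N := by gcongr
        _ = a 0 + (T + 1 : ℕ) * ENNReal.ofReal N := by push_cast; ring
  have ha0 : a 0 ≤ ENNReal.ofReal Φ₀ := by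
    have h1 := hp.lyap_init hc hτ hm hS1 hA (hF x₁) hy hv
    have h2 := lintegral_map (μ := μ) (hφm.comp (measurable_initState hp hc x₁ y₁ v₁))
      hS.init_measurable
    rw [hS.init_law] at h2
    refine h2.symm.le.trans ?_
    have e : p.F x₁ - F₀ = Δ := by rw [hF₀]; ring
    rw [hΦ₀, ← e]
    exact h1
  have hG := fun t => integrable_norm_gradient_run (V := c.V) (τ := τ) (h := h) (x₁ := x₁)
    (y₁ := y₁) (v₁ := v₁) hp hc hS t
  have hgt : ∀ t, ENNReal.ofReal (η₀ / 2 * ∫ ω, ‖gradient p.F (R t ω).x‖ ^ 2 ∂μ) ≤ g t :=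
    fun t => by
      rw [← integral_const_mul, ofReal_integral_eq_lintegral_ofReal ((hG t).const_mul _)
        (Filter.Eventually.of_forall fun ω => by positivity)]
      refine lintegral_mono fun ω => ENNReal.ofReal_le_ofReal ?_
      have := hη t
      gcongr
  have hfin : ENNReal.ofReal (η₀ / 2 * ∑ t ∈ Finset.range T,
      ∫ ω, ‖gradient p.F (R t ω).x‖ ^ 2 ∂μ) ≤ ENNReal.ofReal (Φ₀ + T * N) := by
    rw [mul_sum, ENNReal.ofReal_sum_of_nonneg fun t _ => by positivity,
      ENNReal.ofReal_add hΦ0 (by positivity), ENNReal.ofReal_mul (by positivity),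
      ENNReal.ofReal_natCast]
    calc ∑ t ∈ Finset.range T, ENNReal.ofReal (η₀ / 2 * ∫ ω, ‖gradient p.F (R t ω).x‖ ^ 2 ∂μ)
        ≤ ∑ t ∈ Finset.range T, g t := sum_le_sum fun t _ => hgt t
      _ ≤ a T + ∑ t ∈ Finset.range T, g t := le_add_self
      _ ≤ a 0 + T * ENNReal.ofReal N := htel T
      _ ≤ _ := by gcongr
  exact (ENNReal.ofReal_le_ofReal_iff (by positivity)).1 hfin

end Telescope

end BSVRB

namespace BSVRB

/-! ### Choice of the Lyapunov coefficients -/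

/-- Parameters of the Lyapunov coefficients (`pS`, …, `pL`) and of the step sizes (`D`, `b`, `bx`).
-/
structure Tuning where
  pS : ℝ
  pU : ℝ
  pZ : ℝ
  pY : ℝ
  pV : ℝ
  pL : ℝ
  D : ℝ
  b : ℝ
  bx : ℝ

/-- Compatibility of the parameters. -/
structure Tuning.Valid (w : Tuning) (K κ : ℝ) : Prop where
  S_pos : 0 < w.pS
  U_pos : 0 < w.pU
  Z_pos : 0 < w.pZ
  Y_pos : 0 < w.pY
  V_pos : 0 < w.pV
  L_pos : 0 < w.pL
  b_pos : 0 < w.b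
  bx_pos : 0 < w.bx
  one_le_D : 1 ≤ w.D
  V : K + 1 ≤ w.pV * κ ^ 2 / K
  Y : K + w.pV * K + 2 ≤ w.pY * κ / K
  S : w.pY * K + 1 ≤ w.pS * κ
  U : w.pV * K + 1 ≤ w.pU * κ
  Z : 1 ≤ w.pZ * κ
  L : w.pY * K + w.pV * K + 2 + 6 * K * (w.pS + w.pU + w.pZ) + 2 * K ≤ w.pL
  noise : K * (w.pS + w.pU + w.pZ + 1) ≤ κ / 8 * w.D
  b : w.pL * w.D * K * w.b ^ 2 ≤ 1
  bx : w.bx ^ 2 * (w.pY * K / (κ * w.b ^ 2) + w.pV * K / (κ ^ 2 * w.b ^ 2) + w.pL * w.D) ≤ 1 / 4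

/-- The conditions are triangular: $p_V$, then $p_Y$, then $p_S,p_U,p_Z$, then $p_L$ and $D$, then
$b$, then $b_x$. Each value is determined by equality in its own condition. -/
theorem exists_tuning {K κ : ℝ} (hK : 1 ≤ K) (hκ : 0 < κ) (hκ1 : κ ≤ 1) :
    ∃ w : Tuning, w.Valid K κ := by
  have hK0 : 0 < K := by linarith
  obtain ⟨pV, hpV⟩ : ∃ x, x = K * (K + 1) / κ ^ 2 := ⟨_, rfl⟩
  have hV : 0 < pV := by rw [hpV]; positivity
  obtain ⟨pY, hpY⟩ : ∃ x, x = K * (K + pV * K + 2) / κ := ⟨_, rfl⟩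
  have hY : 0 < pY := by rw [hpY]; positivity
  obtain ⟨pS, hpS⟩ : ∃ x, x = (pY * K + 1) / κ := ⟨_, rfl⟩
  have hS : 0 < pS := by rw [hpS]; positivity
  obtain ⟨pU, hpU⟩ : ∃ x, x = (pV * K + 1) / κ := ⟨_, rfl⟩
  have hU : 0 < pU := by rw [hpU]; positivity
  obtain ⟨pL, hpL⟩ : ∃ x, x = pY * K + pV * K + 2 + 6 * K * (pS + pU + 1 / κ) + 2 * K := ⟨_, rfl⟩
  have hL : 0 < pL := by rw [hpL]; positivity
  obtain ⟨D, hD⟩ : ∃ x, x = 8 * K * (pS + pU + 1 / κ + 1) / κ := ⟨_, rfl⟩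
  have hD1 : 1 ≤ D := by
    rw [hD, le_div_iff₀ hκ]
    have : 0 < K * (pS + pU + 1 / κ) := by positivity
    linarith
  have hD0 : 0 < D := by linarith
  obtain ⟨b, hb⟩ : ∃ x, x = (√(pL * D * K))⁻¹ := ⟨_, rfl⟩
  have hb0 : 0 < b := by rw [hb]; positivity
  obtain ⟨Q, hQ⟩ : ∃ x, x = pY * K / (κ * b ^ 2) + pV * K / (κ ^ 2 * b ^ 2) + pL * D := ⟨_, rfl⟩
  have hQ0 : 0 < Q := by rw [hQ]; positivity
  refine ⟨⟨pS, pU, 1 / κ, pY, pV, pL, D, b, (2 * √Q)⁻¹⟩, hS, hU, by positivity, hY, hV, hL, hb0,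
    by positivity, hD1, ?_, ?_, ?_, ?_, ?_, ?_, ?_, ?_, ?_⟩
  · refine le_of_eq ?_
    simp only [hpV]
    field_simp
  · refine le_of_eq ?_
    simp only [hpY]
    field_simp
  · refine le_of_eq ?_
    simp only [hpS]
    field_simp
  · refine le_of_eq ?_
    simp only [hpU]
    field_simp
  · refine le_of_eq ?_
    simp only
    field_simp
  · exact hpL.ge
  · refine le_of_eq ?_
    simp only [hD]
    field_simp
  · refine le_of_eq ?_
    simp only [hb, inv_pow]
    rw [Real.sq_sqrt (by positivity)]
    field_simp
  · refine le_of_eq ?_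
    simp only
    rw [← hQ, inv_pow, mul_pow, Real.sq_sqrt hQ0.le]
    field_simp
    norm_num

/-- Coefficients of the Lyapunov function, for the fraction `a = I / m` of selected blocks and
`r = ε / √ρ`. -/
noncomputable def Tuning.coeffs (w : Tuning) (a r α₀ : ℝ) : Coeffs where
  S := w.pS * w.bx * r / α₀
  U := w.pU * w.bx * w.D / r
  Z := w.pZ * w.bx * (a * w.D) / r
  Y := w.pY * w.bx / w.b
  V := w.pV * w.bx / w.b
  L := w.pL * w.bx * w.D / (a * r)

theorem selInd_add_le {m I B : ℕ} (hB : 1 ≤ B) :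
    selInd m I + 1 / B ≤ 2 ∧ (selInd m I + 1 / B) ≤ 2 * (B * rho m I B) := by
  have hB' : (1 : ℝ) ≤ B := by exact_mod_cast hB
  have h1 : (1 : ℝ) / B ≤ 1 := by rw [div_le_one (by linarith)]; exact hB'
  have h2 : (B : ℝ) * (1 / B) = 1 := by field_simp
  unfold selInd rho
  split_ifs
  · refine ⟨by linarith, ?_⟩
    have : 0 ≤ (B : ℝ) * (1 / I) := by positivity
    rw [mul_add, h2]
    linarith
  · refine ⟨by linarith, ?_⟩
    rw [zero_add, h2]
    linarith

theorem rho_bounds {m I B : ℕ} (hI : 1 ≤ I) (hB : 1 ≤ B) :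
    0 < rho m I B ∧ rho m I B ≤ 2 ∧ 1 ≤ B * rho m I B := by
  have hB' : (1 : ℝ) ≤ B := by exact_mod_cast hB
  have hI' : (1 : ℝ) ≤ I := by exact_mod_cast hI
  have h1 : (1 : ℝ) / B ≤ 1 := by rw [div_le_one (by linarith)]; exact hB'
  have h1' : (1 : ℝ) / I ≤ 1 := by rw [div_le_one (by linarith)]; exact hI'
  have h2 : (B : ℝ) * (1 / B) = 1 := by field_simp
  have h3 : (0 : ℝ) < 1 / B := by positivity
  have h4 : (0 : ℝ) < 1 / I := by positivity
  unfold rho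
  split_ifs
  · refine ⟨by linarith, by linarith, ?_⟩
    have : 0 ≤ (B : ℝ) * (1 / I) := by positivity
    rw [mul_add, h2]
    linarith
  · refine ⟨by linarith, by linarith, ?_⟩
    rw [zero_add, h2]

/-- The step sizes of iteration `t` are of their prescribed orders. -/
structure StepOrder (w : Tuning) (κ a r α₀ : ℝ) (h : Steps) (t : ℕ) : Prop where
  le_α : κ * α₀ ≤ h.α t
  α_le : h.α t ≤ α₀
  le_α' : κ * (r ^ 2 / w.D) ≤ h.α' t
  α'_le : h.α' t ≤ r ^ 2 / w.D
  le_β : κ * (r ^ 2 / w.D) ≤ h.β t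
  β_le : h.β t ≤ r ^ 2 / w.D
  le_τy : κ * (w.b * (a * r)) ≤ h.τy t
  τy_le : h.τy t ≤ w.b * (a * r)
  le_τv : κ ^ 2 * (w.b * (a * r)) ≤ h.τv t
  τv_le : h.τv t ≤ w.b * (a * r)
  le_η : κ * (w.bx * (a * r)) ≤ h.η t
  η_le : h.η t ≤ w.bx * (a * r)

section

variable {w : Tuning} {K κ : ℝ} (hw : w.Valid K κ) (hK : 1 ≤ K) (hκ : 0 < κ)
  {m I B : ℕ} (hI : 1 ≤ I) (hIm : I ≤ m) (hB : 1 ≤ B) {ε r α₀ : ℝ} (hε : 0 < ε) (hr : 0 < r)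
  (hr1 : r ≤ 1) (hrε : r ^ 2 * rho m I B = ε ^ 2) (hα₀ : 0 < α₀) (hα₀_le : α₀ ≤ B * ε ^ 2 / w.D)
  (hα₀_inv : α₀⁻¹ ≤ 2 + w.D / (B * ε ^ 2))

include hw hr hα₀ in
theorem Tuning.Valid.coeffs_nonneg : (w.coeffs ((I : ℝ) / m) r α₀).Nonneg := by
  have := hw.S_pos
  have := hw.U_pos
  have := hw.Z_pos
  have := hw.Y_pos
  have := hw.V_pos
  have := hw.L_pos
  have := hw.b_pos
  have := hw.bx_pos
  have := hw.one_le_D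
  have : 0 < w.D := by linarith
  have : 0 ≤ (I : ℝ) / m := by positivity
  constructor <;> simp only [Tuning.coeffs] <;> positivity

set_option maxHeartbeats 2000000 in
include hw hK hκ hI hIm hB hε hr hr1 hrε hα₀ hα₀_le hα₀_inv in
-- With weights and step sizes of the stated orders, the powers of $a$ and $r$ cancel in each
-- condition after replacing every step size by its upper or lower bound. What remains is the
-- inequality between constants of the same name in `Tuning.Valid`.
theorem Tuning.Valid.balanced {h : Steps} {t : ℕ} (ho : StepOrder w κ ((I : ℝ) / m) r α₀ h t) :
    Balanced K (w.coeffs ((I : ℝ) / m) r α₀) m I B h t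
      ((I : ℝ) / m * r * ε ^ 2 * (κ * w.bx / 8)) := by
  have hpS := hw.S_pos
  have hpU := hw.U_pos
  have hpZ := hw.Z_pos
  have hpY := hw.Y_pos
  have hpV := hw.V_pos
  have hpL := hw.L_pos
  have hb := hw.b_pos
  have hbx := hw.bx_pos
  have hD1 := hw.one_le_D
  have hD : 0 < w.D := by linarith
  have hK0 : 0 < K := by linarith
  have hI' : (0 : ℝ) < I := by exact_mod_cast hI
  have hm' : (0 : ℝ) < m := by exact_mod_cast hI.trans hIm
  have hB' : (0 : ℝ) < B := by exact_mod_cast hB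
  have hsel := selInd_add_le (m := m) (I := I) hB
  obtain ⟨hρ, hρ2, hρB⟩ := rho_bounds (m := m) hI hB
  have hmI : (m : ℝ) / I = ((I : ℝ) / m)⁻¹ := by rw [inv_div]
  have ha1 : (I : ℝ) / m ≤ 1 := by
    rw [div_le_one hm']
    exact_mod_cast hIm
  have ha : 0 < (I : ℝ) / m := by positivity
  have hθ0 : 0 ≤ selInd m I + 1 / (B : ℝ) := by
    have := selInd_nonneg m I
    positivity
  have hbal_b := hw.b
  obtain ⟨o1, o2, o3, o4, o5, o6, o7, o8, o9, o10, o11, o12⟩ := ho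
  have hA := hw.coeffs_nonneg (I := I) (m := m) hr hα₀
  obtain ⟨nS, nU, nZ, nY, nV, nL⟩ := hA
  simp only [Tuning.coeffs] at nS nU nZ nY nV nL
  obtain ⟨θ, hθ⟩ : ∃ θ, θ = selInd m I + 1 / (B : ℝ) := ⟨_, rfl⟩
  obtain ⟨ρ, hρd⟩ : ∃ ρ, ρ = rho m I B := ⟨_, rfl⟩
  obtain ⟨a, had⟩ : ∃ a, a = (I : ℝ) / m := ⟨_, rfl⟩
  rw [← hθ] at hsel hθ0
  rw [← hρd] at hsel hρ hρ2 hρB hrε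
  rw [← had] at hmI ha1 ha nZ nL o7 o8 o9 o10 o11 o12
  have hh : 0 < a * r := by positivity
  have hh1 : a * r ≤ 1 := by nlinarith
  have t1 : 0 < h.τy t := lt_of_lt_of_le (by positivity) o7
  have t2 : 0 < h.τv t := lt_of_lt_of_le (by positivity) o9
  have t3 : 0 ≤ h.η t := le_trans (by positivity) o11
  have t4 : 0 ≤ h.α t := le_trans (by positivity) o1
  have t5 : 0 ≤ h.α' t := le_trans (by positivity) o3
  have t6 : 0 ≤ h.β t := le_trans (by positivity) o5
  constructor <;> simp only [Tuning.coeffs] <;> (try rw [← had])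
  · calc h.η t * (w.pY * w.bx / w.b * K / h.τy t + w.pV * w.bx / w.b * K / h.τv t
          + w.pL * w.bx * w.D / (a * r))
        ≤ w.bx * (a * r) * (w.pY * w.bx / w.b * K / (κ * (w.b * (a * r)))
          + w.pV * w.bx / w.b * K / (κ ^ 2 * (w.b * (a * r))) + w.pL * w.bx * w.D / (a * r)) := by
          gcongr
      _ = w.bx ^ 2 * (w.pY * K / (κ * w.b ^ 2) + w.pV * K / (κ ^ 2 * w.b ^ 2) + w.pL * w.D) := by
          field_simp
      _ ≤ 1 / 4 := hw.bx
  · calc h.η t * K + w.pV * w.bx / w.b * K * h.τv t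
          + w.pL * w.bx * w.D / (a * r) * K * (h.τy t ^ 2 + h.τv t ^ 2)
        ≤ w.bx * (a * r) * K + w.pV * w.bx / w.b * K * (w.b * (a * r))
          + w.pL * w.bx * w.D / (a * r) * K * ((w.b * (a * r)) ^ 2 + (w.b * (a * r)) ^ 2) := by
          gcongr
      _ = w.bx * (a * r) * (K + w.pV * K + 2 * (w.pL * w.D * K * w.b ^ 2)) := by
          field_simp
          ring
      _ ≤ w.bx * (a * r) * (w.pY * κ / K) := by
          gcongr
          linarith [hw.Y]
      _ = w.pY * w.bx / w.b * (κ * (w.b * (a * r))) / K := by field_simp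
      _ ≤ w.pY * w.bx / w.b * h.τy t / K := by gcongr
  · calc h.η t * K + w.pL * w.bx * w.D / (a * r) * K * h.τv t ^ 2
        ≤ w.bx * (a * r) * K + w.pL * w.bx * w.D / (a * r) * K * (w.b * (a * r)) ^ 2 := by
          gcongr
      _ = w.bx * (a * r) * (K + w.pL * w.D * K * w.b ^ 2) := by field_simp
      _ ≤ w.bx * (a * r) * (w.pV * κ ^ 2 / K) := by
          gcongr
          linarith [hw.V]
      _ = w.pV * w.bx / w.b * (κ ^ 2 * (w.b * (a * r))) / K := by field_simp
      _ ≤ w.pV * w.bx / w.b * h.τv t / K := by gcongr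
  · calc w.pY * w.bx / w.b * K * h.τy t + w.pL * w.bx * w.D / (a * r) * K * h.τy t ^ 2
        ≤ w.pY * w.bx / w.b * K * (w.b * (a * r))
          + w.pL * w.bx * w.D / (a * r) * K * (w.b * (a * r)) ^ 2 := by gcongr
      _ = w.bx * (a * r) * (w.pY * K + w.pL * w.D * K * w.b ^ 2) := by field_simp
      _ ≤ w.bx * (a * r) * (w.pS * κ) := by
          gcongr
          linarith [hw.S]
      _ = w.pS * w.bx * r / α₀ * (a * (κ * α₀)) := by field_simp
      _ ≤ w.pS * w.bx * r / α₀ * (a * h.α t) := by gcongr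
  · calc w.pV * w.bx / w.b * K * h.τv t + w.pL * w.bx * w.D / (a * r) * K * h.τv t ^ 2
        ≤ w.pV * w.bx / w.b * K * (w.b * (a * r))
          + w.pL * w.bx * w.D / (a * r) * K * (w.b * (a * r)) ^ 2 := by gcongr
      _ = w.bx * (a * r) * (w.pV * K + w.pL * w.D * K * w.b ^ 2) := by field_simp
      _ ≤ w.bx * (a * r) * (w.pU * κ) := by
          gcongr
          linarith [hw.U]
      _ = w.pU * w.bx * w.D / r * (a * (κ * (r ^ 2 / w.D))) := by field_simp
      _ ≤ w.pU * w.bx * w.D / r * (a * h.α' t) := by gcongr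
  · calc h.η t ≤ w.bx * (a * r) * 1 := by rw [mul_one]; exact o12
      _ ≤ w.bx * (a * r) * (w.pZ * κ) := by
          gcongr
          exact hw.Z
      _ = w.pZ * w.bx * (a * w.D) / r * (κ * (r ^ 2 / w.D)) := by field_simp
      _ ≤ w.pZ * w.bx * (a * w.D) / r * h.β t := by gcongr
  · rw [← hθ, ← hρd, hmI]
    -- If $\alpha_0$ is the value of order $B\epsilon^2$, then $r^2/\alpha_0=D/(B\rho)$, and
    -- $\theta\le2B\rho$ compensates it; if $\alpha_0=\frac12$, then $r\le1$ suffices. The bound on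
    -- $\alpha_0^{-1}$ by a sum covers both cases.
    have hθr : θ * (r ^ 2 / α₀) ≤ 2 * θ + 2 * w.D := by
      have e1 : w.D / (B * ε ^ 2) * r ^ 2 = w.D / (B * ρ) := by
        rw [← hrε]
        field_simp
      calc θ * (r ^ 2 / α₀) = θ * (r ^ 2 * α₀⁻¹) := by rw [div_eq_mul_inv]
        _ ≤ θ * (r ^ 2 * (2 + w.D / (B * ε ^ 2))) := by gcongr
        _ = θ * (2 * r ^ 2 + w.D / (B * ρ)) := by rw [← e1]; ring
        _ = θ * 2 * r ^ 2 + θ * (w.D / (B * ρ)) := by ring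
        _ ≤ θ * 2 * 1 ^ 2 + 2 * (B * ρ) * (w.D / (B * ρ)) := by gcongr; exact hsel.2
        _ = 2 * θ + 2 * w.D := by field_simp
    have hθr' : θ * (r ^ 2 / α₀) ≤ 6 * w.D := by linarith [hsel.1]
    have ht : h.τy t ^ 2 + h.τv t ^ 2 ≤ 2 * (w.b * (a * r)) ^ 2 := by
      have j1 := pow_le_pow_left₀ t1.le o8 2
      have j2 := pow_le_pow_left₀ t2.le o10 2
      linarith
    calc w.pY * w.bx / w.b * K * h.τy t + w.pV * w.bx / w.b * K * h.τv t
          + w.pL * w.bx * w.D / (a * r) * K * (h.τy t ^ 2 + h.τv t ^ 2)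
          + (w.pS * w.bx * r / α₀ + w.pU * w.bx * w.D / r) * K * (a⁻¹ * θ)
          + (w.pZ * w.bx * (a * w.D) / r + h.η t) * K * ρ
        ≤ w.pY * w.bx / w.b * K * (w.b * (a * r)) + w.pV * w.bx / w.b * K * (w.b * (a * r))
          + w.pL * w.bx * w.D / (a * r) * K * (2 * (w.b * (a * r)) ^ 2)
          + (w.pS * w.bx * r / α₀ + w.pU * w.bx * w.D / r) * K * (a⁻¹ * θ)
          + (w.pZ * w.bx * (a * w.D) / r + w.bx * (a * r)) * K * ρ := by gcongr
      _ = w.bx / (a * r) * ((w.pY * K + w.pV * K + 2 * (w.pL * w.D * K * w.b ^ 2)) * (a * r) ^ 2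
          + K * (w.pS * (θ * (r ^ 2 / α₀)) + w.pU * w.D * θ)
          + (w.pZ * w.D * a ^ 2 + (a * r) ^ 2) * K * ρ) := by
          field_simp
      _ ≤ w.bx / (a * r) * ((w.pY * K + w.pV * K + 2 * 1) * 1 ^ 2
          + K * (w.pS * (6 * w.D) + w.pU * w.D * 2)
          + (w.pZ * w.D * 1 ^ 2 + 1 ^ 2) * K * 2) := by
          gcongr
          exact hsel.1
      _ ≤ w.bx / (a * r) * (w.pL * w.D) := by
          gcongr
          have j1 := mul_le_mul_of_nonneg_right hw.L hD.le
          have j2 : (w.pY * K + w.pV * K + 2 + 2 * K) * 1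
              ≤ (w.pY * K + w.pV * K + 2 + 2 * K) * w.D := by gcongr
          have j3 : 0 ≤ K * w.pU * w.D := by positivity
          have j4 : 0 ≤ K * w.pZ * w.D := by positivity
          linarith
      _ = w.pL * w.bx * w.D / (a * r) := by ring
  -- By $r^2/B\le\epsilon^2$, $\alpha_0/B\le\epsilon^2/D$ and $r^2\rho=\epsilon^2$, each noise term
  -- is at most a constant times $ar\epsilon^2/D$. Their sum meets the target because $D$ was chosen
  -- large.
  · rw [← hρd]
    have hrB : r ^ 2 / B ≤ ε ^ 2 := by
      rw [div_le_iff₀ hB', ← hrε]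
      have : r ^ 2 * 1 ≤ r ^ 2 * (B * ρ) := by gcongr
      linarith
    have hαB : α₀ / B ≤ ε ^ 2 / w.D := by
      rw [div_le_iff₀ hB']
      exact hα₀_le.trans (le_of_eq (by ring))
    have n1 : w.pS * w.bx * r / α₀ * K * (a * h.α t ^ 2 / B)
        ≤ w.bx * (a * r) * K * (w.pS * (ε ^ 2 / w.D)) := by
      calc w.pS * w.bx * r / α₀ * K * (a * h.α t ^ 2 / B)
          ≤ w.pS * w.bx * r / α₀ * K * (a * α₀ ^ 2 / B) := by gcongr
        _ = w.bx * (a * r) * K * (w.pS * (α₀ / B)) := by field_simp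
        _ ≤ _ := by gcongr
    have n2 : w.pU * w.bx * w.D / r * K * (a * h.α' t ^ 2 / B)
        ≤ w.bx * (a * r) * K * (w.pU * (ε ^ 2 / w.D)) := by
      calc w.pU * w.bx * w.D / r * K * (a * h.α' t ^ 2 / B)
          ≤ w.pU * w.bx * w.D / r * K * (a * (r ^ 2 / w.D) ^ 2 / B) := by gcongr
        _ = w.bx * (a * r) * K * (w.pU * (r ^ 2 / B / w.D)) := by field_simp
        _ ≤ _ := by gcongr
    have n3 : (w.pZ * w.bx * (a * w.D) / r + h.η t) * K * (h.β t ^ 2 * ρ)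
        ≤ w.bx * (a * r) * K * ((w.pZ + 1) * (ε ^ 2 / w.D)) := by
      have hrD : r ^ 2 / w.D ≤ 1 := by
        rw [div_le_one hD]
        exact (pow_le_one₀ hr.le hr1).trans hD1
      calc (w.pZ * w.bx * (a * w.D) / r + h.η t) * K * (h.β t ^ 2 * ρ)
          ≤ (w.pZ * w.bx * (a * w.D) / r + w.bx * (a * r)) * K * ((r ^ 2 / w.D) ^ 2 * ρ) := by
            gcongr
        _ = w.bx * (a * r) * K * ((w.pZ + r ^ 2 / w.D) * ((r ^ 2 * ρ) / w.D)) := by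
            field_simp
        _ ≤ _ := by
            rw [hrε]
            gcongr
    calc _ ≤ w.bx * (a * r) * K * (w.pS * (ε ^ 2 / w.D)) + w.bx * (a * r) * K * (w.pU * (ε ^ 2 / w.D))
          + w.bx * (a * r) * K * ((w.pZ + 1) * (ε ^ 2 / w.D)) := add_le_add (add_le_add n1 n2) n3
      _ = w.bx * (a * r) * (ε ^ 2 / w.D) * (K * (w.pS + w.pU + w.pZ + 1)) := by ring
      _ ≤ w.bx * (a * r) * (ε ^ 2 / w.D) * (κ / 8 * w.D) := by
          exact mul_le_mul_of_nonneg_left hw.noise (by positivity)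
      _ = a * r * ε ^ 2 * (κ * w.bx / 8) := by field_simp

end

end BSVRB

namespace BSVRB

variable {m dx : ℕ} {dy : Fin m → ℕ} {Ξ Z : Type*} [MeasurableSpace Ξ] [MeasurableSpace Z]
  {p : Problem m dx dy Ξ Z} {c : Consts}

/-! ### The constants in the step sizes -/

/-- Upper bound for the step sizes of `v`. -/
noncomputable def Consts.capV (c : Consts) : ℝ :=
  min (min (c.lam / (8 * c.Lg ^ 2)) (c.lam / 2)) (min (1 / c.lam) (1 / (2 * √1)))

/-- The constants in the step sizes. -/
noncomputable def Tuning.stepConsts (w : Tuning) (c : Consts) (r₀ : ℝ) : StepConsts where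
  LF := 2 * c.KF + 1
  Lφ := c.Lg
  C6 := 1
  C8 := w.b ^ 2 * w.D / min 1 (w.b ^ 2 * w.D)
  C9 := w.D / 18
  C11 := w.bx ^ 2
  Cτ := w.b ^ 2 * w.D
  c₀ := r₀ ^ 2

/-- A bound for `ε / √ρ` that makes the remaining caps on the step sizes inactive. -/
structure SmallScale (w : Tuning) (c : Consts) (τ r₀ : ℝ) : Prop where
  pos : 0 < r₀
  le_half : r₀ ≤ 1 / 2
  η : 2 * (2 * c.KF + 1) * w.bx * r₀ ≤ 1
  capV : w.b * r₀ ≤ c.capV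
  lam : τ * w.b * c.lam * r₀ ≤ 1
  Lg : τ * w.b * c.Lg ^ 2 * r₀ ≤ c.lam

theorem Consts.Valid.capV_pos (hc : c.Valid) : 0 < c.capV := by
  have := hc.lam_pos
  have := hc.Lg_pos
  unfold Consts.capV
  rw [Real.sqrt_one]
  refine lt_min (lt_min ?_ ?_) (lt_min ?_ ?_) <;> positivity

/-- Finitely many conditions of the form $xr\le y$ with $y>0$, all true for small $r>0$. -/
theorem exists_smallScale (hc : c.Valid) (w : Tuning) (τ : ℝ) : ∃ r₀, SmallScale w c τ r₀ := by
  have key : ∀ x y : ℝ, 0 < y → ∀ᶠ r in nhdsWithin (0 : ℝ) (Set.Ioi 0), x * r ≤ y := by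
    intro x y hy
    have h1 : Filter.Tendsto (fun r : ℝ => x * r) (nhds 0) (nhds (x * 0)) :=
      (continuous_const.mul continuous_id).tendsto 0
    rw [mul_zero] at h1
    exact ((h1.eventually (eventually_lt_nhds hy)).filter_mono nhdsWithin_le_nhds).mono
      fun r hr => hr.le
  have hpos : ∀ᶠ r in nhdsWithin (0 : ℝ) (Set.Ioi 0), 0 < r := self_mem_nhdsWithin
  obtain ⟨r, h0, h1, h2, h3, h4, h5⟩ := (hpos.and ((key 1 (1 / 2) (by norm_num)).and
    ((key (2 * (2 * c.KF + 1) * w.bx) 1 one_pos).and ((key w.b c.capV hc.capV_pos).and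
    ((key (τ * w.b * c.lam) 1 one_pos).and
      (key (τ * w.b * c.Lg ^ 2) c.lam hc.lam_pos)))))).exists
  exact ⟨r, h0, by linarith, h2, h3, h4, h5⟩

theorem Tuning.Valid.stepConsts_pos {w : Tuning} {K κ : ℝ} (hw : w.Valid K κ) (hc : c.Valid)
    {r₀ : ℝ} (hr₀ : 0 < r₀) : (w.stepConsts c r₀).Pos := by
  have := hw.b_pos
  have := hw.bx_pos
  have : 0 < w.D := by linarith [hw.one_le_D]
  have := hc.KF_nonneg
  have := hc.Lg_pos
  have : 0 < min 1 (w.b ^ 2 * w.D) := lt_min one_pos (by positivity)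
  constructor <;> simp only [Tuning.stepConsts] <;> positivity

section

variable {w : Tuning} {K κ τ r₀ : ℝ} (hw : w.Valid K κ) (hc : c.Valid) (hκ : 0 < κ) (hκ1 : κ ≤ 1)
  (hτ : 0 < τ) (hr₀ : SmallScale w c τ r₀)
  {I B : ℕ} (hI : 1 ≤ I) (hIm : I ≤ m) (hB : 1 ≤ B) {ε : ℝ} (hε : 0 < ε)
  (hεr : ε ^ 2 ≤ r₀ ^ 2 * rho m I B)

include hI hB hε in
theorem scale_sq : ((√(rho m I B))⁻¹ * ε) ^ 2 * rho m I B = ε ^ 2 := by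
  obtain ⟨hρ, -, -⟩ := rho_bounds (m := m) hI hB
  rw [mul_pow, inv_pow, Real.sq_sqrt hρ.le]
  field_simp

include hI hB hε hr₀ hεr in
theorem SmallScale.scale_le : (√(rho m I B))⁻¹ * ε ≤ r₀ := by
  obtain ⟨hρ, -, -⟩ := rho_bounds (m := m) hI hB
  refine le_of_sq_le_sq ?_ hr₀.pos.le
  have h1 := scale_sq (m := m) hI hB hε
  rw [← h1] at hεr
  exact le_of_mul_le_mul_right hεr hρ

include hw hc hκ hκ1 hτ hr₀ hI hIm hB hε hεr in
-- The range $\epsilon^2\le r_0^2\rho$ means $r\le r_0$, which makes the caps on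
-- $\bar\alpha,\bar\tau_t,\eta$ inactive and leaves pure orders in $a$ and $r$. Only $\alpha$ keeps
-- its cap $\frac12$, since $B\epsilon^2$ need not be small.
theorem SmallScale.stepOrder_and_stepOk {h : Steps}
    (hh : h.Admissible c.lam (w.stepConsts c r₀) κ m I B ε) (t : ℕ) :
    StepOrder w κ ((I : ℝ) / m) ((√(rho m I B))⁻¹ * ε) (min (1 / 2) (B * ε ^ 2 / w.D)) h t
      ∧ StepOk c τ h t := by
  have hb := hw.b_pos
  have hbx := hw.bx_pos
  have hD1 := hw.one_le_D
  have hD : 0 < w.D := by linarith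
  have hl := hc.lam_pos
  have hLg := hc.Lg_pos
  have hKF := hc.KF_nonneg
  have hI' : (0 : ℝ) < I := by exact_mod_cast hI
  have hm' : (0 : ℝ) < m := by exact_mod_cast hI.trans hIm
  have hB' : (0 : ℝ) < B := by exact_mod_cast hB
  obtain ⟨hρ, hρ2, hρB⟩ := rho_bounds (m := m) hI hB
  have hrr := hr₀.scale_le (m := m) hI hB hε hεr
  have hrs := scale_sq (m := m) hI hB hε
  have hr₀' := hr₀.pos
  obtain ⟨hα, hα', hβ, hτy, hτv, hη⟩ := hh
  simp only [Tuning.stepConsts] at hα hα' hβ hτy hτv hη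
  have hr : 0 < (√(rho m I B))⁻¹ * ε := by positivity
  -- The identities `e1` to `e5` explain the chosen constants: $18C_9'=D$ gives $\bar\alpha$ and
  -- $\beta$ the order $r^2/D$, $C_8'$ makes the factor of $\tau_t$ equal to $b$, and
  -- $\sqrt{C_{\bar\tau}}=b\sqrt D$ cancels the $\sqrt D$ coming from $\sqrt{\bar\alpha}$.
  have e1 : 1 / (18 * (w.D / 18)) * (rho m I B)⁻¹ * ε ^ 2
      = ((√(rho m I B))⁻¹ * ε) ^ 2 / w.D := by
    rw [← hrs]
    field_simp
  have e2 : (B : ℝ) / (18 * (w.D / 18)) * ε ^ 2 = B * ε ^ 2 / w.D := by field_simp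
  have e3 : √(w.b ^ 2 * w.D / min 1 (w.b ^ 2 * w.D) * min 1 (w.b ^ 2 * w.D) / (18 * (w.D / 18)))
      = w.b := by
    have : 0 < min 1 (w.b ^ 2 * w.D) := lt_min one_pos (by positivity)
    rw [div_mul_cancel₀ _ this.ne', show w.b ^ 2 * w.D / (18 * (w.D / 18)) = w.b ^ 2 by field_simp,
      Real.sqrt_sq hb.le]
  have e4 : √(w.bx ^ 2) = w.bx := Real.sqrt_sq hbx.le
  have e5 : √(w.b ^ 2 * w.D) = w.b * √w.D := by
    rw [Real.sqrt_mul (by positivity), Real.sqrt_sq hb.le]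
  rw [e1] at hα' hβ
  rw [e2] at hα
  rw [e3] at hτy
  rw [e4] at hη
  rw [e5] at hτv
  obtain ⟨a, ha⟩ : ∃ a, a = (I : ℝ) / m := ⟨_, rfl⟩
  obtain ⟨r, hrd⟩ : ∃ r, r = (√(rho m I B))⁻¹ * ε := ⟨_, rfl⟩
  have ha0 : 0 < a := by rw [ha]; positivity
  have ha1 : a ≤ 1 := by
    rw [ha, div_le_one hm']
    exact_mod_cast hIm
  rw [← ha, ← hrd]
  rw [← hrd] at hrr hrs hr hα' hβ
  have hr2 : r ^ 2 / w.D ≤ 1 / 2 := by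
    have j1 : r ^ 2 ≤ r₀ ^ 2 := pow_le_pow_left₀ hr.le hrr 2
    have j2 : r₀ ^ 2 ≤ (1 / 2) ^ 2 := pow_le_pow_left₀ hr₀'.le hr₀.le_half 2
    rw [div_le_iff₀ hD]
    linarith
  have har : a * r ≤ r₀ := by nlinarith
  have har0 : 0 < a * r := by positivity
  rw [min_eq_right hr2] at hα'
  have e6 : w.bx * I / m * (√(rho m I B))⁻¹ * ε = w.bx * (a * r) := by rw [ha, hrd]; ring
  have e7 : w.b * (I / m) * (√(rho m I B))⁻¹ * ε = w.b * (a * r) := by rw [ha, hrd]; ring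
  rw [e6] at hη
  rw [e7] at hτy
  have hbxr : w.bx * (a * r) ≤ 1 / (2 * (2 * c.KF + 1)) := by
    rw [le_div_iff₀ (by positivity)]
    have : w.bx * (a * r) * (2 * (2 * c.KF + 1)) ≤ w.bx * r₀ * (2 * (2 * c.KF + 1)) := by gcongr
    linarith [hr₀.η]
  rw [min_eq_right hbxr] at hη
  have hbr : w.b * (a * r) ≤ w.b * r₀ := by gcongr
  have hα'u : √(h.α' t) ≤ r / √w.D := by
    refine (Real.sqrt_le_sqrt (hα' t).2).trans (le_of_eq ?_)
    rw [Real.sqrt_div (by positivity), Real.sqrt_sq hr.le]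
  -- The bound on $\bar\tau_t$ involves $\bar\alpha_t$, itself known only up to $\kappa$. This costs
  -- a second factor $\kappa$, whence $\kappa^2$ in `StepOrder`.
  have hα'l : κ * (r / √w.D) ≤ √(h.α' t) := by
    refine le_trans (le_of_eq_of_le ?_ (Real.sqrt_le_sqrt (?_ : κ ^ 2 * (r ^ 2 / w.D) ≤ _)))
      (Real.sqrt_le_sqrt (hα' t).1)
    · rw [Real.sqrt_mul (by positivity), Real.sqrt_sq hκ.le, Real.sqrt_div (by positivity),
        Real.sqrt_sq hr.le]
    · have : κ ^ 2 ≤ κ := by nlinarith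
      gcongr
  have hsD : 0 < √w.D := Real.sqrt_pos.2 hD
  have hvu : w.b * √w.D * I / m * √(h.α' t) ≤ w.b * (a * r) := by
    calc w.b * √w.D * I / m * √(h.α' t) ≤ w.b * √w.D * I / m * (r / √w.D) := by gcongr
      _ = w.b * (a * r) := by
        rw [ha]
        field_simp
  have hvl : κ * (w.b * (a * r)) ≤ w.b * √w.D * I / m * √(h.α' t) := by
    calc κ * (w.b * (a * r)) = w.b * √w.D * I / m * (κ * (r / √w.D)) := by
          rw [ha]
          field_simp
      _ ≤ w.b * √w.D * I / m * √(h.α' t) := by gcongr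
  have hτv' := hτv t
  change Comparable κ (h.τv t) (min c.capV _) at hτv'
  rw [min_eq_right (hvu.trans (hbr.trans hr₀.capV))] at hτv'
  have hτv1 : h.τv t ≤ c.capV := (hτv'.2.trans hvu).trans (hbr.trans hr₀.capV)
  have hα₀ : 0 < min (1 / 2) (B * ε ^ 2 / w.D) := lt_min (by norm_num) (by positivity)
  refine ⟨⟨(hα t).1, (hα t).2, (hα' t).1, (hα' t).2, (hβ t).1, (hβ t).2, (hτy t).1, (hτy t).2, ?_,
    hτv'.2.trans hvu, (hη t).1, (hη t).2⟩, ?_⟩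
  · refine le_trans ?_ hτv'.1
    rw [pow_two, mul_assoc]
    gcongr
  have hτyu : h.τy t ≤ w.b * r₀ := (hτy t).2.trans hbr
  have hcap : c.capV ≤ c.lam / (8 * c.Lg ^ 2) ∧ c.capV ≤ 1 / c.lam :=
    ⟨(min_le_left _ _).trans (min_le_left _ _), (min_le_right _ _).trans (min_le_left _ _)⟩
  refine ⟨le_trans (by positivity) (hα t).1, (hα t).2.trans (min_le_left _ _),
    le_trans (by positivity) (hα' t).1, (hα' t).2.trans hr2, le_trans (by positivity) (hβ t).1,
    by linarith [(hβ t).2], lt_of_lt_of_le (by positivity) (hτy t).1, ?_, ?_,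
    lt_of_lt_of_le (mul_pos hκ (lt_of_lt_of_le (by positivity) hvl)) hτv'.1, ?_, ?_, le_trans (by positivity) (hη t).1, ?_⟩
  · calc τ * h.τy t * c.lam ≤ τ * (w.b * r₀) * c.lam := by gcongr
      _ = τ * w.b * c.lam * r₀ := by ring
      _ ≤ 1 := hr₀.lam
  · calc τ * h.τy t * c.Lg ^ 2 ≤ τ * (w.b * r₀) * c.Lg ^ 2 := by gcongr
      _ = τ * w.b * c.Lg ^ 2 * r₀ := by ring
      _ ≤ c.lam := hr₀.Lg
  · exact (le_div_iff₀ hl).1 (hτv1.trans hcap.2)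
  · have := (le_div_iff₀ (by positivity : 0 < 8 * c.Lg ^ 2)).1 (hτv1.trans hcap.1)
    have h0 : 0 ≤ h.τv t * c.Lg ^ 2 :=
      mul_nonneg ((by positivity : (0 : ℝ) ≤ κ * _).trans hτv'.1) (by positivity)
    linarith
  · have := (hη t).2.trans hbxr
    rw [le_div_iff₀ (by positivity)] at this
    have h0 : 0 ≤ h.η t := le_trans (by positivity) (hη t).1
    linarith

end

/-- The iteration complexity dominates the inverse of the order of the step sizes. -/
theorem inv_le_rate {m I B : ℕ} (hI : 1 ≤ I) (hIm : I ≤ m) (hB : 1 ≤ B) {ε : ℝ} (hε : 0 < ε) :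
    1 / ((I : ℝ) / m * ((√(rho m I B))⁻¹ * ε) * ε ^ 2) ≤ rate m I B ε := by
  have hI' : (0 : ℝ) < I := by exact_mod_cast hI
  have hm' : (0 : ℝ) < m := by exact_mod_cast hI.trans hIm
  have hB' : (0 : ℝ) < B := by exact_mod_cast hB
  obtain ⟨hρ, hρ2, hρB⟩ := rho_bounds (m := m) hI hB
  have hsρ : 0 < √(rho m I B) := Real.sqrt_pos.2 hρ
  have e : 1 / ((I : ℝ) / m * ((√(rho m I B))⁻¹ * ε) * ε ^ 2)
      = m / (ε ^ 3 * I) * √(rho m I B) := by field_simp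
  rw [e]
  -- Subadditivity of the square root separates the two terms of the rate.
  have hs : √(rho m I B) ≤ (if I < m then 1 / √I else 0) + 1 / √B := by
    refine Real.sqrt_le_iff.2 ⟨by split_ifs <;> positivity, ?_⟩
    unfold rho
    have h1 : (1 / √(I : ℝ)) ^ 2 = 1 / I := by rw [div_pow, one_pow, Real.sq_sqrt hI'.le]
    have h2 : (1 / √(B : ℝ)) ^ 2 = 1 / B := by rw [div_pow, one_pow, Real.sq_sqrt hB'.le]
    rw [← h1, ← h2]
    split_ifs
    · have : 0 ≤ 1 / √(I : ℝ) * (1 / √(B : ℝ)) := by positivity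
      nlinarith
    · simp
  refine (mul_le_mul_of_nonneg_left hs (by positivity)).trans (le_of_eq ?_)
  unfold rate
  split_ifs
  · field_simp
  · rw [zero_add, zero_add]
    field_simp

end BSVRB

/-! ### Initial error and assembly of the convergence bound -/

namespace BSVRB

/-- An initial mini-batch of size of order `1 / ε` suffices for the initial errors. -/
theorem Tuning.Valid.coeffs_mul_le {w : Tuning} {K κ : ℝ} (hw : w.Valid K κ) {a B ρ ε r α₀ : ℝ}
    (ha1 : a ≤ 1) (hB : 1 ≤ B) (hρ2 : ρ ≤ 2) (hρB : 1 ≤ B * ρ) (hε : 0 < ε)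
    (hr : 0 < r) (hr1 : r ≤ 1) (hrε : r ^ 2 * ρ = ε ^ 2)
    (hα₀_inv : α₀⁻¹ ≤ 2 + w.D / (B * ε ^ 2)) :
    ((w.coeffs a r α₀).S + (w.coeffs a r α₀).U + (w.coeffs a r α₀).Z) * ε
      ≤ w.bx * (w.pS * (4 + w.D) + 2 * w.pU * w.D + 2 * w.pZ * w.D) := by
  have hpS := hw.S_pos
  have hpU := hw.U_pos
  have hpZ := hw.Z_pos
  have hbx := hw.bx_pos
  have hD : 0 < w.D := by linarith [hw.one_le_D]
  have hB0 : 0 < B := by linarith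
  -- From $r^2\rho=\epsilon^2$: the bound $\rho\le2$ gives $\epsilon\le2r$, while $B\rho\ge1$ and
  -- $B\ge1$ give $r\le B\epsilon$. Hence each estimator weight is $O(1/\epsilon)$.
  have h1 : ε ≤ 2 * r := by
    refine le_of_sq_le_sq ?_ (by positivity)
    nlinarith
  have h2 : r ≤ B * ε := by
    refine le_of_sq_le_sq ?_ (by positivity)
    rw [mul_pow, ← hrε]
    have : r ^ 2 * 1 ≤ r ^ 2 * (B * (B * ρ)) := by
      gcongr
      nlinarith
    linarith
  have h3 : r * ε ≤ 2 := by nlinarith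
  have hS : w.pS * w.bx * r / α₀ * ε ≤ w.bx * (w.pS * (4 + w.D)) := by
    calc w.pS * w.bx * r / α₀ * ε = w.bx * (w.pS * (r * ε * α₀⁻¹)) := by
          rw [div_eq_mul_inv]
          ring
      _ ≤ w.bx * (w.pS * (r * ε * (2 + w.D / (B * ε ^ 2)))) := by gcongr
      _ = w.bx * (w.pS * (2 * (r * ε) + w.D * (r / (B * ε)))) := by field_simp
      _ ≤ w.bx * (w.pS * (2 * 2 + w.D * 1)) := by
          gcongr
          rw [div_le_one (by positivity)]
          exact h2
      _ = w.bx * (w.pS * (4 + w.D)) := by ring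
  have h4 : ε / r ≤ 2 := by
    rw [div_le_iff₀ hr]
    exact h1
  have hU : w.pU * w.bx * w.D / r * ε ≤ w.bx * (2 * w.pU * w.D) := by
    calc w.pU * w.bx * w.D / r * ε = w.bx * (w.pU * w.D * (ε / r)) := by field_simp
      _ ≤ w.bx * (w.pU * w.D * 2) := by gcongr
      _ = _ := by ring
  have hZ : w.pZ * w.bx * (a * w.D) / r * ε ≤ w.bx * (2 * w.pZ * w.D) := by
    calc w.pZ * w.bx * (a * w.D) / r * ε = w.bx * (w.pZ * (a * w.D) * (ε / r)) := by field_simp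
      _ ≤ w.bx * (w.pZ * (1 * w.D) * 2) := by gcongr
      _ = _ := by ring
  simp only [Tuning.coeffs]
  linarith

end BSVRB

theorem theorem5 (c : BSVRB.Consts) (hc : c.Valid)
    (τ : ℝ) (hτ0 : 0 < τ) (hτ : τ ≤ 2 / (3 * c.Lg))
    (κ : ℝ) (hκ0 : 0 < κ) (hκ1 : κ ≤ 1) :
    -- the constants in the step sizes depend only on the problem constants, `τ` and `κ`
    ∃ k : BSVRB.StepConsts, k.Pos ∧
    ∀ Δ Dy cS : ℝ, 0 < Δ → 0 < Dy → 0 < cS →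
    -- the constant in the iteration complexity
    ∃ CT : ℝ, 0 < CT ∧
    ∀ (m dx : ℕ) (dy : Fin m → ℕ) (Ξ Z Ω : Type*)
      [MeasurableSpace Ξ] [MeasurableSpace Z] [MeasurableSpace Ω]
      (p : BSVRB.Problem m dx dy Ξ Z), p.Assumptions c →
    -- `F` is `L_F`-smooth
    (Differentiable ℝ p.F ∧ ∀ x x', ‖gradient p.F x - gradient p.F x'‖ ≤ k.LF * ‖x - x'‖) ∧
    -- convergence of the algorithm
    ∀ (I B S : ℕ) (ε : ℝ), 1 ≤ I → I ≤ m → 1 ≤ B →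
      0 < ε → ε ^ 2 ≤ k.c₀ * BSVRB.rho m I B → cS / ε ≤ S →
    ∀ h : BSVRB.Steps, h.Admissible c.lam k κ m I B ε →
    ∀ (x₁ : BSVRB.E dx) (y₁ v₁ : (i : Fin m) → BSVRB.E (dy i)),
      (∀ x, p.F x₁ - p.F x ≤ Δ) →
      ∑ i, ‖y₁ i - p.ySol i x₁‖ ^ 2 ≤ Dy * m →
      (∀ i, ‖v₁ i‖ ≤ c.V) →
    ∀ (μ : MeasureTheory.Measure Ω) [MeasureTheory.IsProbabilityMeasure μ]
      (init : Ω → BSVRB.Batches m S Ξ Z) (smp : ℕ → Ω → BSVRB.IterSample m B Ξ Z),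
      BSVRB.IsSampling p I B S μ init smp →
    ∀ T : ℕ, CT * BSVRB.rate m I B ε ≤ T →
      MeasureTheory.Integrable (fun ω => (T : ℝ)⁻¹ * ∑ t ∈ Finset.range T,
        ‖gradient p.F (BSVRB.run p I c.V τ h x₁ y₁ v₁ init smp t ω).x‖ ^ 2) μ ∧
      ∫ ω, (T : ℝ)⁻¹ * ∑ t ∈ Finset.range T,
        ‖gradient p.F (BSVRB.run p I c.V τ h x₁ y₁ v₁ init smp t ω).x‖ ^ 2 ∂μ ≤ ε ^ 2 := by
  obtain ⟨hK, -⟩ := hc.K_bounds hτ0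
  obtain ⟨w, hw⟩ := BSVRB.exists_tuning hK hκ0 hκ1
  obtain ⟨r₀, hr₀⟩ := BSVRB.exists_smallScale hc w τ
  have hK0 : 0 < c.K τ := by linarith
  have hpS := hw.S_pos
  have hpU := hw.U_pos
  have hpZ := hw.Z_pos
  have hpY := hw.Y_pos
  have hpV := hw.V_pos
  have hb := hw.b_pos
  have hbx := hw.bx_pos
  have hD : 0 < w.D := by linarith [hw.one_le_D]
  refine ⟨w.stepConsts c r₀, hw.stepConsts_pos hc hr₀.pos, fun Δ Dy cS hΔ hDy hcS => ?_⟩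
  obtain ⟨C, hC⟩ : ∃ C, C = w.bx * (w.pS * (4 + w.D) + 2 * w.pU * w.D + 2 * w.pZ * w.D) := ⟨_, rfl⟩
  have hC0 : 0 < C := by rw [hC]; positivity
  obtain ⟨Φ, hΦ⟩ : ∃ Φ, Φ = Δ + C * c.K τ / cS + w.pY * w.bx / w.b * Dy
    + w.pV * w.bx / w.b * (4 * c.V ^ 2) := ⟨_, rfl⟩
  have hΦ0 : 0 < Φ := by rw [hΦ]; positivity
  -- With $\eta_0=\kappa b_xar$, telescoping gives $\frac{\eta_0}2\sum_t\mathbb E\|\nabla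
  -- F\|^2\le\Phi+T\eta_0\epsilon^2/8$. This constant is the one that makes $\Phi\le
  -- T\eta_0\epsilon^2/8$ as well.
  refine ⟨8 * Φ / (κ * w.bx), by positivity, ?_⟩
  intro m dx dy Ξ Z Ω _ _ _ p hp
  refine ⟨⟨hp.differentiable_F hc, fun x x' => (hp.norm_gradient_F_sub_le hc x x').trans ?_⟩, ?_⟩
  · have := hc.KF_nonneg
    simp only [BSVRB.Tuning.stepConsts]
    gcongr
    linarith
  intro I B S ε hI hIm hB hε hεr hS h hh x₁ y₁ v₁ hF hy hv μ _ init smp hsamp T hT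
  simp only [BSVRB.Tuning.stepConsts] at hεr
  have hI' : (0 : ℝ) < I := by exact_mod_cast hI
  have hm' : (0 : ℝ) < m := by exact_mod_cast hI.trans hIm
  have hB' : (1 : ℝ) ≤ B := by exact_mod_cast hB
  obtain ⟨hρ, hρ2, hρB⟩ := BSVRB.rho_bounds (m := m) hI hB
  have hord := hr₀.stepOrder_and_stepOk hw hc hκ0 hκ1 hτ0 hI hIm hB hε hεr hh
  have hrr := hr₀.scale_le (m := m) hI hB hε hεr
  have hrs := BSVRB.scale_sq (m := m) hI hB hε
  have hrate := BSVRB.inv_le_rate hI hIm hB hε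
  have hr : 0 < (√(BSVRB.rho m I B))⁻¹ * ε := by positivity
  have hα₀ : 0 < min (1 / 2) (B * ε ^ 2 / w.D) := lt_min (by norm_num) (by positivity)
  have hα₀_inv : (min (1 / 2) (B * ε ^ 2 / w.D))⁻¹ ≤ 2 + w.D / (B * ε ^ 2) := by
    have h1 : 0 ≤ w.D / (B * ε ^ 2) := by positivity
    rcases min_choice (1 / 2) (B * ε ^ 2 / w.D) with h2 | h2 <;> rw [h2]
    · norm_num
      exact h1
    · rw [inv_div]
      linarith
  have hα₀_le : min (1 / 2) (B * ε ^ 2 / w.D) ≤ B * ε ^ 2 / w.D := min_le_right _ _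
  generalize min (1 / 2) (B * ε ^ 2 / w.D) = α₀ at *
  generalize (√(BSVRB.rho m I B))⁻¹ * ε = r at *
  have hr1 : r ≤ 1 := by linarith [hr₀.le_half]
  have ha1 : (I : ℝ) / m ≤ 1 := by
    rw [div_le_one hm']
    exact_mod_cast hIm
  have hS0 : (0 : ℝ) < S := lt_of_lt_of_le (by positivity) hS
  have hS1 : 1 ≤ S := by exact_mod_cast hS0
  have hsum := BSVRB.sum_integral_norm_gradient_le hp hc hτ0 hI hIm hB hS1 hsamp
    (fun t => (hord t).2) (hw.coeffs_nonneg (I := I) (m := m) hr hα₀)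
    (fun t => hw.balanced hK hκ0 hI hIm hB hε hr hr1 hrs hα₀ hα₀_le hα₀_inv (hord t).1)
    (by positivity) (by positivity) (fun t => (hord t).1.le_η) hF hy hv T
  have hint := fun t => BSVRB.integrable_norm_gradient_run (V := c.V) (τ := τ) (h := h) (x₁ := x₁)
    (y₁ := y₁) (v₁ := v₁) hp hc hsamp t
  refine ⟨(integrable_finsetSum _ fun t _ => hint t).const_mul _, ?_⟩
  rw [integral_const_mul, integral_finsetSum _ fun t _ => hint t]
  generalize ∑ t ∈ Finset.range T,
    ∫ ω, ‖gradient p.F (BSVRB.run p I c.V τ h x₁ y₁ v₁ init smp t ω).x‖ ^ 2 ∂μ = G at *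
  have hinit := hw.coeffs_mul_le (a := (I : ℝ) / m) ha1 hB' hρ2 hρB hε hr hr1 hrs
    hα₀_inv
  have hcoef := hw.coeffs_nonneg (I := I) (m := m) hr hα₀
  -- The initial batch size $S\ge c_S/\epsilon$ turns the $O(1/\epsilon)$ weights into a constant.
  have hinit' : ((w.coeffs ((I : ℝ) / m) r α₀).S + (w.coeffs ((I : ℝ) / m) r α₀).U
      + (w.coeffs ((I : ℝ) / m) r α₀).Z) * c.K τ / S ≤ C * c.K τ / cS := by
    rw [← hC] at hinit
    rw [div_le_iff₀ hε] at hS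
    have h0 := add_nonneg (add_nonneg hcoef.S hcoef.U) hcoef.Z
    rw [div_le_div_iff₀ hS0 hcS]
    generalize (w.coeffs ((I : ℝ) / m) r α₀).S + (w.coeffs ((I : ℝ) / m) r α₀).U
      + (w.coeffs ((I : ℝ) / m) r α₀).Z = s at *
    calc s * c.K τ * cS ≤ s * c.K τ * (S * ε) := by gcongr
      _ = s * ε * c.K τ * S := by ring
      _ ≤ C * c.K τ * S := by gcongr
  have hY : (w.coeffs ((I : ℝ) / m) r α₀).Y = w.pY * w.bx / w.b := rfl
  have hV : (w.coeffs ((I : ℝ) / m) r α₀).V = w.pV * w.bx / w.b := rfl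
  rw [hY, hV] at hsum
  have hh0 : 0 < (I : ℝ) / m * r := by positivity
  have hT' : 8 * Φ / (κ * w.bx) * (1 / ((I : ℝ) / m * r * ε ^ 2)) ≤ T :=
    le_trans (by gcongr) hT
  generalize (I : ℝ) / m * r = s at *
  have hT0 : (0 : ℝ) < T := lt_of_lt_of_le (by positivity) hT'
  rw [div_mul_div_comm, div_le_iff₀ (by positivity)] at hT'
  rw [inv_mul_le_iff₀ hT0]
  have hk : 0 < κ * w.bx * s := by positivity
  -- The two bounds add up to half of the right-hand side.
  have hfin : κ * w.bx * s * G ≤ κ * w.bx * s * (T * ε ^ 2) := by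
    have : 0 ≤ κ * w.bx * s * (T * ε ^ 2) := by positivity
    linarith
  exact le_of_mul_le_mul_left hfin hk
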